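/- Network model (in the plane $\mathbb R^2$). Access points form a homogeneous Poisson point process (HPPP) $\Phi_{ap}$ of intensity $\lambda_{ap}>0$, sinks form an independent HPPP $\Phi_{sk}$ of intensity $\lambda_{sk}>0$. Independently of everything else, each access point is active (forwarding its own data to its associated sink) with probability $\rho_{ap}\in(0,1)$; $\Phi_{ap,a}$ denotes the set of active access points. The typical access point $ap_0$ is the access point that has received the data of a typical sensor at a fixed location $o\in\mathbb R^2$: the nearest to $o$ among the access points not in $\Phi_{ap,a}$. It forwards these data to its nearest sink, the typical sink $sk_0$. Each access point has $M\ge 1$ antennas and uses a maximal-ratio transmission beamformer; sinks have one antenna. All access points transmit with power $P_{ap}>0$, the noise power is $\delta^2\ge 0$, and the path loss exponent is $\beta>2$. For each access point $j$, let $\mathbf g_{j,sk_0}\in\mathbb C^{1\times M}$ be its channel vector to the typical sink and $\mathbf h_{j,sk_j}\in\mathbb C^{1\times M}$ its channel vector to its own associated sink; all these vectors are independent of each other, of the locations and of the activities, with i.i.d. circularly symmetric complex Gaussian entries of mean $0$ and variance $1$ (Rayleigh fading). With $|X_{j,sk_0}|$ the distance from access point $j$ to $sk_0$, the SINR at the typical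 sink is $$\gamma_{sk}=\frac{\|\mathbf g_{ap_0,sk_0}\|^2\,|X_{ap_0,sk_0}|^{-\beta}}{\sum_{j\in\Phi_{ap,a}\setminus\{ap_0\}}\Big|\mathbf g_{j,sk_0}\frac{\mathbf h_{j,sk_j}^\dagger}{\|\mathbf h_{j,sk_j}\|}\Big|^2|X_{j,sk_0}|^{-\beta}+\delta^2/P_{ap}}.$$ Lemma. Put $\Lambda_2=\lambda_{ap}\rho_{ap}\,\pi\,\Gamma(1+2/\beta)\,\Gamma(1-2/\beta)$ and, for $r>0$, $$E(r)=\exp\Big\{-\Lambda_2\,\gamma_{th}^{2/\beta}r^2-\frac{\gamma_{th}r^\beta\delta^2}{P_{ap}}-\pi\lambda_{sk}r^2\Big\}.$$ Then $\gamma_{sk}$ is a random variable with values in $[0,\infty]$, and for every $\gamma_{th}\ge 0$ its CDF $F_{\gamma_{sk}}(\gamma_{th})=\Pr[\gamma_{sk}\le\gamma_{th}]$ is $$F_{\gamma_{sk}}(\gamma_{th})=1-2\pi\lambda_{sk}\int_0^\infty rE(r)\,dr-2\pi\lambda_{sk}\sum_{m=1}^{M-1}\frac1{(-1)^m}\sum_{(m_1,\dots,m_m)}\frac1{\prod_{l=1}^m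 m_l!\,(l!)^{m_l}}\int_0^\infty r^{\beta m+1}E(r)\Big[-\Lambda_2\tfrac2\beta\gamma_{th}^{2/\beta}r^{2-\beta}-\frac{\gamma_{th}\delta^2}{P_{ap}}\Big]^{m_1}\prod_{l=2}^m\Big[-\Lambda_2\gamma_{th}^{2/\beta}\Big(\prod_{j=0}^{l-1}\big(\tfrac2\beta-j\big)\Big)r^{2-l\beta}\Big]^{m_l}dr,$$ where the inner sum runs over all tuples of nonnegative integers with $\sum_{l=1}^m l\,m_l=m$, and all the integrals converge absolutely. -/

import Mathlib

open MeasureTheory ProbabilityTheory Set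
open scoped ENNReal NNReal Nat

noncomputable section

namespace SensorNet

/-- The Euclidean plane in which all nodes live. -/
abbrev Plane : Type := EuclideanSpace ℝ (Fin 2)

/-- Fading vectors of an `M`-antenna array. -/
abbrev Chan (M : ℕ) : Type := EuclideanSpace ℂ (Fin M)

/-! ### Poisson point processes -/

/-- Number of points of the enumerated configuration `x` that fall in `A`. -/
def count (x : ℕ → Plane) (A : Set Plane) : ℕ∞ := {i | x i ∈ A}.encard

/-- `X 0, X 1, …` is an enumeration (by random points) of a homogeneous Poisson point process of
intensity `lam` on the plane: the number of points in a Borel set of finite area is Poisson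
distributed with mean `lam` times the area, and the numbers of points in disjoint sets are
independent. -/
structure IsHPPP {Ω : Type*} [MeasurableSpace Ω] (μ : Measure Ω) (X : ℕ → Ω → Plane)
    (lam : ℝ) : Prop where
  measurable : ∀ i, Measurable (X i)
  count_law : ∀ A : Set Plane, MeasurableSet A → volume A ≠ ∞ → ∀ n : ℕ,
    μ {ω | count (fun i => X i ω) A = n}
      = poissonMeasure (lam * volume.real A).toNNReal {n}
  count_indep : ∀ (n : ℕ) (A : Fin n → Set Plane), (∀ k, MeasurableSet (A k)) →
    (∀ k, volume (A k) ≠ ∞) → Pairwise (fun k l => Disjoint (A k) (A l)) →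
    iIndepFun (fun k ω => count (fun i => X i ω) (A k)) μ

/-! ### Rayleigh fading -/

/-- The circularly symmetric complex Gaussian law with mean zero and unit variance. -/
def complexGaussian : Measure ℂ :=
  ((gaussianReal 0 2⁻¹).prod (gaussianReal 0 2⁻¹)).map (fun p => (⟨p.1, p.2⟩ : ℂ))

/-- Rayleigh fading law of an `M`-antenna channel vector: i.i.d. `complexGaussian` entries. -/
def rayleigh (M : ℕ) : Measure (Chan M) :=
  (Measure.pi (fun _ : Fin M => complexGaussian)).map (WithLp.toLp 2)

/-! ### The network -/

/-- The random network seen by the link from the typical access point to the typical sink.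
* `X j` are the access points, a Poisson process of intensity `lamAP`;
* `S k` are the sinks, a Poisson process of intensity `lamSK`;
* `T j` tells whether access point `j` is active (forwarding its own data to a sink), which happens
  with probability `rho`, independently for all access points;
* `G j` is the channel vector from access point `j` to the typical sink;
* `H j` is the channel vector from access point `j` to the sink with which it is associated.
Locations of access points, locations of sinks, activities and fading are independent. -/
structure IsNetwork {Ω : Type*} [MeasurableSpace Ω] (μ : Measure Ω) (M : ℕ)
    (lamAP lamSK rho : ℝ) (X S : ℕ → Ω → Plane) (T : ℕ → Ω → Bool)
    (G H : ℕ → Ω → Chan M) : Prop where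
  ap : IsHPPP μ X lamAP
  sink : IsHPPP μ S lamSK
  act_measurable : ∀ j, Measurable (T j)
  act_law : ∀ j, μ {ω | T j ω = true} = ENNReal.ofReal rho
  act_indep : iIndepFun T μ
  g_measurable : ∀ j, Measurable (G j)
  g_law : ∀ j, μ.map (G j) = rayleigh M
  g_indep : iIndepFun G μ
  h_measurable : ∀ j, Measurable (H j)
  h_law : ∀ j, μ.map (H j) = rayleigh M
  h_indep : iIndepFun H μ
  indep_ap : IndepFun (fun ω j => X j ω)
    (fun ω => ((fun j => S j ω), (fun j => T j ω), (fun j => G j ω), (fun j => H j ω))) μ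
  indep_sink : IndepFun (fun ω j => S j ω)
    (fun ω => ((fun j => T j ω), (fun j => G j ω), (fun j => H j ω))) μ
  indep_act : IndepFun (fun ω j => T j ω)
    (fun ω => ((fun j => G j ω), (fun j => H j ω))) μ
  indep_fading : IndepFun (fun ω j => G j ω) (fun ω j => H j ω) μ

/-- The index of the point nearest to `z` among the `x i` with `p i` (the least such index in case
of ties; the value `0` if there is no nearest point). -/
def nearest (p : ℕ → Prop) (x : ℕ → Plane) (z : Plane) : ℕ :=
  sInf {i | p i ∧ ∀ j, p j → dist (x i) z ≤ dist (x j) z}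

/-- The typical access point: the one that receives the data of the typical sensor located at `o`,
i.e. the nearest one to `o` among the access points that are not busy forwarding other data. -/
def typicalAP (o : Plane) (x : ℕ → Plane) (t : ℕ → Bool) : ℕ :=
  nearest (fun i => t i = false) x o

/-- The typical sink: the one nearest to the location `z` of the typical access point. -/
def typicalSink (s : ℕ → Plane) (z : Plane) : ℕ :=
  nearest (fun _ => True) s z

/-- Power gain `|g hᴴ / ‖h‖|²` of the channel `g` under the MRT beamformer `hᴴ / ‖h‖`. -/
def beamGain {M : ℕ} (g h : Chan M) : ℝ := (‖inner ℂ h g‖ / ‖h‖) ^ 2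

/-- Interference at the location `y` from all active access points other than access point `a`,
with path loss exponent `β`. -/
def interference {M : ℕ} (β : ℝ) (x : ℕ → Plane) (t : ℕ → Bool) (g h : ℕ → Chan M) (a : ℕ)
    (y : Plane) : ℝ≥0∞ :=
  ∑' j, if t j = true ∧ j ≠ a then
    ENNReal.ofReal (beamGain (g j) (h j)) * edist (x j) y ^ (-β) else 0

/-- The SINR at the typical sink, for a given realization of the network; `P` is the transmit
power of the access points and `δ ^ 2` the noise power. -/
def sinr {M : ℕ} (β δ P : ℝ) (o : Plane) (x s : ℕ → Plane) (t : ℕ → Bool) (g h : ℕ → Chan M) :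
    ℝ≥0∞ :=
  let a := typicalAP o x t
  let y := s (typicalSink s (x a))
  ENNReal.ofReal (‖g a‖ ^ 2) * edist (x a) y ^ (-β)
    / (interference β x t g h a y + ENNReal.ofReal (δ ^ 2 / P))

/-! ### The closed form -/

/-- The constant `Λ₂ = λ_ap ρ_ap π Γ(1 + 2/β) Γ(1 - 2/β)`. -/
def lambdaTwo (β lamAP rho : ℝ) : ℝ :=
  lamAP * rho * Real.pi * Real.Gamma (1 + 2 / β) * Real.Gamma (1 - 2 / β)

/-- The exponential factor common to all integrands. -/
def expFactor (β δ P lamAP lamSK rho γ r : ℝ) : ℝ :=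
  Real.exp (-(lambdaTwo β lamAP rho * γ ^ (2 / β) * r ^ 2) - γ * r ^ β * δ ^ 2 / P
    - Real.pi * lamSK * r ^ 2)

/-- The tuples `(m₁, …, m_m)` of natural numbers with `∑ l · m_l = m`; the entry `m_l` is
stored at position `l - 1`. -/
def multiplicities (m : ℕ) : Finset (Fin m → ℕ) :=
  (Fintype.piFinset (fun _ : Fin m => Finset.range (m + 1))).filter
    (fun k => ∑ i : Fin m, ((i : ℕ) + 1) * k i = m)

theorem mem_multiplicities {m : ℕ} {k : Fin m → ℕ} :
    k ∈ multiplicities m ↔ ∑ i : Fin m, ((i : ℕ) + 1) * k i = m := by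
  simp only [multiplicities, Finset.mem_filter, Fintype.mem_piFinset, Finset.mem_range,
    and_iff_right_iff_imp]
  intro h i
  have h1 : ((i : ℕ) + 1) * k i ≤ ∑ i : Fin m, ((i : ℕ) + 1) * k i :=
    Finset.single_le_sum (f := fun i : Fin m => ((i : ℕ) + 1) * k i)
      (fun _ _ => Nat.zero_le _) (Finset.mem_univ i)
  nlinarith [Nat.zero_le ((i : ℕ) * k i)]

/-- The `l`-th bracket (`l ≥ 1`): for `l = 1` it is
`-Λ₂ (2/β) γ^(2/β) r^(2-β) - γ δ²/P`, and for `l ≥ 2` it is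
`-Λ₂ γ^(2/β) (∏_{j=0}^{l-1} (2/β - j)) r^(2-lβ)`. -/
def bracket (β δ P lamAP rho γ : ℝ) (l : ℕ) (r : ℝ) : ℝ :=
  if l = 1 then
    -(lambdaTwo β lamAP rho * (2 / β) * γ ^ (2 / β) * r ^ (2 - β)) - γ * δ ^ 2 / P
  else
    -(lambdaTwo β lamAP rho * γ ^ (2 / β) * (∏ j ∈ Finset.range l, (2 / β - (j : ℝ)))
      * r ^ (2 - (l : ℝ) * β))

/-- The integrand of the term with indices `m` and `(m₁, …, m_m)`. -/
def faaIntegrand (β δ P lamAP lamSK rho γ : ℝ) (m : ℕ) (k : Fin m → ℕ) (r : ℝ) : ℝ :=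
  r ^ (β * (m : ℝ) + 1) * expFactor β δ P lamAP lamSK rho γ r
    * ∏ i : Fin m, bracket β δ P lamAP rho γ ((i : ℕ) + 1) r ^ k i

/-- The closed form of the CDF of the SINR at the typical sink. -/
def closedForm (M : ℕ) (β δ P lamAP lamSK rho γ : ℝ) : ℝ :=
  1 - 2 * Real.pi * lamSK * (∫ r in Ioi (0 : ℝ), r * expFactor β δ P lamAP lamSK rho γ r)
    - 2 * Real.pi * lamSK * ∑ m ∈ Finset.Icc 1 (M - 1), (1 / (-1 : ℝ) ^ m) *
        ∑ k ∈ multiplicities m,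
          (1 / ∏ i : Fin m, (((k i)! : ℝ) * ((((i : ℕ) + 1)! : ℕ) : ℝ) ^ k i)) *
            ∫ r in Ioi (0 : ℝ), faaIntegrand β δ P lamAP lamSK rho γ m k r

end SensorNet

end

/-! Condition on everything except the fading of the typical link. Its power `‖g‖²` is a sum of `M`
independent unit exponentials, so the SINR exceeds `γ` with conditional probability `gammaTail M (γ
r^β J)`, where `r` is the link distance and `J` is interference plus normalized noise. Neither
depends on that fading vector, because the interference leaves out the typical access point. It
remains to find the joint law of `r` and `J`.

The delicate point is that the receiver is determined by the typical access point, which belongs to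
the same Poisson process as the interferers. Giving weight `∞` to inactive points in a set, the
marked Laplace functional shows that the inactive and the active points are independent
(`IsNetwork.laplace_active_void`); up to null events the typical access point is a function of the
inactive ones. With the sinks frozen, the receiver is a fixed point on each Voronoi cell, and the
interference has the same Laplace transform `exp (-Λ₂ x^(2/β))` at every fixed point. Hence `r` and
`J` are independent (`IsNetwork.indepFun_linkDist_interferenceNoise`), and the void probability of a
disc gives the density of `r`. In `Λ₂`, the factor `Γ(1 - 2/β)` comes from integrating the path loss
over the plane and `Γ(1 + 2/β)` is the moment of order `2/β` of the beamforming gain, a unit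
exponential variable.

Finally, the mean of `gammaTail M (θ J)` is `∑ θ^m / m!` times the `m`-th derivative at `-θ` of the
moment generating function of `J`. That function is the exponential of an explicit one, so Faà di
Bruno's formula (`iteratedDeriv_exp_comp`) yields the sums over multiplicities. Setting `θ = γ r^β`
and integrating against the density of `r` gives the closed form. -/

noncomputable section

namespace SensorNet

open Filter Topology

/-! ### The exponential on `[0, ∞]` -/

/-- The decreasing exponential `a ↦ e^{-a}` on `[0, ∞]`. -/
def expNeg (a : ℝ≥0∞) : ℝ≥0∞ := EReal.exp (-(a : EReal))

@[simp] lemma expNeg_zero : expNeg 0 = 1 := by simp [expNeg]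

@[simp] lemma expNeg_top : expNeg ∞ = 0 := by simp [expNeg]

lemma expNeg_add (a b : ℝ≥0∞) : expNeg (a + b) = expNeg a * expNeg b := by
  unfold expNeg
  rw [← EReal.exp_add, EReal.coe_ennreal_add, EReal.neg_add]
  · rfl
  · simp
  · simp

lemma expNeg_sum {ι : Type*} (s : Finset ι) (f : ι → ℝ≥0∞) :
    expNeg (∑ i ∈ s, f i) = ∏ i ∈ s, expNeg (f i) := by
  classical
  induction s using Finset.induction_on with
  | empty => simp
  | insert i s hi ih => rw [Finset.sum_insert hi, Finset.prod_insert hi, expNeg_add, ih]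

lemma continuous_expNeg : Continuous expNeg :=
  ENNReal.continuous_exp.comp (continuous_neg.comp continuous_coe_ennreal_ereal)

@[fun_prop] lemma measurable_expNeg : Measurable expNeg := continuous_expNeg.measurable

lemma expNeg_antitone : Antitone expNeg := fun _ _ h =>
  EReal.exp_monotone (EReal.neg_le_neg_iff.2 (EReal.coe_ennreal_le_coe_ennreal_iff.2 h))

lemma expNeg_le_one (a : ℝ≥0∞) : expNeg a ≤ 1 := by
  rw [← expNeg_zero]; exact expNeg_antitone zero_le

lemma expNeg_ofReal {x : ℝ} (hx : 0 ≤ x) :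
    expNeg (ENNReal.ofReal x) = ENNReal.ofReal (Real.exp (-x)) := by
  rw [expNeg, EReal.coe_ennreal_ofReal, max_eq_left hx, ← EReal.coe_neg, EReal.exp_coe]

lemma expNeg_mul_nat (a : ℝ≥0∞) (n : ℕ) : expNeg (a * n) = expNeg a ^ n := by
  induction n with
  | zero => simp
  | succ n ih => rw [Nat.cast_succ, mul_add, mul_one, expNeg_add, ih, pow_succ]

/-- The inverse `p ↦ -log p` of `expNeg` on `[0, 1]`. -/
def negLog (p : ℝ≥0∞) : ℝ≥0∞ := (-(ENNReal.log p)).toENNReal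

/-- For `p ≤ 1` the number `-log p` is nonnegative, so `toENNReal` truncates nothing; `p = 0`
corresponds to `∞`. Written in this form, averaged mark factors reduce a marked process to an
unmarked one. -/
lemma expNeg_negLog {p : ℝ≥0∞} (hp : p ≤ 1) : expNeg (negLog p) = p := by
  have h : 0 ≤ -(ENNReal.log p) := by
    rw [EReal.le_neg, neg_zero, ← ENNReal.log_one]
    exact ENNReal.log_monotone hp
  rw [expNeg, negLog, EReal.coe_toENNReal h, neg_neg, ENNReal.exp_log]

@[fun_prop] lemma measurable_negLog : Measurable negLog :=
  measurable_ereal_toENNReal.comp (continuous_neg.measurable.comp ENNReal.measurable_log)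

/-- No summability is needed, since `expNeg` is continuous at `∞` too. -/
lemma tendsto_prod_expNeg (f : ℕ → ℝ≥0∞) :
    Tendsto (fun n => ∏ j ∈ Finset.range n, expNeg (f j)) atTop (𝓝 (expNeg (∑' j, f j))) := by
  simp_rw [← expNeg_sum]
  exact (continuous_expNeg.tendsto _).comp (ENNReal.tendsto_nat_tsum f)

/-! ### Counting -/

lemma coe_count (x : ℕ → Plane) (A : Set Plane) :
    ((count x A : ℕ∞) : ℝ≥0∞) = ∑' j, A.indicator (fun _ => (1 : ℝ≥0∞)) (x j) := by
  rw [count, ← ENNReal.tsum_set_one, tsum_subtype {i | x i ∈ A} (fun _ => (1 : ℝ≥0∞))]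
  rfl

lemma measurable_count_seq {A : Set Plane} (hA : MeasurableSet A) :
    Measurable (fun x : ℕ → Plane => count x A) := by
  have h : Measurable (fun x : ℕ → Plane => ((count x A : ℕ∞) : ℝ≥0∞)) := by
    simp_rw [coe_count]
    refine Measurable.tsum fun j => ?_
    exact (measurable_const.indicator hA).comp (measurable_pi_apply j)
  refine measurable_to_countable' fun n => ?_
  have : (fun x : ℕ → Plane => count x A) ⁻¹' {n}
      = (fun x : ℕ → Plane => ((count x A : ℕ∞) : ℝ≥0∞)) ⁻¹' {(n : ℝ≥0∞)} := by
    ext x; simp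
  rw [this]
  exact h (measurableSet_singleton _)

/-! ### Laplace functional of a Poisson process -/

section Laplace

variable {Ω : Type*} [MeasurableSpace Ω] {μ : Measure Ω} {X : ℕ → Ω → Plane} {lam : ℝ}

lemma IsHPPP.measurable_count (hX : IsHPPP μ X lam) {A : Set Plane} (hA : MeasurableSet A) :
    Measurable (fun ω => count (fun i => X i ω) A) :=
  (measurable_count_seq hA).comp (measurable_pi_lambda _ hX.measurable)

lemma IsHPPP.measure_void (hX : IsHPPP μ X lam) (hlam : 0 ≤ lam) {A : Set Plane}
    (hA : MeasurableSet A) (hv : volume A ≠ ∞) :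
    μ {ω | count (fun i => X i ω) A = 0} = ENNReal.ofReal (Real.exp (-(lam * volume.real A))) := by
  have := hX.count_law A hA hv 0
  rw [Nat.cast_zero] at this
  rw [this, poissonMeasure_singleton]
  simp [hlam, mul_nonneg, measureReal_nonneg]

/-- The Poisson probabilities of the finite values already add up to one, which leaves no mass for
`⊤`. -/
lemma IsHPPP.ae_count_lt_top (hX : IsHPPP μ X lam) [IsProbabilityMeasure μ] {A : Set Plane}
    (hA : MeasurableSet A) (hv : volume A ≠ ∞) :
    ∀ᵐ ω ∂μ, count (fun i => X i ω) A ≠ ⊤ := by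
  have hm := hX.measurable_count hA
  have h1 : μ {ω | count (fun i => X i ω) A ≠ ⊤} = 1 := by
    have : {ω | count (fun i => X i ω) A ≠ ⊤}
        = ⋃ n : ℕ, {ω | count (fun i => X i ω) A = n} := by
      ext ω
      simp only [mem_ofPred_eq, mem_iUnion]
      exact ⟨fun h => ⟨_, (ENat.natCast_toNat h).symm⟩, fun ⟨n, hn⟩ => by simp [hn]⟩
    rw [this, measure_iUnion]
    · simp_rw [hX.count_law A hA hv]
      rw [← measure_iUnion]
      · rw [show (⋃ n : ℕ, {n}) = (univ : Set ℕ) by ext; simp]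
        exact measure_univ
      · intro i j hij
        simpa using hij
      · exact fun _ => measurableSet_singleton _
    · intro i j hij
      refine Set.disjoint_left.2 fun ω h1 h2 => hij ?_
      simp only [mem_ofPred_eq] at h1 h2
      exact_mod_cast h1.symm.trans h2
    · exact fun n => hm (measurableSet_singleton _)
  rw [ae_iff_measure_eq, h1, measure_univ]
  exact (hm (measurableSet_singleton ⊤).compl).nullMeasurableSet

/-- Laplace transform of a single count. -/
lemma IsHPPP.lintegral_expNeg_mul_count (hX : IsHPPP μ X lam) [IsProbabilityMeasure μ]
    (hlam : 0 ≤ lam) {A : Set Plane} (hA : MeasurableSet A) (hv : volume A ≠ ∞) (c : ℝ≥0∞) :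
    ∫⁻ ω, expNeg (c * (count (fun i => X i ω) A : ℕ∞)) ∂μ
      = expNeg (ENNReal.ofReal lam * ((1 - expNeg c) * volume A)) := by
  have hm := hX.measurable_count hA
  set N : Ω → ℕ∞ := fun ω => count (fun i => X i ω) A with hN
  have hfin := hX.ae_count_lt_top hA hv
  obtain ⟨q, hq0, hq1, hq⟩ : ∃ q : ℝ, 0 ≤ q ∧ q ≤ 1 ∧ expNeg c = ENNReal.ofReal q := by
    have h := ne_top_of_le_ne_top ENNReal.one_ne_top (expNeg_le_one c)
    refine ⟨(expNeg c).toReal, ENNReal.toReal_nonneg, ?_, (ENNReal.ofReal_toReal h).symm⟩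
    simpa using ENNReal.toReal_mono ENNReal.one_ne_top (expNeg_le_one c)
  set m : ℝ := lam * volume.real A with hmdef
  have hm0 : 0 ≤ m := mul_nonneg hlam measureReal_nonneg
  have hR : ENNReal.ofReal lam * ((1 - expNeg c) * volume A) = ENNReal.ofReal (m * (1 - q)) := by
    rw [hq, ← ENNReal.ofReal_one, ← ENNReal.ofReal_sub _ hq0, ← ofReal_measureReal hv,
      ← ENNReal.ofReal_mul (by linarith), ← ENNReal.ofReal_mul hlam]
    congr 1; rw [hmdef]; ring
  rw [hR, expNeg_ofReal (mul_nonneg hm0 (by linarith))]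
  -- Splitting by the finite value of the count leads to the generating function `e^{-m} ∑ (m q)^n /
  -- n!` with `q = e^{-c}`.
  have hdec : ∀ᵐ ω ∂μ, expNeg (c * (N ω : ℝ≥0∞))
      = ∑' n : ℕ, ({ω | N ω = n} : Set Ω).indicator (fun _ => expNeg c ^ n) ω := by
    filter_upwards [hfin] with ω hω
    obtain ⟨n, hn⟩ := ENat.ne_top_iff_exists.1 hω
    have hn' : N ω = n := hn.symm
    rw [tsum_eq_single n]
    · simp only [indicator, mem_ofPred_eq, hn', if_true]
      rw [ENat.toENNReal_coe, expNeg_mul_nat]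
    · intro k hk
      simp only [indicator, mem_ofPred_eq, hn']
      rw [if_neg]
      exact_mod_cast hk.symm
  rw [lintegral_congr_ae hdec, lintegral_tsum]
  · have : ∀ n : ℕ, ∫⁻ ω, ({ω | N ω = n} : Set Ω).indicator (fun _ => expNeg c ^ n) ω ∂μ
        = ENNReal.ofReal (Real.exp (-m) * (m * q) ^ n / n !) := by
      intro n
      have hms : MeasurableSet {ω | N ω = n} := hm (measurableSet_singleton _)
      rw [lintegral_indicator_const hms, hX.count_law A hA hv,
        poissonMeasure_singleton, hq, ← ENNReal.ofReal_pow hq0, ← ENNReal.ofReal_mul (by positivity),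
        Real.coe_toNNReal _ hm0]
      congr 1; rw [mul_pow]; ring
    simp_rw [this]
    have hs := (NormedSpace.expSeries_div_hasSum_exp (m * q)).mul_left (Real.exp (-m))
    rw [← Real.exp_eq_exp_ℝ, ← Real.exp_add] at hs
    have hs' : HasSum (fun n : ℕ => Real.exp (-m) * (m * q) ^ n / n !) (Real.exp (-m + m * q)) := by
      simpa only [mul_div_assoc] using hs
    rw [← ENNReal.ofReal_tsum_of_nonneg _ hs'.summable, hs'.tsum_eq]
    · congr 2; ring
    · intro n; positivity
  · intro n
    have hms : MeasurableSet {ω | N ω = n} := hm (measurableSet_singleton _)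
    exact (measurable_const.indicator hms).aemeasurable

/-- Laplace functional of a Poisson process, for simple functions supported in a set of finite
area. -/
lemma IsHPPP.laplace_simple (hX : IsHPPP μ X lam) [IsProbabilityMeasure μ] (hlam : 0 ≤ lam)
    (f : SimpleFunc Plane ℝ≥0∞) (hf : ∀ c ≠ 0, volume (f ⁻¹' {c}) ≠ ∞) :
    ∫⁻ ω, expNeg (∑' j, f (X j ω)) ∂μ
      = expNeg (ENNReal.ofReal lam * ∫⁻ x, (1 - expNeg (f x))) := by
  classical
  set r : Finset ℝ≥0∞ := f.range.filter (· ≠ 0) with hr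
  set e := r.equivFin.symm with he
  set A : Fin r.card → Set Plane := fun k => f ⁻¹' {(e k : ℝ≥0∞)} with hA
  have hAm : ∀ k, MeasurableSet (A k) := fun k => f.measurableSet_fiber _
  have hne : ∀ k, (e k : ℝ≥0∞) ≠ 0 := fun k => (Finset.mem_filter.1 (e k).2).2
  have hAv : ∀ k, volume (A k) ≠ ∞ := fun k => hf _ (hne k)
  have hdisj : Pairwise (fun k l => Disjoint (A k) (A l)) := by
    intro k l hkl
    refine Set.disjoint_left.2 fun x hk hl => hkl ?_
    have hk' : f x = e k := hk
    have hl' : f x = e l := hl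
    exact e.injective (Subtype.ext (hk'.symm.trans hl'))
  -- Only the nonzero level sets are kept, because they alone have finite area. They are disjoint,
  -- so the sum over the points becomes a combination of independent counts and the transform a
  -- product.
  have hfx : ∀ x, f x = ∑ c ∈ r, c * (f ⁻¹' {c}).indicator (fun _ => (1 : ℝ≥0∞)) x := by
    intro x
    by_cases h0 : f x = 0
    · rw [h0, Finset.sum_eq_zero]
      intro c hc
      rw [indicator_of_notMem, mul_zero]
      intro hx
      exact (Finset.mem_filter.1 hc).2 ((mem_singleton_iff.1 hx).symm.trans h0)
    · rw [Finset.sum_eq_single (f x)]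
      · simp
      · intro c _ hc
        rw [indicator_of_notMem, mul_zero]
        intro hx
        exact hc (mem_singleton_iff.1 hx).symm
      · intro h
        exact absurd (Finset.mem_filter.2 ⟨f.mem_range_self x, h0⟩) h
  have hsum : ∀ ω, ∑' j, f (X j ω)
      = ∑ k, (e k : ℝ≥0∞) * ((count (fun i => X i ω) (A k) : ℕ∞) : ℝ≥0∞) := by
    intro ω
    simp_rw [coe_count, ← ENNReal.tsum_mul_left]
    rw [← Summable.tsum_finsetSum (fun _ _ => ENNReal.summable)]
    refine tsum_congr fun j => ?_
    rw [hfx, ← Finset.sum_coe_sort r]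
    exact (Equiv.sum_comp e (fun c : r =>
      (c : ℝ≥0∞) * (f ⁻¹' {(c : ℝ≥0∞)}).indicator (fun _ => (1 : ℝ≥0∞)) (X j ω))).symm
  have hind := hX.count_indep r.card A hAm hAv hdisj
  have hind2 := hind.comp (fun k (n : ℕ∞) => expNeg ((e k : ℝ≥0∞) * (n : ℝ≥0∞)))
    (fun k => Measurable.of_discrete)
  simp_rw [hsum, expNeg_sum]
  have := lintegral_prod_eq_prod_lintegral_of_indepFun Finset.univ _ hind2
    (fun k => Measurable.of_discrete.comp (hX.measurable_count (hAm k)))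
  simp only [Function.comp_apply] at this
  rw [this]
  simp_rw [hX.lintegral_expNeg_mul_count hlam (hAm _) (hAv _)]
  rw [← expNeg_sum, ← Finset.mul_sum]
  congr 2
  have h1 : ∫⁻ x, (1 - expNeg (f x)) = (f.map (fun c => 1 - expNeg c)).lintegral volume := by
    rw [← SimpleFunc.lintegral_eq_lintegral]
    rfl
  rw [h1, SimpleFunc.map_lintegral, ← Finset.sum_filter_of_ne (s := f.range) (p := (· ≠ 0)), ← hr,
    ← Finset.sum_coe_sort r]
  · exact Equiv.sum_comp e (fun c : r =>
      (1 - expNeg (c : ℝ≥0∞)) * volume (f ⁻¹' {(c : ℝ≥0∞)}))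
  · intro c _ hc h0
    simp [h0] at hc

/-- Laplace functional of a Poisson process. -/
theorem IsHPPP.laplace (hX : IsHPPP μ X lam) [IsProbabilityMeasure μ] (hlam : 0 ≤ lam)
    {u : Plane → ℝ≥0∞} (hu : Measurable u) :
    ∫⁻ ω, expNeg (∑' j, u (X j ω)) ∂μ
      = expNeg (ENNReal.ofReal lam * ∫⁻ x, (1 - expNeg (u x))) := by
  set B : ℕ → Set Plane := fun n => Metric.ball 0 n with hB
  have hBm : ∀ n, MeasurableSet (B n) := fun n => measurableSet_ball
  -- Restriction to the ball of radius `n` gives the nonzero level sets finite area.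
  set f : ℕ → SimpleFunc Plane ℝ≥0∞ := fun n => (SimpleFunc.eapprox u n).restrict (B n) with hfdef
  have hfa : ∀ n x, f n x = (B n).indicator (SimpleFunc.eapprox u n) x := fun n x =>
    SimpleFunc.restrict_apply _ (hBm n) x
  have hmono : ∀ x, Monotone fun n => f n x := by
    intro x n k hnk
    simp only [hfa]
    refine (indicator_le_indicator (SimpleFunc.monotone_eapprox u hnk x)).trans ?_
    exact indicator_le_indicator_of_subset (Metric.ball_subset_ball (by exact_mod_cast hnk))
      (fun _ => zero_le) x
  have hlim : ∀ x, Tendsto (fun n => f n x) atTop (𝓝 (u x)) := by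
    intro x
    have h1 : Tendsto (fun n => SimpleFunc.eapprox u n x) atTop (𝓝 (u x)) :=
      SimpleFunc.tendsto_eapprox hu x
    refine h1.congr' ?_
    obtain ⟨n, hn⟩ := exists_nat_gt (dist x 0)
    filter_upwards [eventually_ge_atTop n] with k hk
    rw [hfa, indicator_of_mem]
    exact Metric.mem_ball.2 (hn.trans_le (by exact_mod_cast hk))
  have hfv : ∀ n, ∀ c ≠ 0, volume (f n ⁻¹' {c}) ≠ ∞ := by
    intro n c hc
    refine ne_top_of_le_ne_top (measure_ball_lt_top (x := (0 : Plane)) (r := n)).ne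
      (measure_mono fun x hx => ?_)
    by_contra hxB
    have hx' : f n x = c := hx
    rw [hfa, indicator_of_notMem hxB] at hx'
    exact hc hx'.symm
  have hL : Tendsto (fun n => ∫⁻ ω, expNeg (∑' j, f n (X j ω)) ∂μ) atTop
      (𝓝 (∫⁻ ω, expNeg (∑' j, u (X j ω)) ∂μ)) := by
    refine tendsto_lintegral_of_dominated_convergence (fun _ => 1) ?_ ?_ ?_ ?_
    · intro n
      exact measurable_expNeg.comp
        (Measurable.tsum fun j => (f n).measurable.comp (hX.measurable j))
    · exact fun n => Eventually.of_forall fun ω => expNeg_le_one _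
    · simp
    -- The sum over the points is an integral for the counting measure on indices, to which monotone
    -- convergence applies.
    · refine Eventually.of_forall fun ω => (continuous_expNeg.tendsto _).comp ?_
      have := lintegral_tendsto_of_tendsto_of_monotone (μ := Measure.count)
        (f := fun n j => f n (X j ω)) (F := fun j => u (X j ω))
        (fun n => Measurable.of_discrete.aemeasurable)
        (Eventually.of_forall fun j => hmono _) (Eventually.of_forall fun j => hlim _)
      simpa [lintegral_count] using this
  -- The limit integral may be infinite, so the convergence here is monotone rather than dominated.
  have hRm : Tendsto (fun n => ∫⁻ x, (1 - expNeg (f n x))) atTop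
      (𝓝 (∫⁻ x, (1 - expNeg (u x)))) := by
    refine lintegral_tendsto_of_tendsto_of_monotone (fun n => ?_) ?_ ?_
    · exact (measurable_const.sub (measurable_expNeg.comp (f n).measurable)).aemeasurable
    · exact Eventually.of_forall fun x n k hnk =>
        tsub_le_tsub_left (expNeg_antitone (hmono x hnk)) _
    · refine Eventually.of_forall fun x => ?_
      exact ENNReal.Tendsto.sub tendsto_const_nhds
        ((continuous_expNeg.tendsto _).comp (hlim x)) (Or.inl ENNReal.one_ne_top)
  have hR : Tendsto (fun n => expNeg (ENNReal.ofReal lam * ∫⁻ x, (1 - expNeg (f n x)))) atTop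
      (𝓝 (expNeg (ENNReal.ofReal lam * ∫⁻ x, (1 - expNeg (u x))))) :=
    (continuous_expNeg.tendsto _).comp
      (ENNReal.Tendsto.const_mul hRm (Or.inr ENNReal.ofReal_ne_top))
  refine tendsto_nhds_unique hL (hR.congr fun n => ?_)
  exact (hX.laplace_simple hlam (f n) (hfv n)).symm

end Laplace

/-! ### Independent marks: activities and fading vectors -/

instance : IsProbabilityMeasure complexGaussian := by
  unfold complexGaussian
  refine Measure.isProbabilityMeasure_map (Measurable.aemeasurable ?_)
  exact Complex.measurableEquivRealProd.symm.measurable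

instance (M : ℕ) : IsProbabilityMeasure (rayleigh M) := by
  unfold rayleigh
  exact Measure.isProbabilityMeasure_map (by fun_prop)

/-- The law of an activity indicator. -/
def actLaw (rho : ℝ) : Measure Bool :=
  ENNReal.ofReal rho • Measure.dirac true + ENNReal.ofReal (1 - rho) • Measure.dirac false

lemma isProbabilityMeasure_actLaw {rho : ℝ} (h0 : 0 ≤ rho) (h1 : rho ≤ 1) :
    IsProbabilityMeasure (actLaw rho) := by
  constructor
  simp only [actLaw, Measure.coe_add, Measure.coe_smul, Pi.add_apply, Pi.smul_apply, measure_univ,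
    smul_eq_mul, mul_one]
  rw [← ENNReal.ofReal_add h0 (by linarith)]
  simp

lemma lintegral_actLaw (rho : ℝ) (f : Bool → ℝ≥0∞) :
    ∫⁻ b, f b ∂(actLaw rho)
      = ENNReal.ofReal rho * f true + ENNReal.ofReal (1 - rho) * f false := by
  rw [actLaw, lintegral_add_measure, lintegral_smul_measure, lintegral_smul_measure,
    lintegral_dirac, lintegral_dirac]
  rfl

/-- Expectation of a product of functions of independent coordinates. -/
lemma lintegral_infinitePi_prod {α : Type*} [MeasurableSpace α] (κ : Measure α)
    [IsProbabilityMeasure κ] (s : Finset ℕ) (f : ℕ → α → ℝ≥0∞) (hf : ∀ j, Measurable (f j)) :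
    ∫⁻ a, ∏ j ∈ s, f j (a j) ∂(Measure.infinitePi fun _ : ℕ => κ) = ∏ j ∈ s, ∫⁻ v, f j v ∂κ := by
  have hind : iIndepFun (fun j (a : ℕ → α) => f j (a j)) (Measure.infinitePi fun _ : ℕ => κ) :=
    iIndepFun_infinitePi hf
  rw [lintegral_prod_eq_prod_lintegral_of_indepFun s _ hind
    (fun j => (hf j).comp (measurable_pi_apply j))]
  refine Finset.prod_congr rfl fun j _ => ?_
  conv_rhs => rw [← Measure.infinitePi_map_eval (fun _ : ℕ => κ) j]
  rw [lintegral_map (hf j) (measurable_pi_apply j)]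

/-- In an i.i.d. sequence the coordinate `i` is independent of the remaining ones. -/
lemma lintegral_infinitePi_update {α : Type*} [MeasurableSpace α] (κ : Measure α)
    [IsProbabilityMeasure κ] (i : ℕ) (c : α) (F : (ℕ → α) × α → ℝ≥0∞) (hF : Measurable F) :
    ∫⁻ a, F (Function.update a i c, a i) ∂(Measure.infinitePi fun _ : ℕ => κ)
      = ∫⁻ a, ∫⁻ v, F (Function.update a i c, v) ∂κ ∂(Measure.infinitePi fun _ : ℕ => κ) := by
  set P := Measure.infinitePi fun _ : ℕ => κ with hP
  have hind : iIndepFun (fun j (a : ℕ → α) => a j) P :=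
    iIndepFun_infinitePi (X := fun _ => id) (fun _ => measurable_id)
  have hm : ∀ j, MeasurableSpace.comap (fun a : ℕ → α => a j) inferInstance
      ≤ (inferInstance : MeasurableSpace (ℕ → α)) := fun j => (measurable_pi_apply j).comap_le
  have hI := indep_iSup_of_disjoint hm hind (S := {i}ᶜ) (T := {i}) disjoint_compl_left
  -- With coordinate `i` overwritten by a constant, the sequence is measurable with respect to the
  -- other coordinates, which are independent of coordinate `i`.
  have hu : Measurable[⨆ j ∈ ({i}ᶜ : Set ℕ), MeasurableSpace.comap (fun a : ℕ → α => a j)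
      inferInstance] (fun a : ℕ → α => Function.update a i c) := by
    refine @measurable_pi_lambda _ _ _ (_) _ _ fun j => ?_
    by_cases hj : j = i
    · subst hj
      simp only [Function.update_self]
      exact measurable_const
    · simp only [Function.update_of_ne hj]
      refine Measurable.of_comap_le ?_
      exact le_iSup₂_of_le j hj le_rfl
  have he : Measurable[⨆ j ∈ ({i} : Set ℕ), MeasurableSpace.comap (fun a : ℕ → α => a j)
      inferInstance] (fun a : ℕ → α => a i) :=
    Measurable.of_comap_le (le_iSup₂_of_le i rfl le_rfl)
  have hIF : IndepFun (fun a : ℕ → α => Function.update a i c) (fun a => a i) P :=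
    indep_of_indep_of_le_left (indep_of_indep_of_le_right hI he.comap_le) hu.comap_le
  have hum : Measurable (fun a : ℕ → α => Function.update a i c) := measurable_update_left
  have hmap := hIF.map_prod_eq_prod_map_map hum.aemeasurable (measurable_pi_apply i).aemeasurable
  have hev : P.map (fun a => a i) = κ := Measure.infinitePi_map_eval (fun _ : ℕ => κ) i
  rw [hev] at hmap
  have h1 : ∫⁻ a, F (Function.update a i c, a i) ∂P
      = ∫⁻ p, F p ∂(P.map (fun a => (Function.update a i c, a i))) :=
    (lintegral_map hF (hum.prodMk (measurable_pi_apply i))).symm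
  rw [h1, hmap, lintegral_prod _ hF.aemeasurable, lintegral_map (hF.lintegral_prod_right') hum]

lemma IsNetwork.measurable_marks {Ω : Type*} [MeasurableSpace Ω] {μ : Measure Ω}
    {M : ℕ} {lamAP lamSK rho : ℝ} {X S : ℕ → Ω → Plane} {T : ℕ → Ω → Bool} {G H : ℕ → Ω → Chan M}
    (hnet : IsNetwork μ M lamAP lamSK rho X S T G H) :
    Measurable (fun ω => ((fun j => T j ω), (fun j => G j ω), (fun j => H j ω))) :=
  (measurable_pi_lambda _ hnet.act_measurable).prodMk
    ((measurable_pi_lambda _ hnet.g_measurable).prodMk (measurable_pi_lambda _ hnet.h_measurable))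

section Network

variable {Ω : Type*} [MeasurableSpace Ω] {μ : Measure Ω} [IsProbabilityMeasure μ] {M : ℕ}
  {lamAP lamSK rho : ℝ} {X S : ℕ → Ω → Plane} {T : ℕ → Ω → Bool} {G H : ℕ → Ω → Chan M}

/-- The joint law of activities and fading vectors. -/
def markLaw (M : ℕ) (rho : ℝ) : Measure ((ℕ → Bool) × (ℕ → Chan M) × (ℕ → Chan M)) :=
  (Measure.infinitePi fun _ : ℕ => actLaw rho).prod
    ((Measure.infinitePi fun _ : ℕ => rayleigh M).prod (Measure.infinitePi fun _ : ℕ => rayleigh M))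

lemma IsNetwork.map_act (hnet : IsNetwork μ M lamAP lamSK rho X S T G H) (h0 : 0 ≤ rho)
    (j : ℕ) : μ.map (T j) = actLaw rho := by
  have ht : μ {ω | T j ω = true} = ENNReal.ofReal rho := hnet.act_law j
  refine Measure.ext_of_singleton fun b => ?_
  rw [Measure.map_apply (hnet.act_measurable j) (measurableSet_singleton _)]
  cases b
  · have : T j ⁻¹' {false} = {ω | T j ω = true}ᶜ := by ext; simp
    rw [this, prob_compl_eq_one_sub, ht]
    · simp [actLaw, ENNReal.ofReal_sub 1 h0]
    · exact hnet.act_measurable j (measurableSet_singleton true)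
  · have : T j ⁻¹' {true} = {ω | T j ω = true} := by ext; simp
    rw [this, ht]
    simp [actLaw]

lemma IsNetwork.map_marks (hnet : IsNetwork μ M lamAP lamSK rho X S T G H) (h0 : 0 ≤ rho) :
    μ.map (fun ω => ((fun j => T j ω), (fun j => G j ω), (fun j => H j ω))) = markLaw M rho := by
  have mT := measurable_pi_lambda (fun ω j => T j ω) hnet.act_measurable
  have mG := measurable_pi_lambda (fun ω j => G j ω) hnet.g_measurable
  have mH := measurable_pi_lambda (fun ω j => H j ω) hnet.h_measurable
  rw [hnet.indep_act.map_prod_eq_prod_map_map mT.aemeasurable (mG.prodMk mH).aemeasurable,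
    hnet.indep_fading.map_prod_eq_prod_map_map mG.aemeasurable mH.aemeasurable,
    hnet.act_indep.map_fun_eq_infinitePi_map hnet.act_measurable,
    hnet.g_indep.map_fun_eq_infinitePi_map hnet.g_measurable,
    hnet.h_indep.map_fun_eq_infinitePi_map hnet.h_measurable]
  simp_rw [hnet.map_act h0, hnet.g_law, hnet.h_law]
  rfl

/-- The network is a product of independent components. -/
theorem IsNetwork.map_all (hnet : IsNetwork μ M lamAP lamSK rho X S T G H) (h0 : 0 ≤ rho) :
    μ.map (fun ω => ((fun j => X j ω), (fun j => S j ω), (fun j => T j ω), (fun j => G j ω),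
      (fun j => H j ω)))
    = (μ.map (fun ω j => X j ω)).prod ((μ.map (fun ω j => S j ω)).prod (markLaw M rho)) := by
  have mX := measurable_pi_lambda (fun ω j => X j ω) hnet.ap.measurable
  have mS := measurable_pi_lambda (fun ω j => S j ω) hnet.sink.measurable
  have mM := hnet.measurable_marks
  rw [hnet.indep_ap.map_prod_eq_prod_map_map mX.aemeasurable (mS.prodMk mM).aemeasurable,
    hnet.indep_sink.map_prod_eq_prod_map_map mS.aemeasurable mM.aemeasurable, hnet.map_marks h0]

/-- The law of the access points together with their marks. -/
theorem IsNetwork.map_ap_marks (hnet : IsNetwork μ M lamAP lamSK rho X S T G H) (h0 : 0 ≤ rho) :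
    μ.map (fun ω => ((fun j => X j ω), (fun j => T j ω), (fun j => G j ω), (fun j => H j ω)))
    = (μ.map (fun ω j => X j ω)).prod (markLaw M rho) := by
  have mX := measurable_pi_lambda (fun ω j => X j ω) hnet.ap.measurable
  have mM := hnet.measurable_marks
  have hI : IndepFun (fun ω j => X j ω)
      (fun ω => ((fun j => T j ω), (fun j => G j ω), (fun j => H j ω))) μ :=
    hnet.indep_ap.comp measurable_id measurable_snd
  rw [hI.map_prod_eq_prod_map_map mX.aemeasurable mM.aemeasurable, hnet.map_marks h0]

/-- Averaging a product over independent marks. -/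
lemma lintegral_markLaw_prod (h0 : 0 ≤ rho) (h1 : rho ≤ 1) (s : Finset ℕ)
    (f : ℕ → Bool × Chan M × Chan M → ℝ≥0∞) (hf : ∀ j, Measurable (f j)) :
    ∫⁻ m, ∏ j ∈ s, f j (m.1 j, m.2.1 j, m.2.2 j) ∂(markLaw M rho)
      = ∏ j ∈ s, ∫⁻ v, f j v ∂((actLaw rho).prod ((rayleigh M).prod (rayleigh M))) := by
  have := isProbabilityMeasure_actLaw h0 h1
  have hm : ∀ j, Measurable (fun m : (ℕ → Bool) × (ℕ → Chan M) × (ℕ → Chan M) =>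
      f j (m.1 j, m.2.1 j, m.2.2 j)) := fun j => (hf j).comp (by fun_prop)
  have hmp : Measurable (fun m : (ℕ → Bool) × (ℕ → Chan M) × (ℕ → Chan M) =>
      ∏ j ∈ s, f j (m.1 j, m.2.1 j, m.2.2 j)) := Finset.measurable_prod s fun j _ => hm j
  rw [markLaw, lintegral_prod _ hmp.aemeasurable]
  have hstep : ∀ t : ℕ → Bool, ∫⁻ y : (ℕ → Chan M) × (ℕ → Chan M),
      ∏ j ∈ s, f j (t j, y.1 j, y.2 j) ∂((Measure.infinitePi fun _ : ℕ => rayleigh M).prod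
        (Measure.infinitePi fun _ : ℕ => rayleigh M))
      = ∏ j ∈ s, ∫⁻ g, ∫⁻ h, f j (t j, g, h) ∂(rayleigh M) ∂(rayleigh M) := by
    intro t
    have hmt : Measurable (fun y : (ℕ → Chan M) × (ℕ → Chan M) =>
        ∏ j ∈ s, f j (t j, y.1 j, y.2 j)) := hmp.comp measurable_prodMk_left
    rw [lintegral_prod _ hmt.aemeasurable]
    have h2 : ∀ g : ℕ → Chan M, ∫⁻ h : ℕ → Chan M, ∏ j ∈ s, f j (t j, g j, h j)
        ∂(Measure.infinitePi fun _ : ℕ => rayleigh M)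
        = ∏ j ∈ s, ∫⁻ h, f j (t j, g j, h) ∂(rayleigh M) := fun g =>
      lintegral_infinitePi_prod _ s (fun j h => f j (t j, g j, h))
        (fun j => (hf j).comp (by fun_prop))
    simp_rw [h2]
    exact lintegral_infinitePi_prod _ s (fun j g => ∫⁻ h, f j (t j, g, h) ∂(rayleigh M))
      (fun j => Measurable.lintegral_prod_right' (f := fun p : Chan M × Chan M => f j (t j, p.1, p.2))
        ((hf j).comp (by fun_prop)))
  simp_rw [hstep]
  rw [lintegral_infinitePi_prod _ s
    (fun j t => ∫⁻ g, ∫⁻ h, f j (t, g, h) ∂(rayleigh M) ∂(rayleigh M))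
    (fun j => Measurable.of_discrete)]
  refine Finset.prod_congr rfl fun j _ => ?_
  rw [lintegral_prod _ (hf j).aemeasurable]
  refine lintegral_congr fun t => ?_
  rw [lintegral_prod]
  exact ((hf j).comp measurable_prodMk_left).aemeasurable

/-- Laplace functional of the independently marked process of access points. -/
theorem IsNetwork.laplace_marked (hnet : IsNetwork μ M lamAP lamSK rho X S T G H)
    (hAP : 0 ≤ lamAP) (h0 : 0 ≤ rho) (h1 : rho ≤ 1)
    {Φ : Plane × Bool × Chan M × Chan M → ℝ≥0∞} (hΦ : Measurable Φ) :
    ∫⁻ ω, expNeg (∑' j, Φ (X j ω, T j ω, G j ω, H j ω)) ∂μ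
      = expNeg (ENNReal.ofReal lamAP * ∫⁻ x, (1 - ∫⁻ v, expNeg (Φ (x, v))
          ∂((actLaw rho).prod ((rayleigh M).prod (rayleigh M))))) := by
  have := isProbabilityMeasure_actLaw h0 h1
  have mX := measurable_pi_lambda (fun ω j => X j ω) hnet.ap.measurable
  set ν := (actLaw rho).prod ((rayleigh M).prod (rayleigh M)) with hν
  set p : Plane → ℝ≥0∞ := fun x => ∫⁻ v, expNeg (Φ (x, v)) ∂ν with hp
  have hpm : Measurable p := (measurable_expNeg.comp hΦ).lintegral_prod_right'
  have hp1 : ∀ x, p x ≤ 1 := fun x => by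
    calc p x ≤ ∫⁻ _, 1 ∂ν := lintegral_mono fun v => expNeg_le_one _
      _ = 1 := by simp
  have hF : Measurable (fun q : (ℕ → Plane) × (ℕ → Bool) × (ℕ → Chan M) × (ℕ → Chan M) =>
      expNeg (∑' j, Φ (q.1 j, q.2.1 j, q.2.2.1 j, q.2.2.2 j))) :=
    measurable_expNeg.comp (Measurable.tsum fun j => hΦ.comp (by fun_prop))
  have hstart : ∫⁻ ω, expNeg (∑' j, Φ (X j ω, T j ω, G j ω, H j ω)) ∂μ
      = ∫⁻ x, ∫⁻ m, expNeg (∑' j, Φ (x j, m.1 j, m.2.1 j, m.2.2 j)) ∂(markLaw M rho)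
        ∂(μ.map (fun ω j => X j ω)) := by
    have : IsProbabilityMeasure (μ.map (fun ω j => X j ω)) :=
      Measure.isProbabilityMeasure_map mX.aemeasurable
    have : IsProbabilityMeasure (markLaw M rho) := by unfold markLaw; infer_instance
    rw [← lintegral_prod _ hF.aemeasurable, ← hnet.map_ap_marks h0,
      lintegral_map hF (mX.prodMk hnet.measurable_marks)]
  -- For fixed points the marks average factor by factor, and each factor `p (x j)` is `expNeg` of
  -- `negLog (p (x j))`. The outcome is a functional of the unmarked process, covered by
  -- `IsHPPP.laplace`.
  have hinner : ∀ x : ℕ → Plane,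
      ∫⁻ m, expNeg (∑' j, Φ (x j, m.1 j, m.2.1 j, m.2.2 j)) ∂(markLaw M rho)
        = expNeg (∑' j, negLog (p (x j))) := by
    intro x
    have : IsProbabilityMeasure (markLaw M rho) := by unfold markLaw; infer_instance
    have hl1 : Tendsto (fun n => ∫⁻ m, ∏ j ∈ Finset.range n,
        expNeg (Φ (x j, m.1 j, m.2.1 j, m.2.2 j)) ∂(markLaw M rho)) atTop
        (𝓝 (∫⁻ m, expNeg (∑' j, Φ (x j, m.1 j, m.2.1 j, m.2.2 j)) ∂(markLaw M rho))) := by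
      refine tendsto_lintegral_of_dominated_convergence (fun _ => 1) ?_ ?_ (by simp) ?_
      · exact fun n => Finset.measurable_prod _ fun j _ =>
          measurable_expNeg.comp (hΦ.comp (by fun_prop))
      · exact fun n => Eventually.of_forall fun m => Finset.prod_le_one' fun j _ => expNeg_le_one _
      · exact Eventually.of_forall fun m => tendsto_prod_expNeg _
    have hl2 := tendsto_prod_expNeg (fun j => negLog (p (x j)))
    refine tendsto_nhds_unique hl1 (hl2.congr fun n => ?_)
    rw [lintegral_markLaw_prod h0 h1 (Finset.range n) (fun j v => expNeg (Φ (x j, v)))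
      (fun j => measurable_expNeg.comp (hΦ.comp measurable_prodMk_left))]
    exact Finset.prod_congr rfl fun j _ => expNeg_negLog (hp1 _)
  have hm2 : Measurable fun x : ℕ → Plane => expNeg (∑' j, negLog (p (x j))) :=
    measurable_expNeg.comp (Measurable.tsum fun j =>
      measurable_negLog.comp (hpm.comp (measurable_pi_apply j)))
  rw [hstart]
  simp_rw [hinner]
  rw [lintegral_map hm2 mX]
  have h2 := hnet.ap.laplace hAP (measurable_negLog.comp hpm)
  simp only [Function.comp_apply, expNeg_negLog (hp1 _)] at h2
  exact h2

end Network

/-! ### Rayleigh fading -/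

/-- The tail `e^{-s} ∑_{m < M} s^m / m!` of the Gamma law with integer shape `M`. -/
def gammaTail (M : ℕ) (s : ℝ) : ℝ := Real.exp (-s) * ∑ m ∈ Finset.range M, s ^ m / m !

/-- Variance `1/2` for each of the real and imaginary parts makes the joint density a function of
the modulus only. -/
lemma gaussianPDF_half_mul (x y : ℝ) :
    gaussianPDF 0 2⁻¹ x * gaussianPDF 0 2⁻¹ y
      = ENNReal.ofReal (Real.pi⁻¹ * Real.exp (-(x ^ 2 + y ^ 2))) := by
  have hpi := Real.pi_pos
  rw [gaussianPDF, gaussianPDF, ← ENNReal.ofReal_mul (gaussianPDFReal_nonneg _ _ _)]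
  congr 1
  simp only [gaussianPDFReal, NNReal.coe_inv, NNReal.coe_ofNat, sub_zero]
  have h1 : (2 * Real.pi * 2⁻¹ : ℝ) = Real.pi := by ring
  have h2 : ∀ z : ℝ, -z ^ 2 / (2 * 2⁻¹) = -z ^ 2 := fun z => by ring
  rw [h1, h2, h2, neg_add, Real.exp_add]
  have h3 : (√Real.pi)⁻¹ * (√Real.pi)⁻¹ = Real.pi⁻¹ := by
    rw [← mul_inv, Real.mul_self_sqrt hpi.le]
  rw [← h3]; ring

/-- The squared modulus of a standard complex Gaussian variable is exponential. -/
lemma lintegral_complexGaussian_normSq {f : ℝ → ℝ≥0∞} (hf : Measurable f) :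
    ∫⁻ z, f (‖z‖ ^ 2) ∂complexGaussian
      = ∫⁻ u in Ioi (0 : ℝ), ENNReal.ofReal (Real.exp (-u)) * f u := by
  have hpi := Real.pi_pos
  have hmk : Measurable (fun p : ℝ × ℝ => (⟨p.1, p.2⟩ : ℂ)) :=
    Complex.measurableEquivRealProd.symm.measurable
  have hnorm : ∀ p : ℝ × ℝ, ‖(⟨p.1, p.2⟩ : ℂ)‖ ^ 2 = p.1 ^ 2 + p.2 ^ 2 := by
    intro p; rw [Complex.sq_norm, Complex.normSq_mk]; ring
  have hv : (2⁻¹ : ℝ≥0) ≠ 0 := by norm_num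
  have hfz : Measurable fun z : ℂ => f (‖z‖ ^ 2) := hf.comp (by fun_prop)
  rw [complexGaussian, lintegral_map hfz hmk]
  simp_rw [hnorm]
  have hfp : Measurable fun p : ℝ × ℝ => f (p.1 ^ 2 + p.2 ^ 2) := hf.comp (by fun_prop)
  have hpdf : Measurable fun p : ℝ × ℝ => gaussianPDF 0 2⁻¹ p.1 * gaussianPDF 0 2⁻¹ p.2 :=
    ((measurable_gaussianPDF _ _).comp measurable_fst).mul
      ((measurable_gaussianPDF _ _).comp measurable_snd)
  rw [gaussianReal_of_var_ne_zero _ hv,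
    prod_withDensity (measurable_gaussianPDF _ _) (measurable_gaussianPDF _ _),
    lintegral_withDensity_eq_lintegral_mul _ hpdf hfp]
  simp only [Pi.mul_apply, gaussianPDF_half_mul]
  -- In polar coordinates the angle contributes `2π`, and the substitution `u = r²` absorbs the
  -- Jacobian `r`.
  have hpol := lintegral_comp_polarCoord_symm (fun p : ℝ × ℝ =>
    ENNReal.ofReal (Real.pi⁻¹ * Real.exp (-(p.1 ^ 2 + p.2 ^ 2))) * f (p.1 ^ 2 + p.2 ^ 2))
  rw [← Measure.volume_eq_prod, ← hpol]
  have hsq : ∀ p : ℝ × ℝ, (polarCoord.symm p).1 ^ 2 + (polarCoord.symm p).2 ^ 2 = p.1 ^ 2 := by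
    intro p
    rw [polarCoord_symm_apply]
    have := Real.sin_sq_add_cos_sq p.2
    linear_combination p.1 ^ 2 * this
  simp_rw [hsq]
  rw [polarCoord_target, Measure.volume_eq_prod, ← Measure.prod_restrict, lintegral_prod _ (by fun_prop)]
  simp only [lintegral_const, Measure.restrict_apply MeasurableSet.univ, univ_inter, Real.volume_Ioo]
  have himg : (fun r : ℝ => r ^ 2) '' Ioi 0 = Ioi 0 := by
    ext u
    simp only [mem_image, mem_Ioi]
    constructor
    · rintro ⟨r, hr, rfl⟩; positivity
    · intro hu
      exact ⟨√u, Real.sqrt_pos.2 hu, Real.sq_sqrt hu.le⟩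
  have hcov := lintegral_image_eq_lintegral_abs_deriv_mul (s := Ioi (0 : ℝ)) (f := fun r => r ^ 2)
    (f' := fun r => 2 * r) measurableSet_Ioi
    (fun x _ => by simpa using (hasDerivAt_pow 2 x).hasDerivWithinAt)
    (fun a ha b hb h => by
      have := (sq_eq_sq₀ (le_of_lt ha) (le_of_lt hb)).1 h
      exact this)
    (fun u => ENNReal.ofReal (Real.exp (-u)) * f u)
  rw [himg] at hcov
  rw [hcov]
  refine setLIntegral_congr_fun measurableSet_Ioi fun r hr => ?_
  have hr0 : (0 : ℝ) < r := hr
  simp only [smul_eq_mul]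
  rw [abs_of_pos (by positivity), mul_comm, ← mul_assoc, ← mul_assoc, ← mul_assoc,
    ← ENNReal.ofReal_mul (by linarith), ← ENNReal.ofReal_mul (mul_nonneg (by linarith) hr0.le),
    ← ENNReal.ofReal_mul (by positivity)]
  congr 2
  field_simp
  ring

/-- After `e^{-s}` is taken out, integrating `(s - u)^m / m!` raises the index of each term by one;
the term of index `0` is the only one missing, hence the subtracted `e^{-s}`. This is the recursion
for Erlang tails. -/
lemma gammaTail_integral (M : ℕ) (s : ℝ) :
    ∫ u in (0 : ℝ)..s, Real.exp (-u) * gammaTail M (s - u)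
      = gammaTail (M + 1) s - Real.exp (-s) := by
  have h1 : ∀ u : ℝ, Real.exp (-u) * gammaTail M (s - u)
      = Real.exp (-s) * ∑ m ∈ Finset.range M, (s - u) ^ m / m ! := by
    intro u
    rw [gammaTail, ← mul_assoc, ← Real.exp_add]
    congr 2; ring
  simp_rw [h1]
  rw [intervalIntegral.integral_const_mul, intervalIntegral.integral_finsetSum]
  · have h2 : ∀ m : ℕ, ∫ u in (0 : ℝ)..s, (s - u) ^ m / m ! = s ^ (m + 1) / ((m + 1)! : ℕ) := by
      intro m
      rw [intervalIntegral.integral_div, intervalIntegral.integral_comp_sub_left (fun u => u ^ m) s]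
      simp only [sub_self, sub_zero]
      rw [integral_pow, Nat.factorial_succ]
      push_cast
      have : ((m ! : ℕ) : ℝ) ≠ 0 := by positivity
      field_simp
      simp
    simp_rw [h2]
    rw [gammaTail, Finset.sum_range_succ' (fun m => s ^ m / (m ! : ℝ))]
    simp
    ring
  · intro m _
    exact (Continuous.intervalIntegrable (by fun_prop) _ _)

lemma gammaTail_nonneg (M : ℕ) {s : ℝ} (hs : 0 ≤ s) : 0 ≤ gammaTail M s := by
  unfold gammaTail; positivity

lemma continuous_gammaTail (M : ℕ) : Continuous (gammaTail M) := by
  unfold gammaTail; fun_prop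

lemma lintegral_exp_neg_Ioi (s : ℝ) :
    ∫⁻ u in Ioi s, ENNReal.ofReal (Real.exp (-u)) = ENNReal.ofReal (Real.exp (-s)) := by
  rw [← ofReal_integral_eq_lintegral_ofReal (integrableOn_exp_neg_Ioi s)
    (Eventually.of_forall fun u => (Real.exp_pos _).le), integral_exp_neg_Ioi]

/-- Induction, splitting off one coordinate with exponential squared modulus `u`: either `u > s`,
with probability `e^{-s}`, or the other coordinates must exceed `s - u`. Negative thresholds are
included because `s - u` may be negative. -/
lemma pi_complexGaussian_tail (M : ℕ) (s : ℝ) :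
    Measure.pi (fun _ : Fin M => complexGaussian) {a | s < ∑ i, ‖a i‖ ^ 2}
      = if s < 0 then 1 else ENNReal.ofReal (gammaTail M s) := by
  induction M generalizing s with
  | zero =>
    by_cases hs : s < 0
    · simp [hs]
    · simp [hs, gammaTail]
  | succ M ih =>
    split_ifs with hs
    · have : {a : Fin (M + 1) → ℂ | s < ∑ i, ‖a i‖ ^ 2} = univ := by
        ext a
        simp only [mem_ofPred_eq, mem_univ, iff_true]
        exact hs.trans_le (Finset.sum_nonneg fun i _ => sq_nonneg _)
      rw [this, measure_univ]
    · push Not at hs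
      have hmp := measurePreserving_piFinSuccAbove (fun _ : Fin (M + 1) => complexGaussian) 0
      set E : Set (ℂ × (Fin M → ℂ)) := {p | s < ‖p.1‖ ^ 2 + ∑ i, ‖p.2 i‖ ^ 2} with hE
      have hEm : MeasurableSet E := measurableSet_lt measurable_const (by fun_prop)
      have hpre : {a : Fin (M + 1) → ℂ | s < ∑ i, ‖a i‖ ^ 2}
          = (MeasurableEquiv.piFinSuccAbove (fun _ : Fin (M + 1) => ℂ) 0) ⁻¹' E := by
        ext a
        simp only [mem_ofPred_eq, mem_preimage, hE]
        rw [Fin.sum_univ_succAbove _ 0]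
        rfl
      rw [hpre, hmp.measure_preimage hEm.nullMeasurableSet, Measure.prod_apply hEm]
      have hsec : ∀ z : ℂ, Measure.pi (fun _ : Fin M => complexGaussian) (Prod.mk z ⁻¹' E)
          = (fun u : ℝ => if s - u < 0 then 1 else ENNReal.ofReal (gammaTail M (s - u)))
            (‖z‖ ^ 2) := by
        intro z
        simp only
        rw [← ih (s - ‖z‖ ^ 2)]
        congr 1
        ext a
        simp only [hE, mem_preimage, mem_ofPred_eq]
        constructor <;> intro h <;> linarith
      simp_rw [hsec]
      have hg := (continuous_gammaTail M).measurable
      have hfm : Measurable (fun u : ℝ => if s - u < 0 then (1 : ℝ≥0∞)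
          else ENNReal.ofReal (gammaTail M (s - u))) := by
        refine Measurable.ite (measurableSet_lt (by fun_prop) measurable_const) measurable_const ?_
        exact ENNReal.measurable_ofReal.comp (hg.comp (by fun_prop))
      rw [lintegral_complexGaussian_normSq hfm, ← Ioc_union_Ioi_eq_Ioi hs,
        lintegral_union measurableSet_Ioi (Ioc_disjoint_Ioi le_rfl)]
      have hA : ∫⁻ u in Ioi s, ENNReal.ofReal (Real.exp (-u)) *
          (if s - u < 0 then 1 else ENNReal.ofReal (gammaTail M (s - u)))
          = ENNReal.ofReal (Real.exp (-s)) := by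
        rw [← lintegral_exp_neg_Ioi s]
        refine setLIntegral_congr_fun measurableSet_Ioi fun u hu => ?_
        have : s - u < 0 := by simpa using hu
        simp [this]
      have hB : ∫⁻ u in Ioc 0 s, ENNReal.ofReal (Real.exp (-u)) *
          (if s - u < 0 then 1 else ENNReal.ofReal (gammaTail M (s - u)))
          = ENNReal.ofReal (gammaTail (M + 1) s - Real.exp (-s)) := by
        rw [← gammaTail_integral M s, intervalIntegral.integral_of_le hs,
          ofReal_integral_eq_lintegral_ofReal]
        · refine setLIntegral_congr_fun measurableSet_Ioc fun u hu => ?_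
          have : ¬ s - u < 0 := by linarith [hu.2]
          simp only [this, if_false]
          rw [← ENNReal.ofReal_mul (Real.exp_pos _).le]
        · have hc : Continuous fun u : ℝ => Real.exp (-u) * gammaTail M (s - u) :=
            (by fun_prop : Continuous fun u : ℝ => Real.exp (-u)).mul
              ((continuous_gammaTail M).comp (by fun_prop))
          exact (hc.integrableOn_Icc).mono_set Ioc_subset_Icc_self
        · refine (ae_restrict_iff' measurableSet_Ioc).2 (Eventually.of_forall fun u hu => ?_)
          exact mul_nonneg (Real.exp_pos _).le (gammaTail_nonneg M (by linarith [hu.2]))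
      rw [hA, hB, ← ENNReal.ofReal_add _ (Real.exp_pos _).le]
      · congr 1; ring
      · rw [gammaTail, Finset.sum_range_succ']
        simp only [pow_zero, Nat.factorial_zero, Nat.cast_one, div_one, mul_add, mul_one,
          add_sub_cancel_right]
        positivity

/-- Tail of the power of a Rayleigh fading vector. -/
theorem rayleigh_tail (M : ℕ) {s : ℝ} (hs : 0 ≤ s) :
    rayleigh M {g | s < ‖g‖ ^ 2} = ENNReal.ofReal (gammaTail M s) := by
  have hm : MeasurableSet {g : Chan M | s < ‖g‖ ^ 2} :=
    measurableSet_lt measurable_const (by fun_prop)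
  rw [rayleigh, Measure.map_apply (by fun_prop) hm]
  have : WithLp.toLp 2 ⁻¹' {g : Chan M | s < ‖g‖ ^ 2}
      = {a : Fin M → ℂ | s < ∑ i, ‖a i‖ ^ 2} := by
    ext a
    simp [EuclideanSpace.norm_sq_eq]
  rw [this, pi_complexGaussian_tail, if_neg (by linarith)]

/-- This discards the event `h = 0`, on which the beamforming direction `h / ‖h‖` is degenerate. -/
lemma rayleigh_singleton_zero {M : ℕ} (hM : 1 ≤ M) : rayleigh M {0} = 0 := by
  have h := rayleigh_tail M (le_refl (0 : ℝ))
  have h1 : gammaTail M 0 = 1 := by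
    obtain ⟨k, rfl⟩ : ∃ k, M = k + 1 := ⟨M - 1, by omega⟩
    rw [gammaTail, Finset.sum_range_succ']
    simp
  rw [h1, ENNReal.ofReal_one] at h
  have h2 : {g : Chan M | 0 < ‖g‖ ^ 2} = {0}ᶜ := by
    ext g
    simp only [mem_ofPred_eq, mem_compl_iff, mem_singleton_iff]
    rw [sq_pos_iff, norm_ne_zero_iff]
  rw [h2] at h
  exact (prob_compl_eq_one_iff (measurableSet_singleton 0)).1 h

lemma charFun_complexGaussian (w : ℂ) :
    charFun complexGaussian w = Complex.exp (-(‖w‖ ^ 2 : ℝ) / 4) := by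
  have hmk : Measurable (fun p : ℝ × ℝ => (⟨p.1, p.2⟩ : ℂ)) :=
    Complex.measurableEquivRealProd.symm.measurable
  rw [charFun_apply, complexGaussian, integral_map hmk.aemeasurable (by fun_prop)]
  have h1 : ∀ p : ℝ × ℝ, Complex.exp ((inner ℝ (⟨p.1, p.2⟩ : ℂ) w : ℝ) * Complex.I)
      = Complex.exp ((inner ℝ p.1 w.re : ℝ) * Complex.I)
        * Complex.exp ((inner ℝ p.2 w.im : ℝ) * Complex.I) := by
    intro p
    rw [← Complex.exp_add, ← add_mul, ← Complex.ofReal_add, Complex.inner]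
    congr 3
    simp
  simp_rw [h1]
  rw [integral_prod_mul (fun x : ℝ => Complex.exp ((inner ℝ x w.re : ℝ) * Complex.I))
    (fun x : ℝ => Complex.exp ((inner ℝ x w.im : ℝ) * Complex.I)), ← charFun_apply, ← charFun_apply,
    charFun_gaussianReal, charFun_gaussianReal, ← Complex.exp_add]
  congr 1
  rw [Complex.sq_norm, Complex.normSq_apply]
  push_cast
  ring

/-- A unit linear combination of independent standard complex Gaussian variables is standard. -/
lemma map_linear_complexGaussian {M : ℕ} (c : Fin M → ℂ) (hc : ∑ i, ‖c i‖ ^ 2 = 1) :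
    (Measure.pi fun _ : Fin M => complexGaussian).map (fun a => ∑ i, c i * a i)
      = complexGaussian := by
  have hm : Measurable (fun a : Fin M → ℂ => ∑ i, c i * a i) := by fun_prop
  have : IsProbabilityMeasure
      ((Measure.pi fun _ : Fin M => complexGaussian).map (fun a => ∑ i, c i * a i)) :=
    Measure.isProbabilityMeasure_map hm.aemeasurable
  refine Measure.ext_of_charFun (funext fun w => ?_)
  rw [charFun_complexGaussian, charFun_apply, integral_map hm.aemeasurable (by fun_prop)]
  have h1 : ∀ a : Fin M → ℂ, Complex.exp ((inner ℝ (∑ i, c i * a i) w : ℝ) * Complex.I)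
      = ∏ i, Complex.exp ((inner ℝ (a i) (w * (starRingEnd ℂ) (c i)) : ℝ) * Complex.I) := by
    intro a
    rw [← Complex.exp_sum, ← Finset.sum_mul, ← Complex.ofReal_sum, sum_inner]
    congr 3
    refine Finset.sum_congr rfl fun i _ => ?_
    rw [Complex.inner, Complex.inner, map_mul]
    congr 1; ring
  simp_rw [h1]
  rw [integral_fintype_prod_eq_prod (fun i z =>
    Complex.exp ((inner ℝ z (w * (starRingEnd ℂ) (c i)) : ℝ) * Complex.I))]
  simp_rw [← charFun_apply, charFun_complexGaussian]
  rw [← Complex.exp_sum]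
  congr 1
  rw [← Finset.sum_div, Finset.sum_neg_distrib, ← Complex.ofReal_sum]
  congr 3
  simp_rw [norm_mul, RCLike.norm_conj, mul_pow]
  rw [← Finset.mul_sum, hc, mul_one]

/-- The beamforming gain is exponentially distributed. -/
lemma lintegral_beamGain {M : ℕ} {h : Chan M} (hh : h ≠ 0) {f : ℝ → ℝ≥0∞} (hf : Measurable f) :
    ∫⁻ g, f (beamGain g h) ∂(rayleigh M)
      = ∫⁻ u in Ioi (0 : ℝ), ENNReal.ofReal (Real.exp (-u)) * f u := by
  have hn : (‖h‖ : ℝ) ≠ 0 := norm_ne_zero_iff.2 hh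
  -- These are the coefficients of the linear form in `g` whose squared modulus is the gain; they
  -- form a unit vector.
  set c : Fin M → ℂ := fun i => (starRingEnd ℂ) (h i) / (‖h‖ : ℂ) with hcdef
  have hc : ∑ i, ‖c i‖ ^ 2 = 1 := by
    simp only [hcdef, norm_div, RCLike.norm_conj, div_pow, Complex.norm_real, norm_norm]
    rw [← Finset.sum_div, ← EuclideanSpace.norm_sq_eq, div_self (pow_ne_zero 2 hn)]
  have hbm : Measurable (fun g : Chan M => f (beamGain g h)) := by
    unfold beamGain
    exact hf.comp (by fun_prop)
  rw [rayleigh, lintegral_map hbm (by fun_prop)]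
  have hb : ∀ a : Fin M → ℂ, beamGain (WithLp.toLp 2 a) h = ‖∑ i, c i * a i‖ ^ 2 := by
    intro a
    rw [beamGain, PiLp.inner_apply]
    congr 1
    have : ∑ i, c i * a i = (∑ i, inner ℂ (h i) (a i)) / (‖h‖ : ℂ) := by
      rw [Finset.sum_div]
      refine Finset.sum_congr rfl fun i _ => ?_
      simp only [hcdef, RCLike.inner_apply]
      ring
    rw [this, norm_div, Complex.norm_real, norm_norm]
  simp_rw [hb]
  have hm : Measurable (fun a : Fin M → ℂ => ∑ i, c i * a i) := by fun_prop
  have hfm : Measurable fun z : ℂ => f (‖z‖ ^ 2) := hf.comp (by fun_prop)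
  rw [← lintegral_complexGaussian_normSq hf]
  conv_rhs => rw [← map_linear_complexGaussian c hc]
  rw [lintegral_map hfm hm]

lemma lintegral_exp_neg_mul_rpow {s : ℝ} (hs : 0 < s) :
    ∫⁻ u in Ioi (0 : ℝ), ENNReal.ofReal (Real.exp (-u)) * ENNReal.ofReal (u ^ (s - 1))
      = ENNReal.ofReal (Real.Gamma s) := by
  rw [Real.Gamma_eq_integral hs, ofReal_integral_eq_lintegral_ofReal
    (Real.GammaIntegral_convergent hs)]
  · simp_rw [ENNReal.ofReal_mul (Real.exp_pos _).le]
  · refine (ae_restrict_iff' measurableSet_Ioi).2 (Eventually.of_forall fun u hu => ?_)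
    have : (0 : ℝ) < u := hu
    simp only [Pi.zero_apply]
    positivity

lemma measurable_beamGain {M : ℕ} : Measurable (fun p : Chan M × Chan M => beamGain p.1 p.2) := by
  unfold beamGain; fun_prop

/-- Fractional moments of the beamforming gain. -/
theorem lintegral_beamGain_rpow {M : ℕ} (hM : 1 ≤ M) {a : ℝ} (ha : 0 < a) :
    ∫⁻ p, ENNReal.ofReal (beamGain p.1 p.2 ^ a) ∂((rayleigh M).prod (rayleigh M))
      = ENNReal.ofReal (Real.Gamma (1 + a)) := by
  have hm : Measurable (fun p : Chan M × Chan M => ENNReal.ofReal (beamGain p.1 p.2 ^ a)) :=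
    ENNReal.measurable_ofReal.comp (measurable_beamGain.pow_const a)
  -- The law of the gain given `h` is the same unit exponential for every `h ≠ 0`, so conditioning
  -- on `h` leaves a constant.
  rw [lintegral_prod_symm _ hm.aemeasurable]
  have h0 : ∀ᵐ h ∂(rayleigh M), h ≠ 0 := by
    rw [ae_iff]
    simpa using rayleigh_singleton_zero hM
  have h1 : ∀ᵐ h ∂(rayleigh M), ∫⁻ g, ENNReal.ofReal (beamGain g h ^ a) ∂(rayleigh M)
      = ENNReal.ofReal (Real.Gamma (1 + a)) := by
    filter_upwards [h0] with h hh
    rw [lintegral_beamGain hh (f := fun u => ENNReal.ofReal (u ^ a)) (by fun_prop),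
      ← lintegral_exp_neg_mul_rpow (by linarith)]
    simp
  rw [lintegral_congr_ae h1]
  simp

/-! ### Nearest points -/

/-- One eligible point at distance less than `n` has only finitely many competitors in that ball, so
the minimum is attained and the infimum of indices is over a nonempty set. -/
lemma nearest_spec {p : ℕ → Prop} {x : ℕ → Plane} {z : Plane} (hp : ∃ i, p i)
    (hx : ∀ n : ℕ, {i | x i ∈ Metric.ball z n}.Finite) :
    p (nearest p x z) ∧ ∀ j, p j → dist (x (nearest p x z)) z ≤ dist (x j) z := by
  obtain ⟨i0, hi0⟩ := hp
  obtain ⟨n, hn⟩ := exists_nat_gt (dist (x i0) z)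
  have hfin : {i | p i ∧ dist (x i) z < n}.Finite :=
    (hx n).subset fun i hi => Metric.mem_ball.2 hi.2
  obtain ⟨i, hi, hmin⟩ := Set.exists_min_image _ (fun i => dist (x i) z) hfin ⟨i0, hi0, hn⟩
  have hne : {i | p i ∧ ∀ j, p j → dist (x i) z ≤ dist (x j) z}.Nonempty := by
    refine ⟨i, hi.1, fun j hj => ?_⟩
    by_cases hjn : dist (x j) z < n
    · exact hmin j ⟨hj, hjn⟩
    · exact hi.2.le.trans (not_lt.1 hjn)
  exact Nat.sInf_mem hne

lemma measurable_nearest {α : Type*} [MeasurableSpace α] {p : α → ℕ → Prop} {x : α → ℕ → Plane}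
    {z : α → Plane} (hp : ∀ i, MeasurableSet {a | p a i}) (hx : Measurable x)
    (hz : Measurable z) : Measurable fun a => nearest (p a) (x a) (z a) := by
  have hd : ∀ i, Measurable fun a => dist (x a i) (z a) := fun i =>
    ((measurable_pi_apply i).comp hx).dist hz
  have hS : ∀ i, MeasurableSet {a | p a i ∧ ∀ j, p a j → dist (x a i) (z a) ≤ dist (x a j) (z a)} := by
    intro i
    refine (hp i).inter ?_
    have : {a | ∀ j, p a j → dist (x a i) (z a) ≤ dist (x a j) (z a)}
        = ⋂ j, ({a | p a j}ᶜ ∪ {a | dist (x a i) (z a) ≤ dist (x a j) (z a)}) := by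
      ext a; simp [imp_iff_not_or]
    change MeasurableSet {a | ∀ j, p a j → dist (x a i) (z a) ≤ dist (x a j) (z a)}
    rw [this]
    exact MeasurableSet.iInter fun j => (hp j).compl.union (measurableSet_le (hd i) (hd j))
  set Q : ℕ → Set α := fun i =>
    {a | p a i ∧ ∀ j, p a j → dist (x a i) (z a) ≤ dist (x a j) (z a)} with hQ
  refine measurable_to_countable' fun n => ?_
  -- The infimum of the empty set of indices is `0`, which explains the additional piece for `n =
  -- 0`.
  have hpre : (fun a => nearest (p a) (x a) (z a)) ⁻¹' {n}
      = (Q n ∩ ⋂ k ∈ Finset.range n, (Q k)ᶜ) ∪ (if n = 0 then ⋂ k, (Q k)ᶜ else ∅) := by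
    ext a
    set U : Set ℕ := {i | a ∈ Q i} with hU
    have hn : nearest (p a) (x a) (z a) = sInf U := rfl
    simp only [mem_preimage, mem_singleton_iff, hn, mem_union, mem_inter_iff, mem_iInter,
      Finset.mem_range, mem_compl_iff]
    constructor
    · intro h
      rcases U.eq_empty_or_nonempty with he | hne
      · right
        rw [he, Nat.sInf_empty] at h
        subst h
        simp only [if_true, mem_iInter, mem_compl_iff]
        intro k hk
        have : k ∈ U := hk
        rw [he] at this
        exact this
      · left
        refine ⟨h ▸ Nat.sInf_mem hne, fun k hk hkU => ?_⟩
        exact Nat.notMem_of_lt_sInf (h ▸ hk : k < sInf U) hkU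
    · rintro (⟨h1, h2⟩ | h)
      · refine le_antisymm (Nat.sInf_le h1) ?_
        by_contra hlt
        push Not at hlt
        exact h2 _ hlt (Nat.sInf_mem (s := U) ⟨n, h1⟩)
      · split_ifs at h with h0
        · have : U = ∅ := by
            ext k
            simp only [mem_iInter, mem_compl_iff] at h
            exact iff_of_false (h k) (notMem_empty k)
          rw [this, h0, Nat.sInf_empty]
        · exact absurd h (notMem_empty a)
  rw [hpre]
  refine ((hS n).inter (Finset.measurableSet_biInter _ fun k _ => (hS k).compl)).union ?_
  split_ifs
  · exact MeasurableSet.iInter fun k => (hS k).compl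
  · exact MeasurableSet.empty

lemma measurable_eval_nat {α β : Type*} [MeasurableSpace α] [MeasurableSpace β] {x : α → ℕ → β}
    {n : α → ℕ} (hx : Measurable x) (hn : Measurable n) : Measurable fun a => x a (n a) := by
  have h : Measurable fun q : (ℕ → β) × ℕ => q.1 q.2 :=
    measurable_from_prod_countable_left fun k => measurable_pi_apply k
  exact h.comp (hx.prodMk hn)

/-- Realizations of the network. -/
abbrev Config (M : ℕ) : Type :=
  (ℕ → Plane) × (ℕ → Plane) × (ℕ → Bool) × (ℕ → Chan M) × (ℕ → Chan M)

lemma measurable_typicalAP (o : Plane) :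
    Measurable fun q : (ℕ → Plane) × (ℕ → Bool) => typicalAP o q.1 q.2 := by
  refine measurable_nearest (fun i => ?_) measurable_fst measurable_const
  have h : Measurable fun q : (ℕ → Plane) × (ℕ → Bool) => q.2 i := by fun_prop
  exact h (measurableSet_singleton false)

lemma measurable_typicalSink :
    Measurable fun q : (ℕ → Plane) × Plane => typicalSink q.1 q.2 :=
  measurable_nearest (fun _ => MeasurableSet.const True) measurable_fst measurable_snd

lemma measurable_interference {M : ℕ} (β : ℝ) :
    Measurable fun q : (ℕ → Plane) × (ℕ → Bool) × (ℕ → Chan M) × (ℕ → Chan M) × ℕ × Plane =>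
      interference β q.1 q.2.1 q.2.2.1 q.2.2.2.1 q.2.2.2.2.1 q.2.2.2.2.2 := by
  unfold interference
  refine Measurable.tsum fun j => Measurable.ite ?_ ?_ measurable_const
  · refine MeasurableSet.inter ?_ ?_
    · have : Measurable fun q : (ℕ → Plane) × (ℕ → Bool) × (ℕ → Chan M) × (ℕ → Chan M) × ℕ × Plane =>
        q.2.1 j := by fun_prop
      exact this (measurableSet_singleton true)
    · have : Measurable fun q : (ℕ → Plane) × (ℕ → Bool) × (ℕ → Chan M) × (ℕ → Chan M) × ℕ × Plane =>
        q.2.2.2.2.1 := by fun_prop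
      exact this (MeasurableSet.of_discrete (s := {a | j ≠ a}))
  · refine (ENNReal.measurable_ofReal.comp (measurable_beamGain.comp (f := fun
      q : (ℕ → Plane) × (ℕ → Bool) × (ℕ → Chan M) × (ℕ → Chan M) × ℕ × Plane =>
        (q.2.2.1 j, q.2.2.2.1 j)) (by fun_prop))).mul ?_
    exact (Measurable.edist (by fun_prop) (by fun_prop)).pow_const _

/-- The location of the typical access point. -/
def apLoc (o : Plane) (x : ℕ → Plane) (t : ℕ → Bool) : Plane := x (typicalAP o x t)

/-- The location of the sink nearest to `z`. -/
def sinkLoc (s : ℕ → Plane) (z : Plane) : Plane := s (typicalSink s z)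

lemma measurable_apLoc (o : Plane) :
    Measurable fun q : (ℕ → Plane) × (ℕ → Bool) => apLoc o q.1 q.2 :=
  measurable_eval_nat measurable_fst (measurable_typicalAP o)

lemma measurable_sinkLoc : Measurable fun q : (ℕ → Plane) × Plane => sinkLoc q.1 q.2 :=
  measurable_eval_nat measurable_fst measurable_typicalSink

/-- The interference at the typical sink, as a function of the realization. -/
def sinkInterference {M : ℕ} (β : ℝ) (o : Plane) (q : Config M) : ℝ≥0∞ :=
  interference β q.1 q.2.2.1 q.2.2.2.1 q.2.2.2.2 (typicalAP o q.1 q.2.2.1)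
    (sinkLoc q.2.1 (apLoc o q.1 q.2.2.1))

lemma measurable_sinkInterference {M : ℕ} (β : ℝ) (o : Plane) :
    Measurable (sinkInterference (M := M) β o) := by
  have ha : Measurable fun q : Config M => typicalAP o q.1 q.2.2.1 :=
    (measurable_typicalAP o).comp (f := fun q : Config M => (q.1, q.2.2.1)) (by fun_prop)
  have hl : Measurable fun q : Config M => apLoc o q.1 q.2.2.1 :=
    (measurable_apLoc o).comp (f := fun q : Config M => (q.1, q.2.2.1)) (by fun_prop)
  have hy : Measurable fun q : Config M => sinkLoc q.2.1 (apLoc o q.1 q.2.2.1) :=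
    measurable_sinkLoc.comp (f := fun q : Config M => (q.2.1, apLoc o q.1 q.2.2.1))
      ((by fun_prop : Measurable fun q : Config M => q.2.1).prodMk hl)
  exact (measurable_interference β).comp (f := fun q : Config M => (q.1, q.2.2.1, q.2.2.2.1,
    q.2.2.2.2, typicalAP o q.1 q.2.2.1, sinkLoc q.2.1 (apLoc o q.1 q.2.2.1)))
    ((by fun_prop : Measurable fun q : Config M => q.1).prodMk
      ((by fun_prop : Measurable fun q : Config M => q.2.2.1).prodMk
        ((by fun_prop : Measurable fun q : Config M => q.2.2.2.1).prodMk
          ((by fun_prop : Measurable fun q : Config M => q.2.2.2.2).prodMk (ha.prodMk hy)))))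

/-- The distance from the typical access point to the typical sink. -/
def linkDist {M : ℕ} (o : Plane) (q : Config M) : ℝ :=
  dist (apLoc o q.1 q.2.2.1) (sinkLoc q.2.1 (apLoc o q.1 q.2.2.1))

lemma measurable_linkDist {M : ℕ} (o : Plane) : Measurable (linkDist (M := M) o) := by
  have hl : Measurable fun q : Config M => apLoc o q.1 q.2.2.1 :=
    (measurable_apLoc o).comp (f := fun q : Config M => (q.1, q.2.2.1)) (by fun_prop)
  have hy : Measurable fun q : Config M => sinkLoc q.2.1 (apLoc o q.1 q.2.2.1) :=
    measurable_sinkLoc.comp (f := fun q : Config M => (q.2.1, apLoc o q.1 q.2.2.1))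
      ((by fun_prop : Measurable fun q : Config M => q.2.1).prodMk hl)
  exact hl.dist hy

lemma sinr_eq {M : ℕ} (β δ P : ℝ) (o : Plane) (q : Config M) :
    sinr β δ P o q.1 q.2.1 q.2.2.1 q.2.2.2.1 q.2.2.2.2
      = ENNReal.ofReal (‖q.2.2.2.1 (typicalAP o q.1 q.2.2.1)‖ ^ 2)
          * ENNReal.ofReal (linkDist o q) ^ (-β)
        / (sinkInterference β o q + ENNReal.ofReal (δ ^ 2 / P)) := by
  rw [linkDist, ← edist_dist]
  rfl

lemma measurable_sinr {M : ℕ} (β δ P : ℝ) (o : Plane) :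
    Measurable fun q : Config M => sinr β δ P o q.1 q.2.1 q.2.2.1 q.2.2.2.1 q.2.2.2.2 := by
  simp_rw [sinr_eq]
  have ha : Measurable fun q : Config M => typicalAP o q.1 q.2.2.1 :=
    (measurable_typicalAP o).comp (f := fun q : Config M => (q.1, q.2.2.1)) (by fun_prop)
  have hg : Measurable fun q : Config M => q.2.2.2.1 (typicalAP o q.1 q.2.2.1) :=
    measurable_eval_nat (by fun_prop) ha
  refine Measurable.div (Measurable.mul ?_ ?_) ((measurable_sinkInterference β o).add_const _)
  · exact ENNReal.measurable_ofReal.comp (hg.norm.pow_const 2)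
  · exact (ENNReal.measurable_ofReal.comp (measurable_linkDist o)).pow_const _

/-! ### Almost sure properties of a Poisson process -/

section AlmostSure

variable {Ω : Type*} [MeasurableSpace Ω] {μ : Measure Ω} [IsProbabilityMeasure μ]
  {X : ℕ → Ω → Plane} {lam : ℝ}

lemma IsHPPP.ae_locallyFinite (hX : IsHPPP μ X lam) (z : Plane) :
    ∀ᵐ ω ∂μ, ∀ n : ℕ, {i | X i ω ∈ Metric.ball z n}.Finite := by
  rw [ae_all_iff]
  intro n
  filter_upwards [hX.ae_count_lt_top (A := Metric.ball z n) measurableSet_ball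
    measure_ball_lt_top.ne] with ω hω
  exact Set.encard_ne_top_iff.1 hω

/-- The probability is `1 - (1 + m) e^{-m}`, and `e^{-m} ≥ 1 - m` bounds it by `m²`. The quadratic
order makes fine partitions rule out ties. -/
lemma IsHPPP.measure_two_le_count (hX : IsHPPP μ X lam) (hlam : 0 ≤ lam) {A : Set Plane}
    (hA : MeasurableSet A) (hv : volume A ≠ ∞) :
    μ {ω | 1 < count (fun i => X i ω) A} ≤ ENNReal.ofReal ((lam * volume.real A) ^ 2) := by
  set m := lam * volume.real A with hm
  have hm0 : 0 ≤ m := mul_nonneg hlam measureReal_nonneg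
  have hN := hX.measurable_count hA
  have h0 := hX.count_law A hA hv 0
  have h1 := hX.count_law A hA hv 1
  rw [poissonMeasure_singleton, Real.coe_toNNReal _ hm0] at h0 h1
  have hc : {ω | 1 < count (fun i => X i ω) A}
      = ({ω | count (fun i => X i ω) A = (0 : ℕ)} ∪ {ω | count (fun i => X i ω) A = (1 : ℕ)})ᶜ := by
    ext ω
    simp only [mem_ofPred_eq, mem_compl_iff, mem_union, Nat.cast_zero, Nat.cast_one]
    generalize count (fun i => X i ω) A = k
    induction k using ENat.recTopCoe with
    | top => simp
    | coe k => norm_cast; omega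
  have hs0 : MeasurableSet {ω | count (fun i => X i ω) A = (0 : ℕ)} := hN (measurableSet_singleton _)
  have hs1 : MeasurableSet {ω | count (fun i => X i ω) A = (1 : ℕ)} := hN (measurableSet_singleton _)
  rw [hc, prob_compl_eq_one_sub (hs0.union hs1), measure_union _ hs1, h0, h1,
    ← ENNReal.ofReal_add (by positivity) (by positivity), ← ENNReal.ofReal_one,
    ← ENNReal.ofReal_sub _ (by positivity)]
  · refine ENNReal.ofReal_le_ofReal ?_
    have := Real.add_one_le_exp (-m)
    simp only [pow_zero, pow_one, Nat.factorial]
    norm_num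
    nlinarith
  · refine Set.disjoint_left.2 fun ω h h' => ?_
    simp only [mem_ofPred_eq] at h h'
    rw [h] at h'
    norm_num at h'

/-- Almost surely no two points are at the same distance from `z`. -/
lemma IsHPPP.ae_dist_ne (hX : IsHPPP μ X lam) (hlam : 0 ≤ lam) (z : Plane) :
    ∀ᵐ ω ∂μ, ∀ i j, i ≠ j → dist (X i ω) z ≠ dist (X j ω) z := by
  have hpi := Real.pi_pos
  have key : ∀ R : ℕ, μ {ω | ∃ i j, i ≠ j ∧ dist (X i ω) z = dist (X j ω) z ∧
      dist (X i ω) z < R} = 0 := by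
    intro R
    set E := {ω | ∃ i j, i ≠ j ∧ dist (X i ω) z = dist (X j ω) z ∧ dist (X i ω) z < R} with hE
    -- The disc of radius `R` is cut into `K = N + 1` annuli of equal area, whence the radii `√(k /
    -- K) R`. A tie puts two points into one annulus; this has probability at most `K (c / K)² = c²
    -- / K` with `c = lam π R²`.
    have hb : ∀ N : ℕ, μ E ≤ ENNReal.ofReal ((lam * (Real.pi * R ^ 2)) ^ 2 / (N + 1 : ℕ)) := by
      intro N
      set K : ℕ := N + 1 with hK
      have hK0 : (0 : ℝ) < K := by positivity
      set b : ℕ → ℝ := fun k => √(k / K) * R with hbdef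
      have hb0 : ∀ k, 0 ≤ b k := fun k => by positivity
      have hbm : ∀ k, b k ≤ b (k + 1) := fun k => by
        simp only [hbdef]; gcongr; simp
      set A : ℕ → Set Plane := fun k => Metric.ball z (b (k + 1)) \ Metric.ball z (b k) with hA
      have hAm : ∀ k, MeasurableSet (A k) := fun k => measurableSet_ball.diff measurableSet_ball
      have hAv : ∀ k, volume (A k) ≠ ∞ := fun k =>
        ne_top_of_le_ne_top measure_ball_lt_top.ne (measure_mono sdiff_subset)
      have hvr : ∀ k, volume.real (A k) = Real.pi * R ^ 2 / K := by
        intro k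
        have hball : ∀ r : ℝ, 0 ≤ r → volume.real (Metric.ball z r) = r ^ 2 * Real.pi := by
          intro r hr
          rw [measureReal_def, EuclideanSpace.volume_ball_fin_two, ENNReal.toReal_mul,
            ENNReal.toReal_pow, ENNReal.toReal_ofReal hr, ENNReal.toReal_ofReal hpi.le]
        rw [hA]
        rw [measureReal_sdiff (Metric.ball_subset_ball (hbm k)) measurableSet_ball
          measure_ball_lt_top.ne,
          hball _ (hb0 _), hball _ (hb0 _)]
        simp only [hbdef, mul_pow]
        rw [Real.sq_sqrt (by positivity), Real.sq_sqrt (by positivity)]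
        push_cast
        field_simp
        ring
      have hsub : E ⊆ ⋃ k ∈ Finset.range K, {ω | 1 < count (fun i => X i ω) (A k)} := by
        rintro ω ⟨i, j, hij, hd, hR⟩
        set d := dist (X i ω) z with hddef
        have hd0 : 0 ≤ d := dist_nonneg
        have hR0 : (0 : ℝ) < R := hd0.trans_lt hR
        have hex : ∃ k, d < b (k + 1) := by
          refine ⟨N, ?_⟩
          simp only [hbdef]
          rw [← hK, div_self hK0.ne', Real.sqrt_one, one_mul]
          exact hR
        classical
        set k := Nat.find hex with hk
        have hk1 : d < b (k + 1) := Nat.find_spec hex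
        have hk2 : b k ≤ d := by
          rcases Nat.eq_zero_or_pos k with h0 | hpos
          · rw [h0]; simpa [hbdef] using hd0
          · have := Nat.find_min hex (m := k - 1) (by omega)
            rw [Nat.sub_add_cancel hpos] at this
            exact not_lt.1 this
        have hkN : k ≤ N := by
          refine Nat.find_min' hex ?_
          simp only [hbdef]
          rw [← hK, div_self hK0.ne', Real.sqrt_one, one_mul]
          exact hR
        simp only [mem_iUnion, Finset.mem_range]
        refine ⟨k, by omega, ?_⟩
        refine Set.one_lt_encard_iff.2 ⟨i, j, ?_, ?_, hij⟩
        · exact ⟨Metric.mem_ball.2 hk1, fun h => absurd (Metric.mem_ball.1 h) (not_lt.2 hk2)⟩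
        · refine ⟨Metric.mem_ball.2 (hd ▸ hk1), fun h => absurd (Metric.mem_ball.1 h) (not_lt.2 ?_)⟩
          exact hd ▸ hk2
      refine (measure_mono hsub).trans ((measure_biUnion_finset_le _ _).trans ?_)
      refine (Finset.sum_le_sum fun k _ => hX.measure_two_le_count hlam (hAm k) (hAv k)).trans ?_
      simp_rw [hvr]
      rw [Finset.sum_const, Finset.card_range, nsmul_eq_mul, ← ENNReal.ofReal_natCast,
        ← ENNReal.ofReal_mul (by positivity)]
      refine ENNReal.ofReal_le_ofReal (le_of_eq ?_)
      field_simp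
    have hlim : Tendsto (fun N : ℕ => ENNReal.ofReal ((lam * (Real.pi * R ^ 2)) ^ 2 / (N + 1 : ℕ)))
        atTop (𝓝 0) := by
      rw [← ENNReal.ofReal_zero]
      refine ENNReal.tendsto_ofReal ?_
      exact (tendsto_const_div_atTop_nhds_zero_nat _).comp (tendsto_add_atTop_nat 1)
    exact le_antisymm (ge_of_tendsto' hlim hb) zero_le
  have hall : ∀ᵐ ω ∂μ, ∀ R : ℕ, ¬ ∃ i j, i ≠ j ∧ dist (X i ω) z = dist (X j ω) z ∧
      dist (X i ω) z < R := by
    rw [ae_all_iff]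
    intro R
    rw [ae_iff]
    simpa only [not_not] using key R
  filter_upwards [hall] with ω hω i j hij hd
  obtain ⟨R, hR⟩ := exists_nat_gt (dist (X i ω) z)
  exact hω R ⟨i, j, hij, hd, hR⟩

end AlmostSure

/-! ### Independence of the typical access point and the active access points -/

/-- No inactive access point lies in `A`. -/
def inactiveVoid {Ω : Type*} (X : ℕ → Ω → Plane) (T : ℕ → Ω → Bool) (A : Set Plane) : Set Ω :=
  {ω | ∀ j, T j ω = false → X j ω ∉ A}

lemma measurableSet_inactiveVoid {Ω : Type*} [MeasurableSpace Ω] {X : ℕ → Ω → Plane}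
    {T : ℕ → Ω → Bool} (hX : ∀ j, Measurable (X j)) (hT : ∀ j, Measurable (T j)) {A : Set Plane}
    (hA : MeasurableSet A) : MeasurableSet (inactiveVoid X T A) := by
  have : inactiveVoid X T A = ⋂ j, ((T j ⁻¹' {false})ᶜ ∪ (X j ⁻¹' A)ᶜ) := by
    ext ω
    simp [inactiveVoid, imp_iff_not_or]
  rw [this]
  exact MeasurableSet.iInter fun j =>
    ((hT j) (measurableSet_singleton _)).compl.union ((hX j) hA).compl

/-- The sum of a function of the marked active access points. -/
def activeSum {Ω : Type*} {M : ℕ} (X : ℕ → Ω → Plane) (T : ℕ → Ω → Bool) (G H : ℕ → Ω → Chan M)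
    (u : Plane × Chan M × Chan M → ℝ≥0∞) (ω : Ω) : ℝ≥0∞ :=
  ∑' j, if T j ω = true then u (X j ω, G j ω, H j ω) else 0

lemma activeSum_zero {Ω : Type*} {M : ℕ} {X : ℕ → Ω → Plane} {T : ℕ → Ω → Bool}
    {G H : ℕ → Ω → Chan M} : activeSum X T G H (fun _ => 0) = fun _ : Ω => (0 : ℝ≥0∞) := by
  funext ω; simp [activeSum]

lemma measurable_activeSum {Ω : Type*} [MeasurableSpace Ω] {μ : Measure Ω}
    {M : ℕ} {lamAP lamSK rho : ℝ} {X S : ℕ → Ω → Plane} {T : ℕ → Ω → Bool} {G H : ℕ → Ω → Chan M}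
    (hnet : IsNetwork μ M lamAP lamSK rho X S T G H)
    {u : Plane × Chan M × Chan M → ℝ≥0∞} (hu : Measurable u) :
    Measurable (activeSum X T G H u) := by
  unfold activeSum
  refine Measurable.tsum fun j => Measurable.ite
    (hnet.act_measurable j (measurableSet_singleton true)) ?_ measurable_const
  exact hu.comp ((hnet.ap.measurable j).prodMk ((hnet.g_measurable j).prodMk (hnet.h_measurable j)))

section Void

variable {Ω : Type*} [MeasurableSpace Ω] {μ : Measure Ω} [IsProbabilityMeasure μ] {M : ℕ}
  {lamAP lamSK rho : ℝ} {X S : ℕ → Ω → Plane} {T : ℕ → Ω → Bool} {G H : ℕ → Ω → Chan M}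

/-- The marked Laplace functional is used with weight `u` on active points and weight `∞` on
inactive points of `A`, so that every realization with an inactive point in `A` contributes `0`.
Averaging over the activity splits the exponent into an active and an inactive part, and the
transform factorizes. -/
lemma IsNetwork.laplace_active_void (hnet : IsNetwork μ M lamAP lamSK rho X S T G H)
    (hAP : 0 ≤ lamAP) (h0 : 0 ≤ rho) (h1 : rho ≤ 1)
    {u : Plane × Chan M × Chan M → ℝ≥0∞} (hu : Measurable u) {A : Set Plane}
    (hA : MeasurableSet A) :
    ∫⁻ ω in inactiveVoid X T A, expNeg (activeSum X T G H u ω) ∂μ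
      = expNeg (ENNReal.ofReal lamAP * (ENNReal.ofReal rho *
          ∫⁻ x, (1 - ∫⁻ v, expNeg (u (x, v)) ∂((rayleigh M).prod (rayleigh M)))))
        * expNeg (ENNReal.ofReal lamAP * (ENNReal.ofReal (1 - rho) * volume A)) := by
  classical
  have := isProbabilityMeasure_actLaw h0 h1
  set Φ : Plane × Bool × Chan M × Chan M → ℝ≥0∞ := fun q =>
    if q.2.1 = true then u (q.1, q.2.2) else A.indicator (fun _ => ∞) q.1 with hΦ
  have hΦm : Measurable Φ := by
    refine Measurable.ite ?_ (hu.comp (by fun_prop)) ?_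
    · have : Measurable fun q : Plane × Bool × Chan M × Chan M => q.2.1 := by fun_prop
      exact this (measurableSet_singleton true)
    · exact (measurable_const.indicator hA).comp measurable_fst
  have key := hnet.laplace_marked hAP h0 h1 hΦm
  have hL : ∀ ω, expNeg (∑' j, Φ (X j ω, T j ω, G j ω, H j ω))
      = (inactiveVoid X T A).indicator (fun ω => expNeg (activeSum X T G H u ω)) ω := by
    intro ω
    by_cases hω : ω ∈ inactiveVoid X T A
    · rw [indicator_of_mem hω, activeSum]
      congr 1
      refine tsum_congr fun j => ?_
      simp only [hΦ]
      split_ifs with hj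
      · rfl
      · exact indicator_of_notMem (hω j (by simpa using hj)) _
    · rw [indicator_of_notMem hω]
      simp only [inactiveVoid, mem_ofPred_eq, not_forall, not_not] at hω
      obtain ⟨j, hj, hjA⟩ := hω
      have : ∑' j, Φ (X j ω, T j ω, G j ω, H j ω) = ∞ := by
        refine top_le_iff.1 (le_trans (le_of_eq ?_) (ENNReal.le_tsum j))
        simp [hΦ, hj, hjA]
      rw [this, expNeg_top]
  rw [← lintegral_indicator (measurableSet_inactiveVoid hnet.ap.measurable hnet.act_measurable hA)]
  simp_rw [← hL]
  rw [key, ← expNeg_add, ← mul_add]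
  congr 2
  set p : Plane → ℝ≥0∞ := fun x => ∫⁻ v, expNeg (u (x, v)) ∂((rayleigh M).prod (rayleigh M)) with hp
  have hpm : Measurable p := (measurable_expNeg.comp hu).lintegral_prod_right'
  have hp1 : ∀ x, p x ≤ 1 := fun x => by
    calc p x ≤ ∫⁻ _, 1 ∂((rayleigh M).prod (rayleigh M)) := lintegral_mono fun v => expNeg_le_one _
      _ = 1 := by simp
  have hadd : ENNReal.ofReal rho + ENNReal.ofReal (1 - rho) = 1 := by
    rw [← ENNReal.ofReal_add h0 (by linarith)]; simp
  have hx : ∀ x, 1 - ∫⁻ v, expNeg (Φ (x, v)) ∂((actLaw rho).prod ((rayleigh M).prod (rayleigh M)))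
      = ENNReal.ofReal rho * (1 - p x) + ENNReal.ofReal (1 - rho) * A.indicator (fun _ => 1) x := by
    intro x
    have hxm : Measurable fun v => expNeg (Φ (x, v)) :=
      measurable_expNeg.comp (hΦm.comp measurable_prodMk_left)
    rw [lintegral_prod _ hxm.aemeasurable, lintegral_actLaw]
    have e1 : ∫⁻ y : Chan M × Chan M, expNeg (Φ (x, true, y)) ∂((rayleigh M).prod (rayleigh M))
        = p x := by simp [hΦ, hp]
    have e2 : ∫⁻ y : Chan M × Chan M, expNeg (Φ (x, false, y)) ∂((rayleigh M).prod (rayleigh M))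
        = Aᶜ.indicator (fun _ => 1) x := by
      by_cases hxA : x ∈ A <;> simp [hΦ, hxA]
    rw [e1, e2]
    refine ENNReal.sub_eq_of_eq_add ?_ ?_
    · refine ENNReal.add_ne_top.2 ⟨ENNReal.mul_ne_top ENNReal.ofReal_ne_top
        (ne_top_of_le_ne_top ENNReal.one_ne_top (hp1 x)), ENNReal.mul_ne_top ENNReal.ofReal_ne_top ?_⟩
      by_cases hxA : x ∈ A <;> simp [hxA]
    · have e3 : A.indicator (fun _ => (1 : ℝ≥0∞)) x + Aᶜ.indicator (fun _ => 1) x = 1 := by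
        by_cases hxA : x ∈ A <;> simp [hxA]
      calc (1 : ℝ≥0∞) = ENNReal.ofReal rho * ((1 - p x) + p x) + ENNReal.ofReal (1 - rho) *
            (A.indicator (fun _ => 1) x + Aᶜ.indicator (fun _ => 1) x) := by
            rw [e3, tsub_add_cancel_of_le (hp1 x), mul_one, mul_one, hadd]
        _ = _ := by ring
  simp_rw [hx]
  have hpm' : Measurable fun x => 1 - p x := measurable_const.sub hpm
  rw [lintegral_add_left (hpm'.const_mul _), lintegral_const_mul _ hpm',
    lintegral_const_mul _ (measurable_const.indicator hA), lintegral_indicator_const hA, one_mul]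

lemma IsNetwork.measure_inactiveVoid (hnet : IsNetwork μ M lamAP lamSK rho X S T G H)
    (hAP : 0 ≤ lamAP) (h0 : 0 ≤ rho) (h1 : rho ≤ 1) {A : Set Plane} (hA : MeasurableSet A) :
    μ (inactiveVoid X T A)
      = expNeg (ENNReal.ofReal lamAP * (ENNReal.ofReal (1 - rho) * volume A)) := by
  have := hnet.laplace_active_void hAP h0 h1 (u := fun _ => 0) measurable_const hA
  simpa [activeSum_zero] using this

lemma IsNetwork.laplace_active (hnet : IsNetwork μ M lamAP lamSK rho X S T G H)
    (hAP : 0 ≤ lamAP) (h0 : 0 ≤ rho) (h1 : rho ≤ 1)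
    {u : Plane × Chan M × Chan M → ℝ≥0∞} (hu : Measurable u) :
    ∫⁻ ω, expNeg (activeSum X T G H u ω) ∂μ
      = expNeg (ENNReal.ofReal lamAP * (ENNReal.ofReal rho *
          ∫⁻ x, (1 - ∫⁻ v, expNeg (u (x, v)) ∂((rayleigh M).prod (rayleigh M))))) := by
  have := hnet.laplace_active_void hAP h0 h1 hu MeasurableSet.empty
  have he : inactiveVoid X T ∅ = univ := by ext ω; simp [inactiveVoid]
  simpa [he] using this

/-- The events generated by the positions of the inactive access points. -/
@[reducible] def inactiveAlgebra {Ω : Type*} (X : ℕ → Ω → Plane) (T : ℕ → Ω → Bool) : MeasurableSpace Ω :=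
  MeasurableSpace.generateFrom {E | ∃ A, MeasurableSet A ∧ E = inactiveVoid X T A}

/-- In `E` both sides are finite measures. They agree on void events, and these form a π-system
because the voids of `A` and of `B` intersect in the void of `A ∪ B`. -/
lemma IsNetwork.lintegral_inactive_mul (hnet : IsNetwork μ M lamAP lamSK rho X S T G H)
    (hAP : 0 ≤ lamAP) (h0 : 0 ≤ rho) (h1 : rho ≤ 1)
    {u : Plane × Chan M × Chan M → ℝ≥0∞} (hu : Measurable u) {E : Set Ω}
    (hE : MeasurableSet[inactiveAlgebra X T] E) :
    ∫⁻ ω in E, expNeg (activeSum X T G H u ω) ∂μ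
      = μ E * ∫⁻ ω, expNeg (activeSum X T G H u ω) ∂μ := by
  set W : Ω → ℝ≥0∞ := fun ω => expNeg (activeSum X T G H u ω) with hW
  have hWm : Measurable W := measurable_expNeg.comp (measurable_activeSum hnet hu)
  have hW1 : ∫⁻ ω, W ω ∂μ ≤ 1 := by
    calc ∫⁻ ω, W ω ∂μ ≤ ∫⁻ _, 1 ∂μ := lintegral_mono fun v => expNeg_le_one _
      _ = 1 := by simp
  have hle : inactiveAlgebra X T ≤ ‹MeasurableSpace Ω› := by
    refine MeasurableSpace.generateFrom_le ?_
    rintro _ ⟨A, hA, rfl⟩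
    exact measurableSet_inactiveVoid hnet.ap.measurable hnet.act_measurable hA
  have hfin : IsFiniteMeasure (μ.withDensity W) :=
    isFiniteMeasure_withDensity (ne_top_of_le_ne_top ENNReal.one_ne_top hW1)
  have heq : (μ.withDensity W).trim hle = ((∫⁻ ω, W ω ∂μ) • μ).trim hle := by
    refine @ext_of_generate_finite Ω (inactiveAlgebra X T) _ _ _ rfl ?_ ?_ ?_ ?_
    · rintro _ ⟨A, hA, rfl⟩ _ ⟨B, hB, rfl⟩ _
      refine ⟨A ∪ B, hA.union hB, ?_⟩
      ext ω
      simp only [inactiveVoid, mem_inter_iff, mem_ofPred_eq, mem_union, not_or]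
      exact ⟨fun h j hj => ⟨h.1 j hj, h.2 j hj⟩, fun h => ⟨fun j hj => (h j hj).1, fun j hj => (h j hj).2⟩⟩
    · exact isFiniteMeasure_trim hle
    · rintro _ ⟨A, hA, rfl⟩
      have hs : MeasurableSet[inactiveAlgebra X T] (inactiveVoid X T A) :=
        MeasurableSpace.measurableSet_generateFrom ⟨A, hA, rfl⟩
      rw [trim_measurableSet_eq hle hs, trim_measurableSet_eq hle hs, withDensity_apply _ (hle _ hs),
        hnet.laplace_active_void hAP h0 h1 hu hA, ← hnet.laplace_active hAP h0 h1 hu,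
        ← hnet.measure_inactiveVoid hAP h0 h1 hA]
      rfl
    · rw [trim_measurableSet_eq hle MeasurableSet.univ, trim_measurableSet_eq hle MeasurableSet.univ,
        withDensity_apply _ MeasurableSet.univ]
      simp
  have h2 := congrArg (fun m => @DFunLike.coe _ _ _ _ m E) heq
  rw [trim_measurableSet_eq hle hE, trim_measurableSet_eq hle hE, withDensity_apply _ (hle _ hE)] at h2
  rw [h2, mul_comm]
  rfl

/-- Almost surely the typical access point is the unique nearest inactive access point. -/
lemma IsNetwork.ae_typicalAP (hnet : IsNetwork μ M lamAP lamSK rho X S T G H)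
    (hAP : 0 < lamAP) (h0 : 0 ≤ rho) (h1 : rho < 1) (o : Plane) :
    ∀ᵐ ω ∂μ, T (typicalAP o (fun i => X i ω) (fun i => T i ω)) ω = false ∧
      ∀ j, T j ω = false → j ≠ typicalAP o (fun i => X i ω) (fun i => T i ω) →
        dist (X (typicalAP o (fun i => X i ω) (fun i => T i ω)) ω) o < dist (X j ω) o := by
  -- The plane has infinite area and `rho < 1`, so inactive points are absent with probability
  -- `e^{-∞} = 0`.
  have hex : ∀ᵐ ω ∂μ, ∃ j, T j ω = false := by
    have := hnet.measure_inactiveVoid hAP.le h0 h1.le MeasurableSet.univ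
    have hv : volume (univ : Set Plane) = ∞ := measure_univ_of_isAddLeftInvariant _
    rw [hv, ENNReal.mul_top (by simpa using h1), ENNReal.mul_top (by simpa using hAP),
      expNeg_top] at this
    rw [ae_iff]
    convert this using 2
    ext ω
    simp [inactiveVoid]
  filter_upwards [hex, hnet.ap.ae_locallyFinite o, hnet.ap.ae_dist_ne hAP.le o] with ω h1 h2 h3
  have hs := nearest_spec (p := fun i => T i ω = false) h1 h2
  exact ⟨hs.1, fun j hj hne => lt_of_le_of_ne (hs.2 j hj) (h3 _ _ hne.symm)⟩

/-- Up to null events, the position of the typical access point is determined by the inactive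
access points. -/
lemma IsNetwork.exists_inactive_ae_eq (hnet : IsNetwork μ M lamAP lamSK rho X S T G H)
    (hAP : 0 < lamAP) (h0 : 0 ≤ rho) (h1 : rho < 1) (o : Plane) {B : Set Plane}
    (hB : MeasurableSet B) :
    ∃ E, MeasurableSet[inactiveAlgebra X T] E ∧
      {ω | apLoc o (fun i => X i ω) (fun i => T i ω) ∈ B} =ᵐ[μ] E := by
  set V : Set Plane → Set Ω := inactiveVoid X T with hV
  -- The event says that some disc about `o` has an inactive point in `B` and none outside `B`; the
  -- nearest inactive point then lies in `B`. Conversely, any `q` slightly larger than the nearest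
  -- distance isolates the nearest point. Rational radii keep the union countable.
  refine ⟨⋃ q : ℚ, (V (B ∩ Metric.ball o q))ᶜ ∩ V (Metric.ball o q \ B), ?_, ?_⟩
  · have hs : ∀ A, MeasurableSet A → MeasurableSet[inactiveAlgebra X T] (V A) := fun A hA =>
      MeasurableSpace.measurableSet_generateFrom ⟨A, hA, rfl⟩
    refine MeasurableSet.iUnion fun q => MeasurableSet.inter ?_ ?_
    · exact MeasurableSet.compl (hs _ (hB.inter measurableSet_ball))
    · exact hs _ (measurableSet_ball.diff hB)
  · filter_upwards [hnet.ae_typicalAP hAP h0 h1 o, hnet.ap.ae_locallyFinite o] with ω hω hfin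
    obtain ⟨ha, hmin⟩ := hω
    set a := typicalAP o (fun i => X i ω) (fun i => T i ω) with hadef
    have hloc : apLoc o (fun i => X i ω) (fun i => T i ω) = X a ω := rfl
    refine propext ?_
    change apLoc o (fun i => X i ω) (fun i => T i ω) ∈ B ↔ ω ∈ ⋃ q : ℚ, _
    rw [hloc]
    simp only [mem_iUnion, mem_inter_iff, mem_compl_iff]
    constructor
    · intro haB
      set d := dist (X a ω) o with hd
      obtain ⟨n, hn⟩ := exists_nat_gt (d + 1)
      -- Only finitely many points lie within `n > d + 1`, so some radii above `d` stay below the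
      -- distances of all the other inactive points.
      have hev : ∀ᶠ r in 𝓝[>] d, ∀ j ∈ {j | X j ω ∈ Metric.ball o n},
          T j ω = false → j ≠ a → r < dist (X j ω) o := by
        rw [eventually_all_finite (hfin n)]
        intro j _
        by_cases hj : T j ω = false ∧ j ≠ a
        · have : ∀ᶠ r in 𝓝[>] d, r < dist (X j ω) o :=
            mem_nhdsWithin_of_mem_nhds (Iio_mem_nhds (hmin j hj.1 hj.2))
          filter_upwards [this] with r hr _ _ using hr
        · exact Eventually.of_forall fun r h1 h2 => absurd ⟨h1, h2⟩ hj
      have hev2 : ∀ᶠ r in 𝓝[>] d, r < d + 1 :=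
        mem_nhdsWithin_of_mem_nhds (Iio_mem_nhds (by linarith))
      obtain ⟨b, hb, hsub⟩ := mem_nhdsGT_iff_exists_Ioo_subset.1 (hev.and hev2)
      obtain ⟨q, hq1, hq2⟩ := exists_rat_btwn (show d < b from hb)
      obtain ⟨hq3, hq4⟩ := hsub ⟨hq1, hq2⟩
      refine ⟨q, ?_, ?_⟩
      · intro hvoid
        exact hvoid a ha ⟨haB, Metric.mem_ball.2 hq1⟩
      · rintro j hj ⟨hjb, hjB⟩
        have hja : j ≠ a := fun h => hjB (h ▸ haB)
        have hjd : dist (X j ω) o < q := Metric.mem_ball.1 hjb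
        have := hq3 j (Metric.mem_ball.2 (by linarith)) hj hja
        exact absurd hjd (not_lt.2 this.le)
    · rintro ⟨q, hq1, hq2⟩
      simp only [hV, inactiveVoid, mem_ofPred_eq, not_forall, not_not] at hq1
      obtain ⟨j, hj, hjB, hjq⟩ := hq1
      have hle : dist (X a ω) o ≤ dist (X j ω) o := by
        by_cases hja : j = a
        · rw [hja]
        · exact (hmin j hj hja).le
      by_contra haB
      exact hq2 a ha ⟨Metric.mem_ball.2 (hle.trans_lt (Metric.mem_ball.1 hjq)), haB⟩

/-- The typical access point is independent of the active access points. -/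
theorem IsNetwork.lintegral_apLoc_mul (hnet : IsNetwork μ M lamAP lamSK rho X S T G H)
    (hAP : 0 < lamAP) (h0 : 0 ≤ rho) (h1 : rho < 1) (o : Plane)
    {u : Plane × Chan M × Chan M → ℝ≥0∞} (hu : Measurable u) {B : Set Plane}
    (hB : MeasurableSet B) :
    ∫⁻ ω in {ω | apLoc o (fun i => X i ω) (fun i => T i ω) ∈ B},
        expNeg (activeSum X T G H u ω) ∂μ
      = μ {ω | apLoc o (fun i => X i ω) (fun i => T i ω) ∈ B}
        * ∫⁻ ω, expNeg (activeSum X T G H u ω) ∂μ := by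
  obtain ⟨E, hE, hae⟩ := hnet.exists_inactive_ae_eq hAP h0 h1 o hB
  rw [setLIntegral_congr hae, measure_congr hae, hnet.lintegral_inactive_mul hAP.le h0 h1.le hu hE]

end Void

/-! ### Shot noise of a planar Poisson process with power-law attenuation -/

/-- Layer-cake form: `1 - e^{-a}` is the mass of `(0, a)` under the unit exponential law. It turns
integrals over the plane into areas of discs. -/
lemma one_sub_expNeg_eq (a : ℝ≥0∞) :
    1 - expNeg a = ∫⁻ v in Ioi (0 : ℝ), ENNReal.ofReal (Real.exp (-v))
      * {v : ℝ | ENNReal.ofReal v < a}.indicator (fun _ => 1) v := by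
  have h1 := lintegral_exp_neg_Ioi 0
  rw [neg_zero, Real.exp_zero, ENNReal.ofReal_one] at h1
  by_cases ha : a = ∞
  · subst ha
    simp [h1]
  · obtain ⟨b, hb, rfl⟩ : ∃ b : ℝ, 0 ≤ b ∧ a = ENNReal.ofReal b :=
      ⟨a.toReal, ENNReal.toReal_nonneg, (ENNReal.ofReal_toReal ha).symm⟩
    rw [expNeg_ofReal hb, ← lintegral_exp_neg_Ioi b]
    refine ENNReal.sub_eq_of_eq_add ?_ ?_
    · rw [lintegral_exp_neg_Ioi]; exact ENNReal.ofReal_ne_top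
    · refine h1.symm.trans ?_
      rw [← Ioc_union_Ioi_eq_Ioi hb, lintegral_union measurableSet_Ioi (Ioc_disjoint_Ioi le_rfl),
        lintegral_union measurableSet_Ioi (Ioc_disjoint_Ioi le_rfl)]
      have e1 : ∫⁻ v in Ioi b, ENNReal.ofReal (Real.exp (-v))
          * {v : ℝ | ENNReal.ofReal v < ENNReal.ofReal b}.indicator (fun _ => 1) v = 0 := by
        rw [← lintegral_zero (μ := volume.restrict (Ioi b))]
        refine setLIntegral_congr_fun measurableSet_Ioi fun v hv => ?_
        have hv' : b < v := hv
        rw [indicator_of_notMem, mul_zero]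
        exact not_lt.2 (ENNReal.ofReal_le_ofReal hv'.le)
      have e2 : ∫⁻ v in Ioc 0 b, ENNReal.ofReal (Real.exp (-v))
          * {v : ℝ | ENNReal.ofReal v < ENNReal.ofReal b}.indicator (fun _ => 1) v
          = ∫⁻ v in Ioc 0 b, ENNReal.ofReal (Real.exp (-v)) := by
        rw [setLIntegral_congr (Ioo_ae_eq_Ioc (a := (0 : ℝ)) (b := b)).symm,
          setLIntegral_congr (Ioo_ae_eq_Ioc (a := (0 : ℝ)) (b := b)).symm]
        refine setLIntegral_congr_fun measurableSet_Ioo fun v hv => ?_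
        rw [indicator_of_mem, mul_one]
        exact (ENNReal.ofReal_lt_ofReal_iff (hv.1.trans hv.2)).2 hv.2
      rw [e1, e2, add_zero]

/-- Solve `v < c d^{-β}` for the distance `d`; the centre is included because `0 ^ (-β) = ∞`. -/
lemma setOf_lt_pathLoss {β : ℝ} (hβ : 0 < β) {c v : ℝ} (hc : 0 < c) (hv : 0 < v) (y : Plane) :
    {p : Plane | ENNReal.ofReal v < ENNReal.ofReal c * edist p y ^ (-β)}
      = Metric.ball y ((c / v) ^ (1 / β)) := by
  ext p
  simp only [mem_ofPred_eq, Metric.mem_ball]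
  rcases (dist_nonneg (x := p) (y := y)).eq_or_lt with h0 | hpos
  · have he : edist p y = 0 := by rw [edist_dist, ← h0, ENNReal.ofReal_zero]
    rw [he, ENNReal.zero_rpow_of_neg (by linarith), ENNReal.mul_top (by simpa using hc), ← h0]
    simp only [ENNReal.ofReal_lt_top, true_iff]
    positivity
  · rw [edist_dist, ENNReal.ofReal_rpow_of_pos hpos, ← ENNReal.ofReal_mul hc.le,
      ENNReal.ofReal_lt_ofReal_iff_of_nonneg hv.le, Real.rpow_neg hpos.le, one_div,
      Real.lt_rpow_inv_iff_of_pos hpos.le (by positivity) hβ, ← div_eq_mul_inv,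
      lt_div_iff₀ (Real.rpow_pos_of_pos hpos β), lt_div_iff₀ hv, mul_comm]

/-- After exchanging the integrals, level `v` contributes the disc area `π (c / v)^(2/β)`.
Integration against `e^{-v}` leaves a Gamma integral that converges because `2 / β < 1`. -/
lemma lintegral_plane_pathLoss {β : ℝ} (hβ : 2 < β) {c : ℝ} (hc : 0 ≤ c) (y : Plane) :
    ∫⁻ p : Plane, (1 - expNeg (ENNReal.ofReal c * edist p y ^ (-β)))
      = ENNReal.ofReal (Real.pi * c ^ (2 / β) * Real.Gamma (1 - 2 / β)) := by
  have hβ0 : 0 < β := by linarith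
  have hpi := Real.pi_pos
  have h2β : 2 / β < 1 := (div_lt_one hβ0).2 hβ
  rcases hc.eq_or_lt with rfl | hc
  · have : (0 : ℝ) ^ (2 / β) = 0 := Real.zero_rpow (by positivity)
    simp [this]
  simp_rw [one_sub_expNeg_eq]
  rw [lintegral_lintegral_swap]
  · have h1 : ∀ v ∈ Ioi (0 : ℝ), ∫⁻ p : Plane, ENNReal.ofReal (Real.exp (-v))
        * {v : ℝ | ENNReal.ofReal v < ENNReal.ofReal c * edist p y ^ (-β)}.indicator (fun _ => 1) v
        = ENNReal.ofReal (Real.pi * c ^ (2 / β))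
          * (ENNReal.ofReal (Real.exp (-v)) * ENNReal.ofReal (v ^ ((1 - 2 / β) - 1))) := by
      intro v hv
      have hv0 : (0 : ℝ) < v := hv
      have e1 : ∀ p : Plane,
          {v : ℝ | ENNReal.ofReal v < ENNReal.ofReal c * edist p y ^ (-β)}.indicator
            (fun _ => (1 : ℝ≥0∞)) v
          = (Metric.ball y ((c / v) ^ (1 / β))).indicator (fun _ => 1) p := by
        intro p
        rw [← setOf_lt_pathLoss hβ0 hc hv0]
        rfl
      simp_rw [e1]
      rw [lintegral_const_mul _ (measurable_const.indicator measurableSet_ball),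
        lintegral_indicator_const measurableSet_ball, one_mul, EuclideanSpace.volume_ball_fin_two,
        ← ENNReal.ofReal_pow (by positivity), ← ENNReal.ofReal_mul (by positivity),
        ← ENNReal.ofReal_mul (by positivity), ← ENNReal.ofReal_mul (by positivity),
        ← ENNReal.ofReal_mul (by positivity)]
      congr 1
      rw [← Real.rpow_natCast, ← Real.rpow_mul (by positivity), Real.div_rpow hc.le hv0.le,
        show 1 - 2 / β - 1 = -(2 / β) by ring, Real.rpow_neg hv0.le,
        show 1 / β * ((2 : ℕ) : ℝ) = 2 / β by push_cast; ring]
      ring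
    rw [setLIntegral_congr_fun measurableSet_Ioi h1, lintegral_const_mul _ (by fun_prop),
      lintegral_exp_neg_mul_rpow (by linarith), ← ENNReal.ofReal_mul (by positivity)]
  · refine Measurable.aemeasurable (Measurable.mul (by fun_prop) ?_)
    have hs : MeasurableSet {q : Plane × ℝ |
        ENNReal.ofReal q.2 < ENNReal.ofReal c * edist q.1 y ^ (-β)} := by
      refine measurableSet_lt (by fun_prop) (Measurable.const_mul ?_ _)
      exact (Measurable.edist measurable_fst measurable_const).pow_const _
    exact (measurable_const.indicator hs : Measurable ({q : Plane × ℝ |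
        ENNReal.ofReal q.2 < ENNReal.ofReal c * edist q.1 y ^ (-β)}.indicator fun _ => (1 : ℝ≥0∞)))

/-- Attenuated gain of an interferer, as seen from `y`. -/
def attenuatedGain (M : ℕ) (β : ℝ) (y : Plane) (q : Plane × Chan M × Chan M) : ℝ≥0∞ :=
  ENNReal.ofReal (beamGain q.2.1 q.2.2) * edist q.1 y ^ (-β)

lemma measurable_attenuatedGain (M : ℕ) (β : ℝ) (y : Plane) :
    Measurable (attenuatedGain M β y) := by
  unfold attenuatedGain
  refine (ENNReal.measurable_ofReal.comp (measurable_beamGain.comp measurable_snd)).mul ?_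
  exact (Measurable.edist measurable_fst measurable_const).pow_const _

lemma beamGain_nonneg {M : ℕ} (g h : Chan M) : 0 ≤ beamGain g h := sq_nonneg _

/-- For a fixed gain the plane integral is proportional to the gain to the power `2/β`, so after
exchanging the integrals only that fractional moment is needed. The value does not depend on `y`. -/
lemma lintegral_shotNoise {M : ℕ} (hM : 1 ≤ M) {β : ℝ} (hβ : 2 < β) {x : ℝ} (hx : 0 ≤ x)
    (y : Plane) :
    ∫⁻ p : Plane, (1 - ∫⁻ v, expNeg (ENNReal.ofReal x * attenuatedGain M β y (p, v))
        ∂((rayleigh M).prod (rayleigh M)))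
      = ENNReal.ofReal (Real.pi * x ^ (2 / β) * Real.Gamma (1 + 2 / β) * Real.Gamma (1 - 2 / β)) := by
  have hβ0 : 0 < β := by linarith
  have hpi := Real.pi_pos
  have h2β : 2 / β < 1 := (div_lt_one hβ0).2 hβ
  have hG : 0 < Real.Gamma (1 - 2 / β) := Real.Gamma_pos_of_pos (by linarith)
  have hG' : 0 < Real.Gamma (1 + 2 / β) := Real.Gamma_pos_of_pos (by positivity)
  have hm : Measurable fun q : Plane × Chan M × Chan M =>
      expNeg (ENNReal.ofReal x * attenuatedGain M β y q) :=
    measurable_expNeg.comp ((measurable_attenuatedGain M β y).const_mul _)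
  have h1 : ∀ p : Plane, 1 - ∫⁻ v, expNeg (ENNReal.ofReal x * attenuatedGain M β y (p, v))
        ∂((rayleigh M).prod (rayleigh M))
      = ∫⁻ v, (1 - expNeg (ENNReal.ofReal x * attenuatedGain M β y (p, v)))
        ∂((rayleigh M).prod (rayleigh M)) := by
    intro p
    have hmp : Measurable fun v => expNeg (ENNReal.ofReal x * attenuatedGain M β y (p, v)) :=
      hm.comp measurable_prodMk_left
    rw [lintegral_sub hmp]
    · simp
    · refine ne_top_of_le_ne_top ENNReal.one_ne_top ?_
      calc _ ≤ ∫⁻ _, 1 ∂((rayleigh M).prod (rayleigh M)) := lintegral_mono fun v => expNeg_le_one _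
        _ = 1 := by simp
    · exact Eventually.of_forall fun v => expNeg_le_one _
  simp_rw [h1]
  rw [lintegral_lintegral_swap (measurable_const.sub hm).aemeasurable]
  have h2 : ∀ v : Chan M × Chan M,
      ∫⁻ p : Plane, (1 - expNeg (ENNReal.ofReal x * attenuatedGain M β y (p, v)))
      = ENNReal.ofReal (Real.pi * x ^ (2 / β) * Real.Gamma (1 - 2 / β))
        * ENNReal.ofReal (beamGain v.1 v.2 ^ (2 / β)) := by
    intro v
    have hb := beamGain_nonneg v.1 v.2
    simp only [attenuatedGain]
    simp_rw [← mul_assoc, ← ENNReal.ofReal_mul hx]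
    rw [lintegral_plane_pathLoss hβ (by positivity), ← ENNReal.ofReal_mul (by positivity),
      Real.mul_rpow hx hb]
    congr 1; ring
  simp_rw [h2]
  rw [lintegral_const_mul, lintegral_beamGain_rpow hM (by positivity),
    ← ENNReal.ofReal_mul (by positivity)]
  · congr 1; ring
  · exact ENNReal.measurable_ofReal.comp (measurable_beamGain.pow_const _)

/-- Laplace transform of the interference at the typical sink. -/
def interferenceLaplace (β lamAP rho x : ℝ) : ℝ :=
  Real.exp (-(lambdaTwo β lamAP rho * x ^ (2 / β)))

lemma lambdaTwo_pos {β lamAP rho : ℝ} (hAP : 0 < lamAP) (hrho : 0 < rho) (hβ : 2 < β) :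
    0 < lambdaTwo β lamAP rho := by
  have hβ0 : 0 < β := by linarith
  have h2β : 2 / β < 1 := (div_lt_one hβ0).2 hβ
  have hG : 0 < Real.Gamma (1 - 2 / β) := Real.Gamma_pos_of_pos (by linarith)
  have hG' : 0 < Real.Gamma (1 + 2 / β) := Real.Gamma_pos_of_pos (by positivity)
  have := Real.pi_pos
  unfold lambdaTwo
  positivity

lemma activeSum_const_mul {Ω : Type*} {M : ℕ} (X : ℕ → Ω → Plane) (T : ℕ → Ω → Bool)
    (G H : ℕ → Ω → Chan M) (c : ℝ≥0∞) (u : Plane × Chan M × Chan M → ℝ≥0∞) (ω : Ω) :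
    activeSum X T G H (fun q => c * u q) ω = c * activeSum X T G H u ω := by
  rw [activeSum, activeSum, ← ENNReal.tsum_mul_left]
  simp_rw [mul_ite, mul_zero]

section Network

variable {Ω : Type*} [MeasurableSpace Ω] {μ : Measure Ω} [IsProbabilityMeasure μ] {M : ℕ}
  {lamAP lamSK rho β : ℝ} {X S : ℕ → Ω → Plane} {T : ℕ → Ω → Bool} {G H : ℕ → Ω → Chan M}

lemma IsNetwork.lintegral_apLoc_interference (hnet : IsNetwork μ M lamAP lamSK rho X S T G H)
    (hM : 1 ≤ M) (hAP : 0 < lamAP) (h0 : 0 < rho) (h1 : rho < 1) (hβ : 2 < β) (o y : Plane)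
    {x : ℝ} (hx : 0 ≤ x) {B : Set Plane} (hB : MeasurableSet B) :
    ∫⁻ ω in {ω | apLoc o (fun i => X i ω) (fun i => T i ω) ∈ B},
        expNeg (ENNReal.ofReal x * activeSum X T G H (attenuatedGain M β y) ω) ∂μ
      = μ {ω | apLoc o (fun i => X i ω) (fun i => T i ω) ∈ B}
        * ENNReal.ofReal (interferenceLaplace β lamAP rho x) := by
  have hu : Measurable fun q => ENNReal.ofReal x * attenuatedGain M β y q :=
    (measurable_attenuatedGain M β y).const_mul _
  have key := hnet.lintegral_apLoc_mul hAP h0.le h1 o hu hB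
  have hlam := lambdaTwo_pos hAP h0 hβ
  rw [hnet.laplace_active hAP.le h0.le h1.le hu, lintegral_shotNoise hM hβ hx,
    ← ENNReal.ofReal_mul h0.le, ← ENNReal.ofReal_mul hAP.le, expNeg_ofReal] at key
  · simp_rw [activeSum_const_mul] at key
    rw [key, interferenceLaplace, lambdaTwo]
    congr 4
    ring
  · have : lamAP * (rho * (Real.pi * x ^ (2 / β) * Real.Gamma (1 + 2 / β) * Real.Gamma (1 - 2 / β)))
        = lambdaTwo β lamAP rho * x ^ (2 / β) := by rw [lambdaTwo]; ring
    rw [this]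
    positivity

end Network

/-! ### Joint law of the link distance and the interference -/

/-- The realization of the network at `ω`. -/
def config {Ω : Type*} {M : ℕ} (X S : ℕ → Ω → Plane) (T : ℕ → Ω → Bool) (G H : ℕ → Ω → Chan M)
    (ω : Ω) : Config M :=
  ((fun j => X j ω), (fun j => S j ω), (fun j => T j ω), (fun j => G j ω), (fun j => H j ω))

lemma IsNetwork.measurable_config {Ω : Type*} [MeasurableSpace Ω] {μ : Measure Ω}
    {M : ℕ} {lamAP lamSK rho : ℝ} {X S : ℕ → Ω → Plane} {T : ℕ → Ω → Bool} {G H : ℕ → Ω → Chan M}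
    (hnet : IsNetwork μ M lamAP lamSK rho X S T G H) : Measurable (config X S T G H) :=
  (measurable_pi_lambda _ hnet.ap.measurable).prodMk
    ((measurable_pi_lambda _ hnet.sink.measurable).prodMk hnet.measurable_marks)

/-- Finite measures on `[0, 1]` are determined by their moments. -/
lemma ext_of_moments {ν₁ ν₂ : Measure ℝ} [IsFiniteMeasure ν₁] [IsFiniteMeasure ν₂]
    (h₁ : ∀ᵐ u ∂ν₁, |u| ≤ 1) (h₂ : ∀ᵐ u ∂ν₂, |u| ≤ 1)
    (h : ∀ n : ℕ, ∫ u, u ^ n ∂ν₁ = ∫ u, u ^ n ∂ν₂) : ν₁ = ν₂ := by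
  -- On `[-1, 1]` the exponential series can be integrated term by term, so the moments determine
  -- the complex moment generating function.
  have key : ∀ (ν : Measure ℝ) [IsFiniteMeasure ν], (∀ᵐ u ∂ν, |u| ≤ 1) → ∀ z : ℂ,
      HasSum (fun n : ℕ => z ^ n / n ! * ((∫ u, u ^ n ∂ν : ℝ) : ℂ)) (complexMGF id ν z) := by
    intro ν _ hν z
    have hs := hasSum_integral_of_dominated_convergence (μ := ν)
      (F := fun (n : ℕ) (u : ℝ) => (z * u) ^ n / (n ! : ℂ))
      (f := fun u : ℝ => Complex.exp (z * u))
      (bound := fun n _ => ‖z‖ ^ n / n !) ?_ ?_ ?_ ?_ ?_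
    · simp only [complexMGF, id]
      have e : (fun n : ℕ => z ^ n / n ! * ((∫ u, u ^ n ∂ν : ℝ) : ℂ))
          = fun n : ℕ => ∫ u : ℝ, (z * u) ^ n / (n ! : ℂ) ∂ν := by
        funext n
        rw [← integral_complex_ofReal, ← integral_const_mul]
        refine integral_congr_ae (Eventually.of_forall fun u => ?_)
        simp only [mul_pow]
        push_cast
        ring
      rw [e]
      exact hs
    · intro n; fun_prop
    · intro n
      filter_upwards [hν] with u hu
      rw [norm_div, norm_pow, norm_mul, Complex.norm_natCast, Complex.norm_real, Real.norm_eq_abs]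
      gcongr
      exact mul_le_of_le_one_right (norm_nonneg _) hu
    · exact Eventually.of_forall fun u => Real.summable_pow_div_factorial _
    · exact integrable_const _
    · refine Eventually.of_forall fun u => ?_
      have := NormedSpace.expSeries_div_hasSum_exp (z * u)
      rwa [← Complex.exp_eq_exp_ℂ] at this
  refine Measure.ext_of_complexMGF_id_eq (funext fun z => ?_)
  refine (key ν₁ h₁ z).unique ?_
  simp_rw [h]
  exact key ν₂ h₂ z

/-- An inactive access point is not in the sum anyway, so excluding `a` has no effect. -/
lemma interference_eq_of_inactive {M : ℕ} (β : ℝ) (x : ℕ → Plane) (t : ℕ → Bool)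
    (g h : ℕ → Chan M) {a : ℕ} (ha : t a = false) (y : Plane) :
    interference β x t g h a y
      = ∑' j, if t j = true then attenuatedGain M β y (x j, g j, h j) else 0 := by
  rw [interference]
  refine tsum_congr fun j => ?_
  by_cases hj : t j = true
  · have : j ≠ a := fun h => by rw [h, ha] at hj; exact absurd hj (by simp)
    simp [hj, this, attenuatedGain]
  · simp [hj]

section Network

variable {Ω : Type*} [MeasurableSpace Ω] {μ : Measure Ω} [IsProbabilityMeasure μ] {M : ℕ}
  {lamAP lamSK rho β : ℝ} {X S : ℕ → Ω → Plane} {T : ℕ → Ω → Bool} {G H : ℕ → Ω → Chan M}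

/-- The sinks may be replaced by an independent copy. -/
lemma IsNetwork.lintegral_config (hnet : IsNetwork μ M lamAP lamSK rho X S T G H)
    (h0 : 0 ≤ rho) (h1 : rho ≤ 1) {F : Config M → ℝ≥0∞} (hF : Measurable F) :
    ∫⁻ ω, F (config X S T G H ω) ∂μ
      = ∫⁻ ω', ∫⁻ ω, F ((fun j => X j ω), (fun j => S j ω'), (fun j => T j ω), (fun j => G j ω),
          (fun j => H j ω)) ∂μ ∂μ := by
  have := isProbabilityMeasure_actLaw h0 h1
  have : IsProbabilityMeasure (markLaw M rho) := by unfold markLaw; infer_instance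
  have mX := measurable_pi_lambda (fun ω j => X j ω) hnet.ap.measurable
  have mS := measurable_pi_lambda (fun ω j => S j ω) hnet.sink.measurable
  have : IsProbabilityMeasure (μ.map (fun ω j => X j ω)) :=
    Measure.isProbabilityMeasure_map mX.aemeasurable
  have : IsProbabilityMeasure (μ.map (fun ω j => S j ω)) :=
    Measure.isProbabilityMeasure_map mS.aemeasurable
  have hFm : Measurable fun q : ((ℕ → Plane) × (ℕ → Plane)) × (ℕ → Bool) × (ℕ → Chan M) ×
      (ℕ → Chan M) => F (q.1.1, q.1.2, q.2) := hF.comp (by fun_prop)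
  have e1 : ∫⁻ ω, F (config X S T G H ω) ∂μ
      = ∫⁻ x, ∫⁻ s, ∫⁻ m, F (x, s, m) ∂(markLaw M rho) ∂(μ.map (fun ω j => S j ω))
          ∂(μ.map (fun ω j => X j ω)) := by
    rw [← lintegral_map hF hnet.measurable_config]
    change ∫⁻ a, F a ∂(μ.map (fun ω => ((fun j => X j ω), (fun j => S j ω), (fun j => T j ω),
      (fun j => G j ω), (fun j => H j ω)))) = _
    rw [hnet.map_all h0, lintegral_prod _ hF.aemeasurable]
    refine lintegral_congr fun x => ?_
    rw [lintegral_prod]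
    exact (hF.comp measurable_prodMk_left).aemeasurable
  have hin : Measurable fun p : (ℕ → Plane) × (ℕ → Plane) =>
      ∫⁻ m, F (p.1, p.2, m) ∂(markLaw M rho) := hFm.lintegral_prod_right'
  rw [e1, lintegral_lintegral_swap hin.aemeasurable,
    lintegral_map (Measurable.lintegral_prod_left' hin) mS]
  refine lintegral_congr fun ω' => ?_
  have hs : Measurable fun q : (ℕ → Plane) × (ℕ → Bool) × (ℕ → Chan M) × (ℕ → Chan M) =>
      F (q.1, (fun j => S j ω'), q.2) := hF.comp (by fun_prop)
  rw [← lintegral_prod _ hs.aemeasurable, ← hnet.map_ap_marks h0,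
    lintegral_map hs (mX.prodMk hnet.measurable_marks)]

/-- Given the sinks, `typicalSink` cuts the plane into countably many Voronoi cells. When the
typical access point is in cell `k`, the receiver is the fixed point `s k` and the event on the link
distance concerns only the location of the typical access point. `lintegral_apLoc_interference`
therefore gives the same factor on every cell, and the cells add up. -/
lemma IsNetwork.lintegral_linkDist_interference (hnet : IsNetwork μ M lamAP lamSK rho X S T G H)
    (hM : 1 ≤ M) (hAP : 0 < lamAP) (h0 : 0 < rho) (h1 : rho < 1) (hβ : 2 < β) (o : Plane)
    {x : ℝ} (hx : 0 ≤ x) {C : Set ℝ} (hC : MeasurableSet C) :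
    ∫⁻ ω in {ω | linkDist o (config X S T G H ω) ∈ C},
        expNeg (ENNReal.ofReal x * sinkInterference β o (config X S T G H ω)) ∂μ
      = μ {ω | linkDist o (config X S T G H ω) ∈ C}
        * ENNReal.ofReal (interferenceLaplace β lamAP rho x) := by
  classical
  have hCm : MeasurableSet {q : Config M | linkDist o q ∈ C} := measurable_linkDist o hC
  have hCΩ : MeasurableSet {ω | linkDist o (config X S T G H ω) ∈ C} :=
    hnet.measurable_config hCm
  set F : Config M → ℝ≥0∞ := {q : Config M | linkDist o q ∈ C}.indicator
    (fun q => expNeg (ENNReal.ofReal x * sinkInterference β o q)) with hF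
  have hFm : Measurable F :=
    (measurable_expNeg.comp ((measurable_sinkInterference β o).const_mul _)).indicator hCm
  set D : Config M → ℝ≥0∞ := {q : Config M | linkDist o q ∈ C}.indicator (fun _ => 1) with hD
  have hDm : Measurable D := measurable_const.indicator hCm
  have eF : ∫⁻ ω in {ω | linkDist o (config X S T G H ω) ∈ C},
      expNeg (ENNReal.ofReal x * sinkInterference β o (config X S T G H ω)) ∂μ
      = ∫⁻ ω, F (config X S T G H ω) ∂μ := by
    rw [← lintegral_indicator hCΩ]
    exact lintegral_congr fun ω => rfl
  have eD : μ {ω | linkDist o (config X S T G H ω) ∈ C} = ∫⁻ ω, D (config X S T G H ω) ∂μ := by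
    rw [← lintegral_indicator_one hCΩ]
    exact lintegral_congr fun ω => rfl
  rw [eF, eD, hnet.lintegral_config h0.le h1.le hFm, hnet.lintegral_config h0.le h1.le hDm,
    ← lintegral_mul_const' _ _ ENNReal.ofReal_ne_top]
  refine lintegral_congr fun ω' => ?_
  set s : ℕ → Plane := fun j => S j ω' with hs
  set z : Ω → Plane := fun ω => apLoc o (fun i => X i ω) (fun i => T i ω) with hz
  have hzm : Measurable z := (measurable_apLoc o).comp
    (f := fun ω => ((fun i => X i ω), (fun i => T i ω)))
    ((measurable_pi_lambda _ hnet.ap.measurable).prodMk (measurable_pi_lambda _ hnet.act_measurable))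
  set B : ℕ → Set Plane := fun k => {p | typicalSink s p = k ∧ dist p (s k) ∈ C} with hB
  have hsm : Measurable fun p : Plane => typicalSink s p :=
    measurable_typicalSink.comp (f := fun p : Plane => (s, p)) (measurable_const.prodMk measurable_id)
  have hBm : ∀ k, MeasurableSet (B k) := fun k =>
    (hsm (measurableSet_singleton k)).inter
      ((by fun_prop : Measurable fun p : Plane => dist p (s k)) hC)
  have hBz : ∀ k, MeasurableSet {ω | z ω ∈ B k} := fun k => hzm (hBm k)
  have hsplit : ∀ (ω : Ω) (f : Plane → ℝ≥0∞),
      ∑' k, {ω | z ω ∈ B k}.indicator (fun _ => f (s k)) ω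
        = if dist (z ω) (sinkLoc s (z ω)) ∈ C then f (sinkLoc s (z ω)) else 0 := by
    intro ω f
    rw [tsum_eq_single (typicalSink s (z ω))]
    · by_cases h : dist (z ω) (sinkLoc s (z ω)) ∈ C
      · rw [if_pos h, indicator_of_mem]
        · rfl
        · exact ⟨rfl, h⟩
      · rw [if_neg h, indicator_of_notMem]
        exact fun h' => h h'.2
    · intro k hk
      rw [indicator_of_notMem]
      exact fun h' => hk h'.1.symm
  have hFae : ∀ᵐ ω ∂μ, F ((fun j => X j ω), s, (fun j => T j ω), (fun j => G j ω), (fun j => H j ω))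
      = ∑' k, {ω | z ω ∈ B k}.indicator (fun ω => expNeg (ENNReal.ofReal x *
          activeSum X T G H (attenuatedGain M β (s k)) ω)) ω := by
    filter_upwards [hnet.ae_typicalAP hAP h0.le h1 o] with ω hω
    have h2 := hsplit ω (fun y => expNeg (ENNReal.ofReal x *
      activeSum X T G H (attenuatedGain M β y) ω))
    have h3 : ∀ k, {ω | z ω ∈ B k}.indicator (fun ω => expNeg (ENNReal.ofReal x *
          activeSum X T G H (attenuatedGain M β (s k)) ω)) ω
        = {ω | z ω ∈ B k}.indicator (fun _ => expNeg (ENNReal.ofReal x *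
          activeSum X T G H (attenuatedGain M β (s k)) ω)) ω := fun k => by
      simp only [indicator]
    simp_rw [h3]
    rw [h2]
    simp only [hF, indicator, mem_ofPred_eq, linkDist]
    refine if_congr Iff.rfl ?_ rfl
    rw [sinkInterference, interference_eq_of_inactive _ _ _ _ _ hω.1]
    rfl
  have hDeq : ∀ ω, D ((fun j => X j ω), s, (fun j => T j ω), (fun j => G j ω), (fun j => H j ω))
      = ∑' k, {ω | z ω ∈ B k}.indicator (fun _ => 1) ω := by
    intro ω
    rw [hsplit ω (fun _ => 1)]
    simp only [hD, indicator, mem_ofPred_eq, linkDist]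
    rfl
  rw [lintegral_congr_ae hFae, lintegral_tsum]
  · simp_rw [hDeq]
    rw [lintegral_tsum (fun k => (measurable_const.indicator (hBz k)).aemeasurable),
      ← ENNReal.tsum_mul_right]
    refine tsum_congr fun k => ?_
    rw [lintegral_indicator (hBz k), lintegral_indicator_const (hBz k), one_mul]
    exact hnet.lintegral_apLoc_interference hM hAP h0 h1 hβ o (s k) hx (hBm k)
  · intro k
    refine (Measurable.indicator (measurable_expNeg.comp (Measurable.const_mul ?_ _))
      (hBz k)).aemeasurable
    exact measurable_activeSum hnet (measurable_attenuatedGain M β (s k))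

lemma IsNetwork.laplace_interference (hnet : IsNetwork μ M lamAP lamSK rho X S T G H)
    (hM : 1 ≤ M) (hAP : 0 < lamAP) (h0 : 0 < rho) (h1 : rho < 1) (hβ : 2 < β) (o : Plane)
    {x : ℝ} (hx : 0 ≤ x) :
    ∫⁻ ω, expNeg (ENNReal.ofReal x * sinkInterference β o (config X S T G H ω)) ∂μ
      = ENNReal.ofReal (interferenceLaplace β lamAP rho x) := by
  have := hnet.lintegral_linkDist_interference hM hAP h0 h1 hβ o hx MeasurableSet.univ
  simpa using this

/-- The interference at the typical sink is almost surely finite. -/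
lemma IsNetwork.ae_interference_ne_top (hnet : IsNetwork μ M lamAP lamSK rho X S T G H)
    (hM : 1 ≤ M) (hAP : 0 < lamAP) (h0 : 0 < rho) (h1 : rho < 1) (hβ : 2 < β) (o : Plane) :
    ∀ᵐ ω ∂μ, sinkInterference β o (config X S T G H ω) ≠ ∞ := by
  have hIm : Measurable fun ω => sinkInterference β o (config X S T G H ω) :=
    (measurable_sinkInterference β o).comp hnet.measurable_config
  have hs : MeasurableSet {ω | sinkInterference β o (config X S T G H ω) ≠ ∞} :=
    (hIm (measurableSet_singleton ∞)).compl
  -- For `x > 0` the variable `e^{-x I}` is at most `1` and vanishes where `I = ∞`, so its mean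
  -- bounds the probability of finiteness from below; this mean tends to `1` as `x → 0`.
  have hb : ∀ n : ℕ, ENNReal.ofReal (interferenceLaplace β lamAP rho (1 / ((n : ℝ) + 1)))
      ≤ μ {ω | sinkInterference β o (config X S T G H ω) ≠ ∞} := by
    intro n
    have hn : (0 : ℝ) < 1 / ((n : ℝ) + 1) := by positivity
    rw [← hnet.laplace_interference hM hAP h0 h1 hβ o hn.le, ← lintegral_indicator_one hs]
    refine lintegral_mono fun ω => ?_
    by_cases hω : sinkInterference β o (config X S T G H ω) = ∞
    · rw [hω, ENNReal.mul_top (by simpa using hn), expNeg_top]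
      exact zero_le
    · rw [indicator_of_mem (show ω ∈ {ω | sinkInterference β o (config X S T G H ω) ≠ ∞} from hω)]
      exact expNeg_le_one _
  have hlim : Tendsto (fun n : ℕ => ENNReal.ofReal
      (interferenceLaplace β lamAP rho (1 / ((n : ℝ) + 1)))) atTop (𝓝 1) := by
    rw [← ENNReal.ofReal_one]
    refine ENNReal.tendsto_ofReal ?_
    have hβ0 : 0 < 2 / β := div_pos two_pos (by linarith)
    have hcont : Continuous fun x : ℝ => interferenceLaplace β lamAP rho x := by
      unfold interferenceLaplace
      exact Real.continuous_exp.comp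
        ((Real.continuous_rpow_const hβ0.le).const_mul (lambdaTwo β lamAP rho)).neg
    have hz : interferenceLaplace β lamAP rho 0 = 1 := by
      simp [interferenceLaplace, Real.zero_rpow hβ0.ne']
    conv => rhs; rw [← hz]
    exact (hcont.tendsto 0).comp tendsto_one_div_add_atTop_nhds_zero_nat
  have h1' : (1 : ℝ≥0∞) ≤ μ {ω | sinkInterference β o (config X S T G H ω) ≠ ∞} :=
    le_of_tendsto' hlim hb
  rw [ae_iff_measure_eq hs.nullMeasurableSet, measure_univ]
  exact le_antisymm prob_le_one h1'

/-- The link distance is independent of the interference at the typical sink. -/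
theorem IsNetwork.indepFun_linkDist_interference
    (hnet : IsNetwork μ M lamAP lamSK rho X S T G H)
    (hM : 1 ≤ M) (hAP : 0 < lamAP) (h0 : 0 < rho) (h1 : rho < 1) (hβ : 2 < β) (o : Plane) :
    IndepFun (fun ω => linkDist o (config X S T G H ω))
      (fun ω => (expNeg (sinkInterference β o (config X S T G H ω))).toReal) μ := by
  set R : Ω → ℝ := fun ω => linkDist o (config X S T G H ω) with hR
  set I : Ω → ℝ≥0∞ := fun ω => sinkInterference β o (config X S T G H ω) with hI
  set U : Ω → ℝ := fun ω => (expNeg (I ω)).toReal with hU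
  have hRm : Measurable R := (measurable_linkDist o).comp hnet.measurable_config
  have hIm : Measurable I := (measurable_sinkInterference β o).comp hnet.measurable_config
  have hUm : Measurable U := (measurable_expNeg.comp hIm).ennreal_toReal
  have hU1 : ∀ ω, |U ω| ≤ 1 := fun ω => by
    rw [hU, abs_of_nonneg ENNReal.toReal_nonneg]
    simpa using ENNReal.toReal_mono ENNReal.one_ne_top (expNeg_le_one (I ω))
  have hset : MeasurableSet {u : ℝ | |u| ≤ 1} := measurableSet_le (by fun_prop) measurable_const
  -- The moments of `U = e^{-I}` are the Laplace transform of `I` at the integers. Restricted to `R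
  -- ∈ C` they are merely multiplied by the probability of that event, and moments determine a law
  -- on `[0, 1]`.
  have hmom : ∀ C : Set ℝ, MeasurableSet C → ∀ n : ℕ, ∫ ω in R ⁻¹' C, U ω ^ n ∂μ
      = μ.real (R ⁻¹' C) * interferenceLaplace β lamAP rho n := by
    intro C hC n
    have key := hnet.lintegral_linkDist_interference hM hAP h0 h1 hβ o (Nat.cast_nonneg n) hC
    have e : ∀ ω, U ω ^ n = (expNeg (ENNReal.ofReal n * I ω)).toReal := by
      intro ω
      rw [hU, ENNReal.ofReal_natCast, mul_comm, expNeg_mul_nat, ENNReal.toReal_pow]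
    simp_rw [e]
    rw [integral_toReal]
    · have h2 := congrArg ENNReal.toReal key
      have hL : 0 ≤ interferenceLaplace β lamAP rho n := (Real.exp_pos _).le
      rw [ENNReal.toReal_mul, ENNReal.toReal_ofReal hL] at h2
      exact h2
    · exact (measurable_expNeg.comp (hIm.const_mul _)).aemeasurable
    · exact Eventually.of_forall fun ω => (expNeg_le_one _).trans_lt ENNReal.one_lt_top
  rw [indepFun_iff_measure_inter_preimage_eq_mul]
  intro C D hC hD
  have hext : (μ.restrict (R ⁻¹' C)).map U = μ (R ⁻¹' C) • μ.map U := by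
    have : IsFiniteMeasure (μ (R ⁻¹' C) • μ.map U) := Measure.smul_finite _ (measure_ne_top _ _)
    refine ext_of_moments ?_ ?_ fun n => ?_
    · rw [ae_map_iff hUm.aemeasurable hset]
      exact Eventually.of_forall hU1
    · refine Measure.ae_smul_measure ?_ _
      rw [ae_map_iff hUm.aemeasurable hset]
      exact Eventually.of_forall hU1
    · rw [integral_map hUm.aemeasurable (by fun_prop), integral_smul_measure,
        integral_map hUm.aemeasurable (by fun_prop), hmom C hC]
      have := hmom univ MeasurableSet.univ n
      simp only [preimage_univ, Measure.restrict_univ, probReal_univ, one_mul] at this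
      rw [this]
      rfl
  have h2 := congrArg (fun ν => ν D) hext
  simp only [Measure.smul_apply, smul_eq_mul] at h2
  rw [Measure.map_apply hUm hD, Measure.map_apply hUm hD, Measure.restrict_apply (hUm hD)] at h2
  rw [inter_comm]
  exact h2

/-- Tail of the link distance. -/
lemma IsNetwork.measure_lt_linkDist (hnet : IsNetwork μ M lamAP lamSK rho X S T G H)
    (hSK : 0 < lamSK) (h0 : 0 ≤ rho) (h1 : rho ≤ 1) (o : Plane) {r : ℝ} (hr : 0 ≤ r) :
    μ {ω | r < linkDist o (config X S T G H ω)}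
      = ENNReal.ofReal (Real.exp (-(Real.pi * lamSK * r ^ 2))) := by
  have hpi := Real.pi_pos
  have hm : MeasurableSet {q : Config M | r < linkDist o q} :=
    measurableSet_lt measurable_const (measurable_linkDist o)
  have mX := measurable_pi_lambda (fun ω j => X j ω) hnet.ap.measurable
  have mS := measurable_pi_lambda (fun ω j => S j ω) hnet.sink.measurable
  set D : Config M → ℝ≥0∞ := {q : Config M | r < linkDist o q}.indicator (fun _ => 1) with hD
  have hDm : Measurable D := measurable_const.indicator hm
  have eD : μ {ω | r < linkDist o (config X S T G H ω)} = ∫⁻ ω, D (config X S T G H ω) ∂μ := by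
    have hm' : MeasurableSet {ω | r < linkDist o (config X S T G H ω)} := hnet.measurable_config hm
    rw [← lintegral_indicator_one hm']
    exact lintegral_congr fun ω => rfl
  rw [eD, hnet.lintegral_config h0 h1 hDm, lintegral_lintegral_swap]
  -- With the access points frozen, the link distance exceeds `r` exactly when no sink lies in the
  -- closed disc of radius `r` about a fixed point.
  · have hconst : ∀ ω, ∫⁻ ω', D ((fun j => X j ω), (fun j => S j ω'), (fun j => T j ω),
        (fun j => G j ω), (fun j => H j ω)) ∂μ
        = ENNReal.ofReal (Real.exp (-(Real.pi * lamSK * r ^ 2))) := by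
      intro ω
      set z : Plane := apLoc o (fun i => X i ω) (fun i => T i ω) with hz
      have hball : volume (Metric.closedBall z r) ≠ ∞ := measure_closedBall_lt_top.ne
      have hvr : volume.real (Metric.closedBall z r) = r ^ 2 * Real.pi := by
        rw [measureReal_def, EuclideanSpace.volume_closedBall_fin_two, ENNReal.toReal_mul,
          ENNReal.toReal_pow, ENNReal.toReal_ofReal hr, ENNReal.toReal_ofReal hpi.le]
      have hvoid := hnet.sink.measure_void hSK.le (A := Metric.closedBall z r)
        measurableSet_closedBall hball
      rw [hvr] at hvoid
      rw [show Real.pi * lamSK * r ^ 2 = lamSK * (r ^ 2 * Real.pi) by ring, ← hvoid]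
      have hvm : MeasurableSet {ω | count (fun i => S i ω) (Metric.closedBall z r) = 0} :=
        hnet.sink.measurable_count measurableSet_closedBall (measurableSet_singleton 0)
      rw [← lintegral_indicator_one hvm]
      refine lintegral_congr_ae ?_
      filter_upwards [hnet.sink.ae_locallyFinite z] with ω' hω'
      have hsp := (nearest_spec (p := fun _ => True) ⟨0, trivial⟩ hω').2
      have hiff : r < dist z (sinkLoc (fun j => S j ω') z)
          ↔ count (fun i => S i ω') (Metric.closedBall z r) = 0 := by
        rw [count, Set.encard_eq_zero, dist_comm]
        constructor
        · intro h
          ext j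
          simp only [mem_ofPred_eq, Metric.mem_closedBall, mem_empty_iff_false, iff_false, not_le]
          exact h.trans_le (hsp j trivial)
        · intro h
          by_contra hle
          have : typicalSink (fun j => S j ω') z ∈ {i | S i ω' ∈ Metric.closedBall z r} :=
            Metric.mem_closedBall.2 (not_lt.1 hle)
          rw [h] at this
          exact this
      simp only [hD, indicator, mem_ofPred_eq, linkDist, Pi.one_apply]
      exact if_congr hiff rfl rfl
    simp_rw [hconst]
    simp
  · refine Measurable.aemeasurable (hDm.comp (Measurable.prodMk (mX.comp measurable_snd)
      (Measurable.prodMk (mS.comp measurable_fst) (hnet.measurable_marks.comp measurable_snd))))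

/-- The density of the link distance. -/
def linkDensity (lamSK r : ℝ) : ℝ :=
  2 * Real.pi * lamSK * (r * Real.exp (-(Real.pi * lamSK * r ^ 2)))

lemma lintegral_linkDensity_Ioi {lamSK : ℝ} (hSK : 0 < lamSK) {r : ℝ} (hr : 0 ≤ r) :
    ∫⁻ t in Ioi r, ENNReal.ofReal (linkDensity lamSK t)
      = ENNReal.ofReal (Real.exp (-(Real.pi * lamSK * r ^ 2))) := by
  have hpi := Real.pi_pos
  have hd : ∀ t ∈ Ioi r, HasDerivAt (fun t => -Real.exp (-(Real.pi * lamSK * t ^ 2)))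
      (linkDensity lamSK t) t := by
    intro t _
    have h1 : HasDerivAt (fun t : ℝ => -(Real.pi * lamSK * t ^ 2)) (-(Real.pi * lamSK * (2 * t))) t := by
      simpa using ((hasDerivAt_pow 2 t).const_mul (Real.pi * lamSK)).fun_neg
    refine h1.exp.fun_neg.congr_deriv ?_
    rw [linkDensity]; ring
  have hc : ContinuousWithinAt (fun t => -Real.exp (-(Real.pi * lamSK * t ^ 2))) (Ici r) r :=
    Continuous.continuousWithinAt (by fun_prop)
  have hpos : ∀ t ∈ Ioi r, 0 ≤ linkDensity lamSK t := by
    intro t ht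
    have : 0 < t := hr.trans_lt ht
    unfold linkDensity
    positivity
  have hl : Tendsto (fun t : ℝ => -Real.exp (-(Real.pi * lamSK * t ^ 2))) atTop (𝓝 0) := by
    rw [← neg_zero]
    refine Tendsto.neg (Real.tendsto_exp_neg_atTop_nhds_zero.comp ?_)
    exact Tendsto.const_mul_atTop (by positivity) (tendsto_pow_atTop two_ne_zero)
  rw [← ofReal_integral_eq_lintegral_ofReal (integrableOn_Ioi_deriv_of_nonneg hc hd hpos hl),
    integral_Ioi_of_hasDerivAt_of_nonneg hc hd hpos hl]
  · simp
  · exact (ae_restrict_iff' measurableSet_Ioi).2 (Eventually.of_forall hpos)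

/-- The law of the link distance. -/
theorem IsNetwork.map_linkDist (hnet : IsNetwork μ M lamAP lamSK rho X S T G H)
    (hSK : 0 < lamSK) (h0 : 0 ≤ rho) (h1 : rho ≤ 1) (o : Plane) :
    μ.map (fun ω => linkDist o (config X S T G H ω))
      = (volume.restrict (Ioi 0)).withDensity (fun r => ENNReal.ofReal (linkDensity lamSK r)) := by
  have hRm : Measurable fun ω => linkDist o (config X S T G H ω) :=
    (measurable_linkDist o).comp hnet.measurable_config
  have hdm : Measurable (linkDensity lamSK) := by unfold linkDensity; fun_prop
  have hp1 : IsProbabilityMeasure (μ.map (fun ω => linkDist o (config X S T G H ω))) :=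
    Measure.isProbabilityMeasure_map hRm.aemeasurable
  have hp2 : IsProbabilityMeasure ((volume.restrict (Ioi 0)).withDensity
      (fun r => ENNReal.ofReal (linkDensity lamSK r))) := by
    constructor
    rw [withDensity_apply _ MeasurableSet.univ, Measure.restrict_univ,
      lintegral_linkDensity_Ioi hSK le_rfl]
    simp
  have hIoi : ∀ r, μ.map (fun ω => linkDist o (config X S T G H ω)) (Ioi r)
      = (volume.restrict (Ioi 0)).withDensity (fun r => ENNReal.ofReal (linkDensity lamSK r))
        (Ioi r) := by
    intro r
    rw [Measure.map_apply hRm measurableSet_Ioi, withDensity_apply _ measurableSet_Ioi,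
      Measure.restrict_restrict measurableSet_Ioi]
    rcases le_or_gt 0 r with hr | hr
    · rw [inter_eq_left.2 (Ioi_subset_Ioi hr), lintegral_linkDensity_Ioi hSK hr]
      exact hnet.measure_lt_linkDist hSK h0 h1 o hr
    · rw [inter_eq_right.2 (Ioi_subset_Ioi hr.le), lintegral_linkDensity_Ioi hSK le_rfl]
      have : (fun ω => linkDist o (config X S T G H ω)) ⁻¹' Ioi r = univ :=
        eq_univ_of_forall fun ω => hr.trans_le dist_nonneg
      rw [this, measure_univ]
      simp
  refine Measure.ext_of_Iic _ _ fun r => ?_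
  rw [← compl_Ioi, prob_compl_eq_one_sub measurableSet_Ioi, prob_compl_eq_one_sub measurableSet_Ioi,
    hIoi]

end Network

/-! ### The tail of the SINR -/

section Network

variable {Ω : Type*} [MeasurableSpace Ω] {μ : Measure Ω} [IsProbabilityMeasure μ] {M : ℕ}
  {lamAP lamSK rho β : ℝ} {X S : ℕ → Ω → Plane} {T : ℕ → Ω → Bool} {G H : ℕ → Ω → Chan M}

lemma IsNetwork.lintegral_config_iterated (hnet : IsNetwork μ M lamAP lamSK rho X S T G H)
    (h0 : 0 ≤ rho) (h1 : rho ≤ 1) {F : Config M → ℝ≥0∞} (hF : Measurable F) :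
    ∫⁻ ω, F (config X S T G H ω) ∂μ
      = ∫⁻ x, ∫⁻ s, ∫⁻ t, ∫⁻ g, ∫⁻ h, F (x, s, t, g, h)
          ∂(Measure.infinitePi fun _ : ℕ => rayleigh M) ∂(Measure.infinitePi fun _ : ℕ => rayleigh M)
          ∂(Measure.infinitePi fun _ : ℕ => actLaw rho)
          ∂(μ.map (fun ω j => S j ω)) ∂(μ.map (fun ω j => X j ω)) := by
  have := isProbabilityMeasure_actLaw h0 h1
  have : IsProbabilityMeasure (markLaw M rho) := by unfold markLaw; infer_instance
  have mX := measurable_pi_lambda (fun ω j => X j ω) hnet.ap.measurable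
  have mS := measurable_pi_lambda (fun ω j => S j ω) hnet.sink.measurable
  have : IsProbabilityMeasure (μ.map (fun ω j => X j ω)) :=
    Measure.isProbabilityMeasure_map mX.aemeasurable
  have : IsProbabilityMeasure (μ.map (fun ω j => S j ω)) :=
    Measure.isProbabilityMeasure_map mS.aemeasurable
  rw [← lintegral_map hF hnet.measurable_config]
  change ∫⁻ a, F a ∂(μ.map (fun ω => ((fun j => X j ω), (fun j => S j ω), (fun j => T j ω),
    (fun j => G j ω), (fun j => H j ω)))) = _
  rw [hnet.map_all h0, lintegral_prod _ hF.aemeasurable]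
  refine lintegral_congr fun x => ?_
  have hx : Measurable fun q : (ℕ → Plane) × (ℕ → Bool) × (ℕ → Chan M) × (ℕ → Chan M) =>
    F (x, q) := hF.comp measurable_prodMk_left
  rw [lintegral_prod _ hx.aemeasurable]
  refine lintegral_congr fun s => ?_
  have hs : Measurable fun q : (ℕ → Bool) × (ℕ → Chan M) × (ℕ → Chan M) => F (x, s, q) :=
    hx.comp measurable_prodMk_left
  rw [markLaw, lintegral_prod _ hs.aemeasurable]
  refine lintegral_congr fun t => ?_
  have ht : Measurable fun q : (ℕ → Chan M) × (ℕ → Chan M) => F (x, s, t, q) :=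
    hs.comp measurable_prodMk_left
  rw [lintegral_prod _ ht.aemeasurable]

/-- Averaging over the fading of the typical link, for a threshold which does not depend on it. -/
lemma IsNetwork.measure_lt_signal (hnet : IsNetwork μ M lamAP lamSK rho X S T G H)
    (h0 : 0 ≤ rho) (h1 : rho ≤ 1) (o : Plane) {s : Config M → ℝ} (hs : Measurable s)
    (hs0 : ∀ q, 0 ≤ s q)
    (hsu : ∀ x y t g h, s (x, y, t, Function.update g (typicalAP o x t) 0, h) = s (x, y, t, g, h)) :
    μ {ω | s (config X S T G H ω)
        < ‖G (typicalAP o (fun i => X i ω) (fun i => T i ω)) ω‖ ^ 2}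
      = ∫⁻ ω, ENNReal.ofReal (gammaTail M (s (config X S T G H ω))) ∂μ := by
  set A : Set (Config M) := {q | s q < ‖q.2.2.2.1 (typicalAP o q.1 q.2.2.1)‖ ^ 2} with hA
  have hAm : MeasurableSet A := by
    have ha : Measurable fun q : Config M => typicalAP o q.1 q.2.2.1 :=
      (measurable_typicalAP o).comp (f := fun q : Config M => (q.1, q.2.2.1)) (by fun_prop)
    have hg : Measurable fun q : Config M => q.2.2.2.1 (typicalAP o q.1 q.2.2.1) :=
      measurable_eval_nat (by fun_prop) ha
    exact measurableSet_lt hs (hg.norm.pow_const 2)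
  have hAΩ : MeasurableSet (config X S T G H ⁻¹' A) := hnet.measurable_config hAm
  have e1 : μ {ω | s (config X S T G H ω)
        < ‖G (typicalAP o (fun i => X i ω) (fun i => T i ω)) ω‖ ^ 2}
      = ∫⁻ ω, A.indicator (fun _ => 1) (config X S T G H ω) ∂μ := by
    change μ (config X S T G H ⁻¹' A) = _
    rw [← lintegral_indicator_one hAΩ]
    exact lintegral_congr fun ω => rfl
  have hgt : Measurable fun q : Config M => ENNReal.ofReal (gammaTail M (s q)) :=
    ENNReal.measurable_ofReal.comp ((continuous_gammaTail M).measurable.comp hs)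
  rw [e1, hnet.lintegral_config_iterated h0 h1 (measurable_const.indicator hAm),
    hnet.lintegral_config_iterated h0 h1 hgt]
  refine lintegral_congr fun x => lintegral_congr fun y => lintegral_congr fun t => ?_
  set a := typicalAP o x t with ha
  set P := Measure.infinitePi fun _ : ℕ => rayleigh M with hP
  have hthr : MeasurableSet {q : ((ℕ → Chan M) × Chan M) × (ℕ → Chan M) |
      s (x, y, t, q.1.1, q.2) < ‖q.1.2‖ ^ 2} :=
    measurableSet_lt (hs.comp (by fun_prop)) (by fun_prop)
  set J : ((ℕ → Chan M) × Chan M) × (ℕ → Chan M) → ℝ≥0∞ :=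
    {q | s (x, y, t, q.1.1, q.2) < ‖q.1.2‖ ^ 2}.indicator (fun _ => 1) with hJ
  have hJm : Measurable J := measurable_const.indicator hthr
  -- The threshold ignores `g a`. Overwriting that entry by `0` makes this explicit, so `g a` can be
  -- integrated as an independent variable.
  have e2 : ∀ g h, A.indicator (fun _ => (1 : ℝ≥0∞)) (x, y, t, g, h)
      = J ((Function.update g a 0, g a), h) := by
    intro g h
    simp only [hA, hJ, indicator, mem_ofPred_eq]
    exact if_congr (by rw [hsu]) rfl rfl
  simp_rw [e2]
  rw [lintegral_infinitePi_update (rayleigh M) a 0 (fun p => ∫⁻ h, J (p, h) ∂P)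
    hJm.lintegral_prod_right']
  refine lintegral_congr fun g => ?_
  have hJg : Measurable fun q : Chan M × (ℕ → Chan M) => J ((Function.update g a 0, q.1), q.2) :=
    hJm.comp (by fun_prop)
  rw [lintegral_lintegral_swap hJg.aemeasurable]
  refine lintegral_congr fun h => ?_
  rw [← rayleigh_tail M (hs0 _)]
  have hm : MeasurableSet {v : Chan M | s (x, y, t, g, h) < ‖v‖ ^ 2} :=
    measurableSet_lt measurable_const (by fun_prop)
  rw [← lintegral_indicator_one hm]
  refine lintegral_congr fun v => ?_
  simp only [hJ, indicator, mem_ofPred_eq, Pi.one_apply]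
  exact if_congr (by rw [hsu]) rfl rfl

/-- Since index `a` is absent from the sum, the threshold for the useful signal does not involve the
fading of the useful link. -/
lemma interference_update {M : ℕ} (β : ℝ) (x : ℕ → Plane) (t : ℕ → Bool)
    (g h : ℕ → Chan M) (a : ℕ) (c : Chan M) (y : Plane) :
    interference β x t (Function.update g a c) h a y = interference β x t g h a y := by
  rw [interference, interference]
  refine tsum_congr fun j => ?_
  by_cases hj : j = a
  · simp [hj]
  · rw [Function.update_of_ne hj]

lemma IsNetwork.ae_linkDist_pos (hnet : IsNetwork μ M lamAP lamSK rho X S T G H)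
    (hSK : 0 < lamSK) (h0 : 0 ≤ rho) (h1 : rho ≤ 1) (o : Plane) :
    ∀ᵐ ω ∂μ, 0 < linkDist o (config X S T G H ω) := by
  have hm : MeasurableSet {ω | 0 < linkDist o (config X S T G H ω)} :=
    hnet.measurable_config (measurableSet_lt measurable_const (measurable_linkDist o))
  rw [ae_iff_measure_eq hm.nullMeasurableSet, hnet.measure_lt_linkDist hSK h0 h1 o le_rfl]
  simp

/-- With positive distance and finite interference the fraction can be cleared in `ℝ`. If the
denominator vanishes, both sides say that the signal is positive. -/
lemma lt_sinr_iff {β δ P γ : ℝ} (hP : 0 < P) (hγ : 0 ≤ γ) (o : Plane) {q : Config M}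
    (hd : 0 < linkDist o q) (hI : sinkInterference β o q ≠ ∞) :
    ENNReal.ofReal γ < sinr β δ P o q.1 q.2.1 q.2.2.1 q.2.2.2.1 q.2.2.2.2
      ↔ γ * linkDist o q ^ β * ((sinkInterference β o q).toReal + δ ^ 2 / P)
        < ‖q.2.2.2.1 (typicalAP o q.1 q.2.2.1)‖ ^ 2 := by
  have hc : 0 ≤ δ ^ 2 / P := by positivity
  have hI0 : 0 ≤ (sinkInterference β o q).toReal := ENNReal.toReal_nonneg
  have hpow : 0 < linkDist o q ^ β := Real.rpow_pos_of_pos hd β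
  rw [sinr_eq, ENNReal.lt_div_iff_mul_lt (Or.inr ENNReal.ofReal_ne_top)
    (Or.inl (ENNReal.add_ne_top.2 ⟨hI, ENNReal.ofReal_ne_top⟩))]
  conv_lhs => rw [← ENNReal.ofReal_toReal hI]
  rw [← ENNReal.ofReal_add hI0 hc, ← ENNReal.ofReal_mul hγ,
    ENNReal.ofReal_rpow_of_pos hd, ← ENNReal.ofReal_mul (by positivity),
    ENNReal.ofReal_lt_ofReal_iff_of_nonneg (by positivity), Real.rpow_neg hd.le, ← div_eq_mul_inv,
    lt_div_iff₀ hpow]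
  constructor <;> intro h <;> linarith

theorem IsNetwork.measure_lt_sinr (hnet : IsNetwork μ M lamAP lamSK rho X S T G H)
    (hM : 1 ≤ M) (hAP : 0 < lamAP) (hSK : 0 < lamSK) (h0 : 0 < rho) (h1 : rho < 1) (hβ : 2 < β)
    {δ P γ : ℝ} (hP : 0 < P) (hγ : 0 ≤ γ) (o : Plane) :
    μ {ω | ENNReal.ofReal γ < sinr β δ P o (fun i => X i ω) (fun i => S i ω)
      (fun i => T i ω) (fun i => G i ω) (fun i => H i ω)}
      = ∫⁻ ω, ENNReal.ofReal (gammaTail M (γ * linkDist o (config X S T G H ω) ^ β *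
          ((sinkInterference β o (config X S T G H ω)).toReal + δ ^ 2 / P))) ∂μ := by
  set s : Config M → ℝ := fun q =>
    γ * linkDist o q ^ β * ((sinkInterference β o q).toReal + δ ^ 2 / P) with hs
  have hsm : Measurable s :=
    (((measurable_linkDist o).pow_const β).const_mul γ).mul
      ((measurable_sinkInterference β o).ennreal_toReal.add_const _)
  have hs0 : ∀ q, 0 ≤ s q := fun q => by
    have : 0 ≤ linkDist o q := dist_nonneg
    have h2 : 0 ≤ (sinkInterference β o q).toReal := ENNReal.toReal_nonneg
    simp only [hs]
    positivity
  rw [← hnet.measure_lt_signal h0.le h1.le o hsm hs0 ?_]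
  · refine measure_congr (eventuallyEq_set.2 ?_)
    filter_upwards [hnet.ae_linkDist_pos hSK h0.le h1.le o,
      hnet.ae_interference_ne_top hM hAP h0 h1 hβ o] with ω hd hI
    have key := lt_sinr_iff (δ := δ) hP hγ o hd hI
    exact key
  · intro x y t g h
    simp only [hs, linkDist, sinkInterference, interference_update]

/-- Interference plus noise at the typical sink, normalized by the transmit power. -/
def interferenceNoise {M : ℕ} (β δ P : ℝ) (o : Plane) (q : Config M) : ℝ :=
  (sinkInterference β o q).toReal + δ ^ 2 / P

lemma measurable_interferenceNoise (β δ P : ℝ) (o : Plane) :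
    Measurable (interferenceNoise (M := M) β δ P o) :=
  (measurable_sinkInterference β o).ennreal_toReal.add_const _

lemma interferenceNoise_nonneg {β δ P : ℝ} (hP : 0 < P) (o : Plane) (q : Config M) :
    0 ≤ interferenceNoise β δ P o q := by
  have h2 : 0 ≤ (sinkInterference β o q).toReal := ENNReal.toReal_nonneg
  unfold interferenceNoise
  positivity

/-- Independence is known for the bounded variable `e^{-I}`; a negative logarithm recovers `I` off
the null event `I = ∞`. -/
theorem IsNetwork.indepFun_linkDist_interferenceNoise
    (hnet : IsNetwork μ M lamAP lamSK rho X S T G H)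
    (hM : 1 ≤ M) (hAP : 0 < lamAP) (h0 : 0 < rho) (h1 : rho < 1) (hβ : 2 < β) (δ P : ℝ)
    (o : Plane) :
    IndepFun (fun ω => linkDist o (config X S T G H ω))
      (fun ω => interferenceNoise β δ P o (config X S T G H ω)) μ := by
  have h := (hnet.indepFun_linkDist_interference hM hAP h0 h1 hβ o).comp measurable_id
    (ψ := fun u : ℝ => -Real.log u + δ ^ 2 / P) (by fun_prop)
  refine h.congr (Eventually.of_forall fun ω => rfl) ?_
  filter_upwards [hnet.ae_interference_ne_top hM hAP h0 h1 hβ o] with ω hI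
  simp only [Function.comp_apply, interferenceNoise]
  conv_lhs => rw [← ENNReal.ofReal_toReal hI]
  rw [expNeg_ofReal ENNReal.toReal_nonneg, ENNReal.toReal_ofReal (Real.exp_pos _).le, Real.log_exp,
    neg_neg]

/-- Laplace transform of interference plus noise. -/
lemma IsNetwork.integral_exp_interferenceNoise (hnet : IsNetwork μ M lamAP lamSK rho X S T G H)
    (hM : 1 ≤ M) (hAP : 0 < lamAP) (h0 : 0 < rho) (h1 : rho < 1) (hβ : 2 < β) (δ P : ℝ)
    (o : Plane) {x : ℝ} (hx : 0 ≤ x) :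
    ∫ ω, Real.exp (-(x * interferenceNoise β δ P o (config X S T G H ω))) ∂μ
      = Real.exp (-(lambdaTwo β lamAP rho * x ^ (2 / β)) - x * (δ ^ 2 / P)) := by
  have hIm : Measurable fun ω => sinkInterference β o (config X S T G H ω) :=
    (measurable_sinkInterference β o).comp hnet.measurable_config
  have hL : 0 ≤ interferenceLaplace β lamAP rho x := (Real.exp_pos _).le
  have key := congrArg ENNReal.toReal (hnet.laplace_interference hM hAP h0 h1 hβ o hx)
  have hEm : Measurable fun ω =>
      expNeg (ENNReal.ofReal x * sinkInterference β o (config X S T G H ω)) :=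
    measurable_expNeg.comp (hIm.const_mul _)
  rw [ENNReal.toReal_ofReal hL, ← integral_toReal hEm.aemeasurable
    (Eventually.of_forall fun ω => (expNeg_le_one _).trans_lt ENNReal.one_lt_top)] at key
  rw [sub_eq_add_neg, Real.exp_add]
  change _ = interferenceLaplace β lamAP rho x * _
  rw [← key, ← integral_mul_const]
  refine integral_congr_ae ?_
  filter_upwards [hnet.ae_interference_ne_top hM hAP h0 h1 hβ o] with ω hI
  conv_rhs => rw [← ENNReal.ofReal_toReal hI]
  rw [← ENNReal.ofReal_mul hx, expNeg_ofReal (mul_nonneg hx ENNReal.toReal_nonneg),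
    ENNReal.toReal_ofReal (Real.exp_pos _).le, ← Real.exp_add, interferenceNoise]
  congr 1; ring

/-- The tail of the SINR, conditionally on the link distance. -/
theorem IsNetwork.measure_lt_sinr_eq_lintegral (hnet : IsNetwork μ M lamAP lamSK rho X S T G H)
    (hM : 1 ≤ M) (hAP : 0 < lamAP) (hSK : 0 < lamSK) (h0 : 0 < rho) (h1 : rho < 1) (hβ : 2 < β)
    {δ P γ : ℝ} (hP : 0 < P) (hγ : 0 ≤ γ) (o : Plane) :
    μ {ω | ENNReal.ofReal γ < sinr β δ P o (fun i => X i ω) (fun i => S i ω)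
      (fun i => T i ω) (fun i => G i ω) (fun i => H i ω)}
      = ∫⁻ r in Ioi (0 : ℝ), ENNReal.ofReal (linkDensity lamSK r) *
          ∫⁻ ω, ENNReal.ofReal (gammaTail M (γ * r ^ β *
            interferenceNoise β δ P o (config X S T G H ω))) ∂μ := by
  set R : Ω → ℝ := fun ω => linkDist o (config X S T G H ω) with hR
  set J : Ω → ℝ := fun ω => interferenceNoise β δ P o (config X S T G H ω) with hJ
  have hRm : Measurable R := (measurable_linkDist o).comp hnet.measurable_config
  have hJm : Measurable J := (measurable_interferenceNoise β δ P o).comp hnet.measurable_config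
  have hmap := (hnet.indepFun_linkDist_interferenceNoise hM hAP h0 h1 hβ δ P o).map_prod_eq_prod_map_map
    hRm.aemeasurable hJm.aemeasurable
  have hf : Measurable fun p : ℝ × ℝ => ENNReal.ofReal (gammaTail M (γ * p.1 ^ β * p.2)) := by
    refine ENNReal.measurable_ofReal.comp ((continuous_gammaTail M).measurable.comp ?_)
    exact ((measurable_fst.pow_const β).const_mul γ).mul measurable_snd
  have : IsProbabilityMeasure (μ.map J) := Measure.isProbabilityMeasure_map hJm.aemeasurable
  have hdm : Measurable (linkDensity lamSK) := by unfold linkDensity; fun_prop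
  rw [hnet.measure_lt_sinr hM hAP hSK h0 h1 hβ hP hγ o]
  calc ∫⁻ ω, ENNReal.ofReal (gammaTail M (γ * R ω ^ β * J ω)) ∂μ
      = ∫⁻ p, ENNReal.ofReal (gammaTail M (γ * p.1 ^ β * p.2)) ∂(μ.map (fun ω => (R ω, J ω))) :=
        (lintegral_map hf (hRm.prodMk hJm)).symm
    _ = ∫⁻ r, ∫⁻ j, ENNReal.ofReal (gammaTail M (γ * r ^ β * j)) ∂(μ.map J) ∂(μ.map R) := by
        rw [hmap, lintegral_prod _ hf.aemeasurable]
    _ = _ := by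
        rw [hnet.map_linkDist hSK h0.le h1.le o, lintegral_withDensity_eq_lintegral_mul _
          hdm.ennreal_ofReal hf.lintegral_prod_right']
        refine lintegral_congr fun r => ?_
        simp only [Pi.mul_apply]
        have hfr : Measurable fun j => ENNReal.ofReal (gammaTail M (γ * r ^ β * j)) :=
          hf.comp (f := fun j : ℝ => (r, j)) (measurable_const.prodMk measurable_id)
        rw [lintegral_map hfr hJm]

end Network

/-! ### Faà di Bruno's formula for the exponential -/

/-- The tuples `(k₁, …, k_N)` of natural numbers with `∑ l · k_l = m`. -/
def multiplicitiesBelow (N m : ℕ) : Finset (Fin N → ℕ) :=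
  (Fintype.piFinset (fun _ : Fin N => Finset.range (m + 1))).filter
    (fun k => ∑ i : Fin N, ((i : ℕ) + 1) * k i = m)

lemma mem_multiplicitiesBelow {N m : ℕ} {k : Fin N → ℕ} :
    k ∈ multiplicitiesBelow N m ↔ ∑ i : Fin N, ((i : ℕ) + 1) * k i = m := by
  simp only [multiplicitiesBelow, Finset.mem_filter, Fintype.mem_piFinset, Finset.mem_range,
    and_iff_right_iff_imp]
  intro h i
  have h1 : ((i : ℕ) + 1) * k i ≤ ∑ i : Fin N, ((i : ℕ) + 1) * k i :=
    Finset.single_le_sum (f := fun i : Fin N => ((i : ℕ) + 1) * k i)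
      (fun _ _ => Nat.zero_le _) (Finset.mem_univ i)
  nlinarith [Nat.zero_le ((i : ℕ) * k i)]

/-- The monomial of `exp (∑ a_l x ^ l)` with multiplicities `k`. -/
def expTerm (a : ℕ → ℝ) {N : ℕ} (k : Fin N → ℕ) : ℝ :=
  ∏ i : Fin N, a ((i : ℕ) + 1) ^ k i / (k i)!

/-- The coefficient of `x ^ m` in `exp (∑ l ∈ [1, N], a_l x ^ l)`. -/
def expCoeffBelow (N m : ℕ) (a : ℕ → ℝ) : ℝ := ∑ k ∈ multiplicitiesBelow N m, expTerm a k

/-- The coefficient of `x ^ m` in `exp (∑ l ≥ 1, a_l x ^ l)`. -/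
def expCoeff (m : ℕ) (a : ℕ → ℝ) : ℝ := ∑ k ∈ multiplicities m, expTerm a k

/-- It rests on `(k + 1) / (k + 1)! = 1 / k!`, and is the coefficient form of the Euler operator in
the variable `a_{i+1}`. -/
lemma expTerm_add_single (a : ℕ → ℝ) {N : ℕ} (k : Fin N → ℕ) (i : Fin N) :
    ((k + Pi.single i 1 : Fin N → ℕ) i : ℝ) * expTerm a (k + Pi.single i 1)
      = a ((i : ℕ) + 1) * expTerm a k := by
  rw [expTerm, expTerm, ← Finset.mul_prod_erase _ _ (Finset.mem_univ i),
    ← Finset.mul_prod_erase _ (fun j : Fin N => a ((j : ℕ) + 1) ^ k j / ((k j)! : ℝ))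
      (Finset.mem_univ i)]
  have h : ∀ j ∈ Finset.univ.erase i, (k + Pi.single i 1 : Fin N → ℕ) j = k j := by
    intro j hj
    simp [Finset.ne_of_mem_erase hj]
  rw [Finset.prod_congr rfl fun j hj => by rw [h j hj]]
  have h2 : (k + Pi.single i 1 : Fin N → ℕ) i = k i + 1 := by simp
  have h3 : ((k i)! : ℝ) ≠ 0 := by positivity
  rw [h2, Nat.factorial_succ]
  push_cast
  field_simp
  ring

/-- Raising the `i`-th multiplicity by one is a bijection onto the tuples with `k i ≠ 0`; the
remaining tuples contribute `0`. -/
lemma sum_mul_expTerm (a : ℕ → ℝ) {N : ℕ} (m : ℕ) (i : Fin N) :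
    ∑ k ∈ multiplicitiesBelow N (m + (i + 1)), (k i : ℝ) * expTerm a k
      = a ((i : ℕ) + 1) * expCoeffBelow N m a := by
  have hs : ∀ k : Fin N → ℕ,
      ∑ j : Fin N, ((j : ℕ) + 1) * (k + Pi.single i 1 : Fin N → ℕ) j
        = ∑ j : Fin N, ((j : ℕ) + 1) * k j + (i + 1) := by
    intro k
    simp [mul_add, Finset.sum_add_distrib, Pi.single_apply]
  rw [expCoeffBelow, Finset.mul_sum]
  have hinj : Function.Injective fun k : Fin N → ℕ => k + Pi.single i 1 :=
    add_left_injective _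
  rw [← Finset.sum_congr rfl fun k _ => expTerm_add_single a k i]
  refine Eq.trans ?_ (Finset.sum_map (multiplicitiesBelow N m) ⟨_, hinj⟩
    (fun k : Fin N → ℕ => (k i : ℝ) * expTerm a k))
  symm
  refine Finset.sum_subset (fun k hk => ?_) fun k hk hk' => ?_
  · obtain ⟨k', hk', rfl⟩ := Finset.mem_map.1 hk
    rw [mem_multiplicitiesBelow] at hk' ⊢
    simp only [Function.Embedding.coeFn_mk, hs, hk']
  · by_cases h0 : k i = 0
    · simp [h0]
    refine absurd (Finset.mem_map.2 ⟨k - Pi.single i 1, ?_, ?_⟩) hk'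
    · have hk2 : k - Pi.single i 1 + Pi.single i 1 = k := by
        ext j
        by_cases hj : j = i
        · subst hj; simp; omega
        · simp [hj]
      rw [mem_multiplicitiesBelow] at hk ⊢
      have := hs (k - Pi.single i 1)
      rw [hk2] at this
      omega
    · ext j
      by_cases hj : j = i
      · subst hj; simp; omega
      · simp [hj]

/-- A part of size `N + 1` does not fit into a total `m ≤ N`. Spare part sizes allow coefficients of
different orders to be compared over tuples of one length. -/
lemma expCoeffBelow_succ (a : ℕ → ℝ) {N m : ℕ} (h : m ≤ N) :
    expCoeffBelow (N + 1) m a = expCoeffBelow N m a := by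
  have h0 : ∀ k ∈ multiplicitiesBelow (N + 1) m, k (Fin.last N) = 0 := by
    intro k hk
    rw [mem_multiplicitiesBelow, Fin.sum_univ_castSucc] at hk
    simp only [Fin.val_last] at hk
    by_contra h0
    have : 1 ≤ k (Fin.last N) := Nat.one_le_iff_ne_zero.2 h0
    nlinarith [Nat.zero_le (∑ i : Fin N, ((i.castSucc : ℕ) + 1) * k i.castSucc)]
  refine Finset.sum_nbij' (fun k => Fin.init k) (fun k => Fin.snoc (α := fun _ => ℕ) k 0) ?_ ?_ ?_ ?_ ?_
  · intro k hk
    have := h0 k hk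
    rw [mem_multiplicitiesBelow, Fin.sum_univ_castSucc, this] at hk
    rw [mem_multiplicitiesBelow]
    simpa [Fin.init] using hk
  · intro k hk
    rw [mem_multiplicitiesBelow] at hk ⊢
    rw [Fin.sum_univ_castSucc]
    simpa using hk
  · intro k hk
    have := h0 k hk
    conv_rhs => rw [← Fin.snoc_init_self k]
    rw [this]
  · intro k _
    simp
  · intro k hk
    have := h0 k hk
    rw [expTerm, expTerm, Fin.prod_univ_castSucc, this]
    simp [Fin.init]

lemma expCoeffBelow_eq (a : ℕ → ℝ) {N m : ℕ} (h : m ≤ N) :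
    expCoeffBelow N m a = expCoeff m a := by
  induction N, h using Nat.le_induction with
  | base => rfl
  | succ N hN ih => rw [expCoeffBelow_succ a hN, ih]

lemma expCoeff_zero (a : ℕ → ℝ) : expCoeff 0 a = 1 := by
  have : multiplicities 0 = {0} := by
    ext k
    rw [mem_multiplicities]
    simp [Subsingleton.elim k 0]
  simp [expCoeff, this, expTerm]

/-- This is the coefficient of `x^m` in `F' = h' F` for `F = exp h`, `h = ∑ a_l x^l`.
Combinatorially, the total `m + 1 = ∑ (i + 1) k_i` is distributed over the part sizes. -/
lemma succ_mul_expCoeff (a : ℕ → ℝ) (m : ℕ) :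
    ((m : ℝ) + 1) * expCoeff (m + 1) a
      = ∑ i ∈ Finset.range (m + 1), ((i : ℝ) + 1) * a (i + 1) * expCoeff (m - i) a := by
  rw [Finset.sum_range]
  have h1 : ∀ i : Fin (m + 1), ((i : ℝ) + 1) * a (i + 1) * expCoeff (m - i) a
      = ∑ k ∈ multiplicitiesBelow (m + 1) (m + 1), (((i : ℕ) + 1) * k i : ℕ) * expTerm a k := by
    intro i
    have h2 := sum_mul_expTerm a (m - i) i
    rw [show m - (i : ℕ) + (i + 1) = m + 1 by have := i.2; omega,
      expCoeffBelow_eq a (by omega)] at h2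
    rw [mul_assoc, ← h2, Finset.mul_sum]
    refine Finset.sum_congr rfl fun k _ => ?_
    push_cast; ring
  rw [Finset.sum_congr rfl fun i _ => h1 i, Finset.sum_comm]
  change _ * expCoeffBelow (m + 1) (m + 1) a = _
  rw [expCoeffBelow, Finset.mul_sum]
  refine Finset.sum_congr rfl fun k hk => ?_
  rw [← Finset.sum_mul, ← Nat.cast_sum, mem_multiplicitiesBelow.1 hk]
  push_cast; ring

lemma expCoeff_congr {m : ℕ} {a b : ℕ → ℝ} (h : ∀ l, 1 ≤ l → a l = b l) :
    expCoeff m a = expCoeff m b := by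
  unfold expCoeff expTerm
  simp_rw [h _ (Nat.le_add_left 1 _)]

/-- Homogeneity of the coefficients. -/
lemma expCoeff_pow_mul (m : ℕ) (z : ℝ) (a : ℕ → ℝ) :
    expCoeff m (fun l => z ^ l * a l) = z ^ m * expCoeff m a := by
  rw [expCoeff, expCoeff, Finset.mul_sum]
  refine Finset.sum_congr rfl fun k hk => ?_
  rw [expTerm, expTerm]
  have hz : z ^ m = ∏ i : Fin m, z ^ (((i : ℕ) + 1) * k i) := by
    rw [Finset.prod_pow_eq_pow_sum, mem_multiplicities.1 hk]
  rw [hz, ← Finset.prod_mul_distrib]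
  refine Finset.prod_congr rfl fun i _ => ?_
  rw [mul_pow, ← pow_mul, mul_div_assoc]

lemma expCoeff_eq_zero {m : ℕ} (hm : m ≠ 0) {a : ℕ → ℝ} (h : ∀ l, 1 ≤ l → a l = 0) :
    expCoeff m a = 0 := by
  have := expCoeff_pow_mul m 0 a
  rw [expCoeff_congr (b := a) fun l hl => by rw [h l hl, mul_zero], zero_pow hm, zero_mul] at this
  exact this

/-- Faà di Bruno's formula for the exponential of a smooth function. -/
theorem iteratedDeriv_exp_comp {h : ℝ → ℝ} {t : ℝ} (hh : ContDiffAt ℝ (⊤ : ℕ∞) h t) (m : ℕ) :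
    iteratedDeriv m (fun x => Real.exp (h x)) t
      = Real.exp (h t) * (m ! * expCoeff m fun l => iteratedDeriv l h t / l !) := by
  induction m using Nat.strong_induction_on with
  | _ m ih =>
    rcases m with _ | m
    · simp [expCoeff_zero]
    set a : ℕ → ℝ := fun l => iteratedDeriv l h t / l ! with ha
    have hE : ContDiffAt ℝ (⊤ : ℕ∞) (fun x => Real.exp (h x)) t := hh.exp
    -- Leibniz' rule applied to `(e^h)' = h' e^h` produces the recursion of `succ_mul_expCoeff`.
    have hd : deriv (fun x => Real.exp (h x)) =ᶠ[𝓝 t]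
        deriv h * fun x => Real.exp (h x) := by
      have h1 : ContDiffAt ℝ 1 h t := hh.of_le (by exact_mod_cast le_top)
      filter_upwards [h1.eventually (by simp)] with x hx
      rw [(((hx.differentiableAt (by simp)).hasDerivAt).exp).deriv, Pi.mul_apply, mul_comm]
    have hh' : ContDiffAt ℝ m (deriv h) t := hh.derivWithin (by exact_mod_cast le_top)
    rw [iteratedDeriv_succ', hd.iteratedDeriv_eq, iteratedDeriv_mul hh'
      (hE.of_le (by exact_mod_cast le_top)), Nat.factorial_succ]
    push_cast
    rw [mul_assoc _ ((m ! : ℕ) : ℝ), mul_comm ((m ! : ℕ) : ℝ), ← mul_assoc ((m : ℝ) + 1),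
      succ_mul_expCoeff, Finset.sum_mul, Finset.mul_sum]
    refine Finset.sum_congr rfl fun i hi => ?_
    have hi' : i ≤ m := Nat.lt_succ_iff.1 (Finset.mem_range.1 hi)
    rw [ih (m - i) (by omega), ← iteratedDeriv_succ']
    have h1 : iteratedDeriv (i + 1) h t = (i + 1)! * a (i + 1) := by
      rw [ha]; field_simp
    rw [h1, Nat.factorial_succ]
    have h2 : (m.choose i : ℝ) * (i ! * (m - i)!) = m ! := by
      exact_mod_cast (by rw [← mul_assoc]; exact Nat.choose_mul_factorial_mul_factorial hi')
    push_cast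
    linear_combination (((i : ℝ) + 1) * a (i + 1) * Real.exp (h t) * expCoeff (m - i) a) * h2

/-! ### Moments of a variable with a stretched exponential Laplace transform -/

/-- The moment generating function at `t < 0` is the Laplace transform at `-t`, so powers of `-x`
occur and each derivative brings a sign. -/
lemma iteratedDeriv_rpow_neg (a : ℝ) (l : ℕ) {t : ℝ} (ht : t < 0) :
    iteratedDeriv l (fun x : ℝ => (-x) ^ a) t
      = (-1) ^ l * (∏ j ∈ Finset.range l, (a - (j : ℝ))) * (-t) ^ (a - (l : ℝ)) := by
  induction l generalizing t with
  | zero => simp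
  | succ l ih =>
    have hE : iteratedDeriv l (fun x : ℝ => (-x) ^ a) =ᶠ[𝓝 t] fun x =>
        (-1) ^ l * (∏ j ∈ Finset.range l, (a - (j : ℝ))) * (-x) ^ (a - (l : ℝ)) := by
      filter_upwards [Iio_mem_nhds ht] with x hx using ih hx
    have hd : HasDerivAt (fun x : ℝ => (-x) ^ (a - (l : ℝ)))
        (-1 * (a - (l : ℝ)) * (-t) ^ (a - (l : ℝ) - 1)) t :=
      (hasDerivAt_neg t).rpow_const (Or.inl (by linarith))
    rw [iteratedDeriv_succ, hE.deriv_eq, (hd.const_mul _).deriv, Finset.prod_range_succ]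
    push_cast
    rw [show a - ((l : ℝ) + 1) = a - l - 1 by ring]
    ring

lemma contDiffAt_rpow_neg (a : ℝ) {t : ℝ} (ht : t < 0) :
    ContDiffAt ℝ (⊤ : ℕ∞) (fun x : ℝ => (-x) ^ a) t :=
  contDiffAt_id.neg.rpow_const_of_ne (by simpa using ht.ne)

lemma iteratedDeriv_exponent (L a c : ℝ) {l : ℕ} (hl : 1 ≤ l) {t : ℝ} (ht : t < 0) :
    iteratedDeriv l (fun x : ℝ => -(L * (-x) ^ a) + c * x) t
      = -(L * ((-1) ^ l * (∏ j ∈ Finset.range l, (a - (j : ℝ))) * (-t) ^ (a - (l : ℝ))))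
        + if l = 1 then c else 0 := by
  have h1 : ContDiffAt ℝ l (fun x : ℝ => (-x) ^ a) t :=
    (contDiffAt_rpow_neg a ht).of_le (by exact_mod_cast le_top)
  have h2 : iteratedDeriv l (fun x : ℝ => c * x) t = if l = 1 then c else 0 := by
    obtain ⟨n, rfl⟩ := Nat.exists_eq_add_of_le' hl
    have : deriv (fun x : ℝ => c * x) = fun _ => c := by
      ext x
      simp
    rw [iteratedDeriv_succ', this, iteratedDeriv_const]
    simp
  rw [iteratedDeriv_fun_add (contDiffAt_const.mul h1).neg (by fun_prop), h2, iteratedDeriv_fun_neg,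
    iteratedDeriv_const_mul_field, iteratedDeriv_rpow_neg a l ht]

section Laplace

variable {Ω : Type*} [MeasurableSpace Ω] {μ : Measure Ω} [IsProbabilityMeasure μ] {J : Ω → ℝ}
  {L a c : ℝ}

lemma mem_interior_integrableExpSet (hJm : Measurable J) (hJ : ∀ ω, 0 ≤ J ω) {t : ℝ} (ht : t < 0) :
    t ∈ interior (integrableExpSet J μ) := by
  refine interior_mono (s := Iio 0) (fun x hx => ?_) (by simpa using ht)
  refine Integrable.of_bound (C := 1) (by fun_prop) (Eventually.of_forall fun ω => ?_)
  rw [Real.norm_eq_abs, Real.abs_exp]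
  exact Real.exp_le_one_iff.2 (mul_nonpos_of_nonpos_of_nonneg (le_of_lt hx) (hJ ω))

/-- Averaged Erlang tail of a variable with a stretched exponential Laplace transform. -/
lemma integral_gammaTail_of_laplace (hJm : Measurable J) (hJ : ∀ ω, 0 ≤ J ω)
    (hL : ∀ x : ℝ, 0 ≤ x → ∫ ω, Real.exp (-(x * J ω)) ∂μ = Real.exp (-(L * x ^ a) - x * c))
    (M : ℕ) {θ : ℝ} (hθ : 0 < θ) :
    ∫ ω, gammaTail M (θ * J ω) ∂μ = Real.exp (-(L * θ ^ a) - θ * c) *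
      ∑ m ∈ Finset.range M, expCoeff m fun l => θ ^ l *
        (iteratedDeriv l (fun x : ℝ => -(L * (-x) ^ a) + c * x) (-θ) / l !) := by
  have hθ' : -θ < 0 := by linarith
  have hint := mem_interior_integrableExpSet (μ := μ) hJm hJ hθ'
  have hmgf : mgf J μ =ᶠ[𝓝 (-θ)] fun x => Real.exp (-(L * (-x) ^ a) + c * x) := by
    filter_upwards [Iio_mem_nhds hθ'] with x hx
    have := hL (-x) (by linarith [mem_Iio.1 hx])
    simp only [neg_mul, neg_neg] at this
    rw [mgf, this]
    congr 1; ring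
  have hh : ContDiffAt ℝ (⊤ : ℕ∞) (fun x : ℝ => -(L * (-x) ^ a) + c * x) (-θ) :=
    ((contDiffAt_rpow_neg a hθ').const_smul L).neg.add (by fun_prop)
  have hmom : ∀ m : ℕ, ∫ ω, J ω ^ m * Real.exp (-θ * J ω) ∂μ
      = Real.exp (-(L * θ ^ a) - θ * c) * (m ! * expCoeff m fun l =>
        iteratedDeriv l (fun x : ℝ => -(L * (-x) ^ a) + c * x) (-θ) / l !) := by
    intro m
    rw [← iteratedDeriv_mgf hint m, hmgf.iteratedDeriv_eq, iteratedDeriv_exp_comp hh, neg_neg]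
    congr 2; ring
  -- The Erlang tail is a combination of the variables `J^m e^{-θ J}`, whose means are derivatives
  -- of the moment generating function at `-θ`.
  have hg : ∀ ω, gammaTail M (θ * J ω)
      = ∑ m ∈ Finset.range M, θ ^ m / m ! * (J ω ^ m * Real.exp (-θ * J ω)) := by
    intro ω
    rw [gammaTail, Finset.mul_sum]
    refine Finset.sum_congr rfl fun m _ => ?_
    rw [mul_pow, neg_mul]; ring
  simp_rw [hg]
  rw [integral_finsetSum _ fun m _ =>
    (integrable_pow_mul_exp_of_mem_interior_integrableExpSet hint m).const_mul _, Finset.mul_sum]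
  refine Finset.sum_congr rfl fun m _ => ?_
  rw [integral_const_mul, hmom, expCoeff_pow_mul]
  have : (m ! : ℝ) ≠ 0 := by positivity
  field_simp

lemma rpow_two_div_pow {β r : ℝ} (hβ : 0 < β) (hr : 0 < r) : (r ^ β) ^ (2 / β) = r ^ 2 := by
  rw [← Real.rpow_mul hr.le, mul_div_cancel₀ _ hβ.ne', ← Real.rpow_natCast]
  norm_num

lemma pow_mul_rpow_two_sub {β r : ℝ} (hr : 0 < r) (l : ℕ) :
    (r ^ β) ^ l * r ^ (2 - (l : ℝ) * β) = r ^ 2 := by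
  rw [← Real.rpow_natCast, ← Real.rpow_mul hr.le, ← Real.rpow_add hr, ← Real.rpow_natCast]
  congr 1; push_cast; ring

/-- With `θ = γ r^β` one has `θ^l θ^(2/β - l) = γ^(2/β) r²`. The bracket is what remains when
`(-r^β)^l` is split off, which is the origin of the sign `(-1)^m` in the closed form. -/
lemma pow_mul_iteratedDeriv_exponent {β δ P lamAP rho γ r : ℝ} (hβ : 0 < β) (hγ : 0 < γ)
    (hr : 0 < r) {l : ℕ} (hl : 1 ≤ l) :
    (γ * r ^ β) ^ l * iteratedDeriv l
      (fun x : ℝ => -(lambdaTwo β lamAP rho * (-x) ^ (2 / β)) + δ ^ 2 / P * x) (-(γ * r ^ β))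
      = (-(r ^ β)) ^ l * bracket β δ P lamAP rho γ l r := by
  have hθ : 0 < γ * r ^ β := by positivity
  have h1 : (γ * r ^ β) ^ l * (γ * r ^ β) ^ (2 / β - (l : ℝ)) = γ ^ (2 / β) * r ^ 2 := by
    rw [← Real.rpow_natCast, ← Real.rpow_add hθ, add_sub_cancel, Real.mul_rpow hγ.le (by positivity),
      rpow_two_div_pow hβ hr]
  have h2 := pow_mul_rpow_two_sub (β := β) hr l
  rw [iteratedDeriv_exponent _ _ _ hl (by linarith), neg_neg, bracket]
  split_ifs with h
  · subst h
    simp only [pow_one, Nat.cast_one, one_mul, Finset.prod_range_one, Nat.cast_zero, sub_zero]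
      at h1 h2 ⊢
    linear_combination lambdaTwo β lamAP rho * (2 / β) * h1
      - lambdaTwo β lamAP rho * (2 / β) * γ ^ (2 / β) * h2
  · rw [neg_pow (r ^ β)]
    linear_combination -lambdaTwo β lamAP rho * (-1) ^ l *
        (∏ j ∈ Finset.range l, (2 / β - (j : ℝ))) * h1
      + lambdaTwo β lamAP rho * (-1) ^ l * γ ^ (2 / β) *
        (∏ j ∈ Finset.range l, (2 / β - (j : ℝ))) * h2

lemma bracket_zero {β δ P lamAP rho r : ℝ} (hβ : 0 < β) (l : ℕ) :
    bracket β δ P lamAP rho 0 l r = 0 := by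
  have : (0 : ℝ) ^ (2 / β) = 0 := Real.zero_rpow (by positivity)
  simp [bracket, this]

/-- The tail of the SINR, given the distance `r` of the typical link. -/
lemma integral_gammaTail {β δ P lamAP rho γ r : ℝ} (hβ : 0 < β) (hγ : 0 ≤ γ) (hr : 0 < r)
    (hJm : Measurable J) (hJ : ∀ ω, 0 ≤ J ω)
    (hL : ∀ x : ℝ, 0 ≤ x → ∫ ω, Real.exp (-(x * J ω)) ∂μ
      = Real.exp (-(lambdaTwo β lamAP rho * x ^ (2 / β)) - x * (δ ^ 2 / P))) (M : ℕ) :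
    ∫ ω, gammaTail M (γ * r ^ β * J ω) ∂μ
      = Real.exp (-(lambdaTwo β lamAP rho * γ ^ (2 / β) * r ^ 2) - γ * r ^ β * δ ^ 2 / P) *
        ∑ m ∈ Finset.range M, (-(r ^ β)) ^ m *
          expCoeff m fun l => bracket β δ P lamAP rho γ l r / l ! := by
  -- For `γ = 0` the derivatives would be taken at the boundary point `0`, which
  -- `integral_gammaTail_of_laplace` does not cover; here only the term `m = 0` survives on either
  -- side.
  rcases hγ.eq_or_lt with rfl | hγ
  · have h0 : (0 : ℝ) ^ (2 / β) = 0 := Real.zero_rpow (by positivity)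
    have h1 : ∀ m ∈ Finset.range M, (-(r ^ β)) ^ m *
        (expCoeff m fun l => bracket β δ P lamAP rho 0 l r / l !) = 0 ^ m / m ! := by
      intro m _
      rcases eq_or_ne m 0 with rfl | hm
      · simp [expCoeff_zero]
      · rw [expCoeff_eq_zero hm fun l _ => by rw [bracket_zero hβ, zero_div], zero_pow hm]
        simp
    rw [Finset.sum_congr rfl h1]
    simp [h0, gammaTail]
  · have hθ : 0 < γ * r ^ β := by positivity
    rw [integral_gammaTail_of_laplace hJm hJ hL M hθ]
    congr 1
    · rw [Real.mul_rpow hγ.le (by positivity), rpow_two_div_pow hβ hr]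
      congr 1; ring
    · refine Finset.sum_congr rfl fun m _ => ?_
      rw [← expCoeff_pow_mul]
      refine expCoeff_congr fun l hl => ?_
      rw [← mul_div_assoc, pow_mul_iteratedDeriv_exponent hβ hγ hr hl, mul_div_assoc]

end Laplace

/-! ### Integrability of the integrands -/

lemma expFactor_le {β δ P lamAP lamSK rho γ r : ℝ} (hP : 0 < P) (hΛ : 0 ≤ lambdaTwo β lamAP rho)
    (hγ : 0 ≤ γ) (hr : 0 < r) :
    expFactor β δ P lamAP lamSK rho γ r ≤ Real.exp (-(Real.pi * lamSK) * r ^ 2) := by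
  refine Real.exp_le_exp.2 ?_
  have h1 : 0 ≤ lambdaTwo β lamAP rho * γ ^ (2 / β) * r ^ 2 := by positivity
  have h2 : 0 ≤ γ * r ^ β * δ ^ 2 / P := by positivity
  linarith

/-- The power `r^(2 - lβ)` can be singular at `0`, but multiplication by `(r^β)^l` leaves only `r²`
and `r^β`. -/
lemma exists_abs_bracket_le (β δ P lamAP rho γ : ℝ) (l : ℕ) :
    ∃ C : ℝ, 0 ≤ C ∧ ∀ r : ℝ, 0 < r →
      |(r ^ β) ^ l * bracket β δ P lamAP rho γ l r| ≤ C * (r ^ 2 + r ^ β) := by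
  by_cases h : l = 1
  · subst h
    set A := lambdaTwo β lamAP rho * (2 / β) * γ ^ (2 / β) with hA
    set B := γ * δ ^ 2 / P with hB
    refine ⟨|A| + |B|, by positivity, fun r hr => ?_⟩
    have h2 := pow_mul_rpow_two_sub (β := β) hr 1
    simp only [Nat.cast_one, one_mul, pow_one] at h2
    have hb : (r ^ β) ^ 1 * bracket β δ P lamAP rho γ 1 r = -(A * r ^ 2 + B * r ^ β) := by
      simp only [bracket, if_true, pow_one]
      rw [← h2]; ring
    rw [hb, abs_neg]
    have hr2 : 0 < r ^ 2 := by positivity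
    have hrb : 0 < r ^ β := by positivity
    calc |A * r ^ 2 + B * r ^ β| ≤ |A * r ^ 2| + |B * r ^ β| := abs_add_le _ _
      _ = |A| * r ^ 2 + |B| * r ^ β := by rw [abs_mul A, abs_mul B, abs_of_pos hr2, abs_of_pos hrb]
      _ ≤ _ := by nlinarith [abs_nonneg A, abs_nonneg B]
  · set A := lambdaTwo β lamAP rho * γ ^ (2 / β) * ∏ j ∈ Finset.range l, (2 / β - (j : ℝ)) with hA
    refine ⟨|A|, by positivity, fun r hr => ?_⟩
    have h2 := pow_mul_rpow_two_sub (β := β) hr l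
    have hb : (r ^ β) ^ l * bracket β δ P lamAP rho γ l r = -(A * r ^ 2) := by
      rw [bracket, if_neg h, ← h2]; ring
    have hrb : 0 < r ^ β := by positivity
    rw [hb, abs_neg, abs_mul, abs_of_pos (by positivity : 0 < r ^ 2)]
    nlinarith [abs_nonneg A]

lemma measurable_bracket (β δ P lamAP rho γ : ℝ) (l : ℕ) :
    Measurable (bracket β δ P lamAP rho γ l) := by
  unfold bracket
  split_ifs <;> fun_prop

lemma measurable_expFactor (β δ P lamAP lamSK rho γ : ℝ) :
    Measurable (expFactor β δ P lamAP lamSK rho γ) := by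
  unfold expFactor
  fun_prop

lemma rpow_mul_add_one {β r : ℝ} (hr : 0 < r) (m : ℕ) :
    r ^ (β * (m : ℝ) + 1) = (r ^ β) ^ m * r := by
  rw [Real.rpow_add hr, Real.rpow_one, Real.rpow_mul hr.le, Real.rpow_natCast]

/-- As `∑ l k_l = m`, the power `(r^β)^m` splits into one `(r^β)^l` for each bracket of index `l`,
which removes the singularities at `0`. At infinity the Gaussian factor `e^{-π lamSK r²}` dominates.
-/
lemma integrableOn_faaIntegrand {β δ P lamAP lamSK rho γ : ℝ} (hβ : 0 < β) (hP : 0 < P)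
    (hSK : 0 < lamSK) (hΛ : 0 ≤ lambdaTwo β lamAP rho) (hγ : 0 ≤ γ) {m : ℕ} {k : Fin m → ℕ}
    (hk : k ∈ multiplicities m) :
    IntegrableOn (faaIntegrand β δ P lamAP lamSK rho γ m k) (Ioi 0) := by
  choose C hC0 hC using exists_abs_bracket_le β δ P lamAP rho γ
  set n := ∑ i, k i with hn
  set K : ℝ := ∏ i : Fin m, C ((i : ℕ) + 1) ^ k i with hK
  have hK0 : 0 ≤ K := Finset.prod_nonneg fun i _ => pow_nonneg (hC0 _) _
  have hb : 0 < Real.pi * lamSK := by positivity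
  have hdom : IntegrableOn (fun r : ℝ => K * 2 ^ n *
      (r ^ ((2 * n + 1 : ℕ) : ℝ) * Real.exp (-(Real.pi * lamSK) * r ^ 2)
        + r ^ (β * n + 1) * Real.exp (-(Real.pi * lamSK) * r ^ 2))) (Ioi 0) := by
    refine ((integrableOn_rpow_mul_exp_neg_mul_sq hb ?_).add
      (integrableOn_rpow_mul_exp_neg_mul_sq hb ?_)).const_mul _
    · exact lt_of_lt_of_le (by norm_num) (Nat.cast_nonneg _)
    · have : 0 ≤ β * n := by positivity
      linarith
  have hm : Measurable (faaIntegrand β δ P lamAP lamSK rho γ m k) := by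
    have h1 := measurable_expFactor β δ P lamAP lamSK rho γ
    have h2 := measurable_bracket β δ P lamAP rho γ
    unfold faaIntegrand
    fun_prop
  refine Integrable.mono' hdom hm.aestronglyMeasurable ?_
  filter_upwards [ae_restrict_mem measurableSet_Ioi] with r hr
  have hr : 0 < r := hr
  have hrb : 0 < r ^ β := by positivity
  have hpow : (r ^ β) ^ m = ∏ i : Fin m, ((r ^ β) ^ ((i : ℕ) + 1)) ^ k i := by
    simp_rw [← pow_mul]
    rw [Finset.prod_pow_eq_pow_sum, mem_multiplicities.1 hk]
  have he : faaIntegrand β δ P lamAP lamSK rho γ m k r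
      = r * expFactor β δ P lamAP lamSK rho γ r *
        ∏ i : Fin m, ((r ^ β) ^ ((i : ℕ) + 1) * bracket β δ P lamAP rho γ ((i : ℕ) + 1) r) ^ k i := by
    simp_rw [mul_pow _ _ (k _)]
    rw [Finset.prod_mul_distrib, ← hpow, faaIntegrand, rpow_mul_add_one hr]
    ring
  have hE0 : 0 ≤ expFactor β δ P lamAP lamSK rho γ r := (Real.exp_pos _).le
  have hprod : |∏ i : Fin m,
      ((r ^ β) ^ ((i : ℕ) + 1) * bracket β δ P lamAP rho γ ((i : ℕ) + 1) r) ^ k i|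
      ≤ K * (r ^ 2 + r ^ β) ^ n := by
    rw [Finset.abs_prod, hK, hn, ← Finset.prod_pow_eq_pow_sum, ← Finset.prod_mul_distrib]
    refine Finset.prod_le_prod (fun i _ => abs_nonneg _) fun i _ => ?_
    rw [abs_pow, ← mul_pow]
    exact pow_le_pow_left₀ (abs_nonneg _) (hC _ r hr) _
  have hadd : (r ^ 2 + r ^ β) ^ n ≤ 2 ^ n * ((r ^ 2) ^ n + (r ^ β) ^ n) := by
    refine (add_pow_le (by positivity) hrb.le n).trans ?_
    gcongr
    · norm_num
    · omega
  rw [he, Real.norm_eq_abs, abs_mul, abs_of_nonneg (by positivity), rpow_mul_add_one hr,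
    Real.rpow_natCast]
  calc _ ≤ r * Real.exp (-(Real.pi * lamSK) * r ^ 2) *
        (K * (2 ^ n * ((r ^ 2) ^ n + (r ^ β) ^ n))) := by
        gcongr
        · exact expFactor_le hP hΛ hγ hr
        · exact hprod.trans (by gcongr)
    _ = _ := by rw [← pow_mul]; ring

/-! ### The closed form -/

lemma expTerm_bracket (β δ P lamAP rho γ r : ℝ) {m : ℕ} (k : Fin m → ℕ) :
    expTerm (fun l => bracket β δ P lamAP rho γ l r / l !) k
      = (1 / ∏ i : Fin m, (((k i)! : ℝ) * ((((i : ℕ) + 1)! : ℕ) : ℝ) ^ k i)) *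
        ∏ i : Fin m, bracket β δ P lamAP rho γ ((i : ℕ) + 1) r ^ k i := by
  rw [expTerm, one_div, ← Finset.prod_inv_distrib, ← Finset.prod_mul_distrib]
  refine Finset.prod_congr rfl fun i _ => ?_
  rw [div_pow, mul_inv]
  ring

/-- The density of the link distance supplies the Gaussian factor that completes `expFactor`, and
its factor `r` turns `(r^β)^m` into `r^(βm + 1)`. -/
lemma linkDensity_mul_eq {β δ P lamAP lamSK rho γ r : ℝ} (hr : 0 < r) (M : ℕ) :
    linkDensity lamSK r *
      (Real.exp (-(lambdaTwo β lamAP rho * γ ^ (2 / β) * r ^ 2) - γ * r ^ β * δ ^ 2 / P) *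
        ∑ m ∈ Finset.range M, (-(r ^ β)) ^ m *
          expCoeff m fun l => bracket β δ P lamAP rho γ l r / l !)
      = ∑ m ∈ Finset.range M, 2 * Real.pi * lamSK * ((1 / (-1 : ℝ) ^ m) *
        ∑ k ∈ multiplicities m,
          (1 / ∏ i : Fin m, (((k i)! : ℝ) * ((((i : ℕ) + 1)! : ℕ) : ℝ) ^ k i)) *
            faaIntegrand β δ P lamAP lamSK rho γ m k r) := by
  have hE : linkDensity lamSK r *
      Real.exp (-(lambdaTwo β lamAP rho * γ ^ (2 / β) * r ^ 2) - γ * r ^ β * δ ^ 2 / P)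
      = 2 * Real.pi * lamSK * (r * expFactor β δ P lamAP lamSK rho γ r) := by
    rw [linkDensity, expFactor, sub_eq_add_neg _ (Real.pi * lamSK * r ^ 2), Real.exp_add]
    ring
  rw [← mul_assoc, hE, Finset.mul_sum]
  refine Finset.sum_congr rfl fun m _ => ?_
  rw [mul_assoc (2 * Real.pi * lamSK), expCoeff]
  congr 1
  simp_rw [Finset.mul_sum]
  refine Finset.sum_congr rfl fun k _ => ?_
  rw [expTerm_bracket, faaIntegrand, rpow_mul_add_one hr, neg_pow]
  have h1 : (1 : ℝ) / (-1) ^ m = (-1) ^ m := by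
    rw [one_div, ← inv_pow]; norm_num
  rw [h1]
  ring

lemma faaIntegrand_zero (β δ P lamAP lamSK rho γ : ℝ) (k : Fin 0 → ℕ) :
    faaIntegrand β δ P lamAP lamSK rho γ 0 k
      = fun r => r * expFactor β δ P lamAP lamSK rho γ r := by
  ext r
  simp [faaIntegrand]

/-- The separate first integral is the term `m = 0`, whose only tuple is the empty one. -/
lemma closedForm_eq {M : ℕ} (hM : 1 ≤ M) (β δ P lamAP lamSK rho γ : ℝ) :
    closedForm M β δ P lamAP lamSK rho γ
      = 1 - ∑ m ∈ Finset.range M, 2 * Real.pi * lamSK * ((1 / (-1 : ℝ) ^ m) *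
        ∑ k ∈ multiplicities m,
          (1 / ∏ i : Fin m, (((k i)! : ℝ) * ((((i : ℕ) + 1)! : ℕ) : ℝ) ^ k i)) *
            ∫ r in Ioi (0 : ℝ), faaIntegrand β δ P lamAP lamSK rho γ m k r) := by
  have h0 : multiplicities 0 = {0} := by
    ext k
    rw [mem_multiplicities]
    simp [Subsingleton.elim k 0]
  obtain ⟨n, rfl⟩ := Nat.exists_eq_add_of_le' hM
  rw [Finset.sum_range_succ', ← Finset.mul_sum, closedForm, Nat.add_sub_cancel, h0,
    Finset.sum_singleton, Finset.range_eq_Ico, Finset.sum_Ico_add' (fun m => (1 / (-1 : ℝ) ^ m) *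
        ∑ k ∈ multiplicities m,
          (1 / ∏ i : Fin m, (((k i)! : ℝ) * ((((i : ℕ) + 1)! : ℕ) : ℝ) ^ k i)) *
            ∫ r in Ioi (0 : ℝ), faaIntegrand β δ P lamAP lamSK rho γ m k r) 0 n 1]
  rw [faaIntegrand_zero, show Finset.Ico (0 + 1) (n + 1) = Finset.Icc 1 n from rfl]
  simp
  ring

lemma integral_sum_faaIntegrand {β δ P lamAP lamSK rho γ : ℝ} (hβ : 0 < β) (hP : 0 < P)
    (hSK : 0 < lamSK) (hΛ : 0 ≤ lambdaTwo β lamAP rho) (hγ : 0 ≤ γ) {M : ℕ} (hM : 1 ≤ M) :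
    IntegrableOn (fun r => ∑ m ∈ Finset.range M, 2 * Real.pi * lamSK * ((1 / (-1 : ℝ) ^ m) *
        ∑ k ∈ multiplicities m,
          (1 / ∏ i : Fin m, (((k i)! : ℝ) * ((((i : ℕ) + 1)! : ℕ) : ℝ) ^ k i)) *
            faaIntegrand β δ P lamAP lamSK rho γ m k r)) (Ioi 0) ∧
    ∫ r in Ioi (0 : ℝ), ∑ m ∈ Finset.range M, 2 * Real.pi * lamSK * ((1 / (-1 : ℝ) ^ m) *
        ∑ k ∈ multiplicities m,
          (1 / ∏ i : Fin m, (((k i)! : ℝ) * ((((i : ℕ) + 1)! : ℕ) : ℝ) ^ k i)) *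
            faaIntegrand β δ P lamAP lamSK rho γ m k r)
      = 1 - closedForm M β δ P lamAP lamSK rho γ := by
  have h1 : ∀ m, ∀ k ∈ multiplicities m, IntegrableOn (fun r =>
      (1 / ∏ i : Fin m, (((k i)! : ℝ) * ((((i : ℕ) + 1)! : ℕ) : ℝ) ^ k i)) *
            faaIntegrand β δ P lamAP lamSK rho γ m k r) (Ioi 0) := fun m k hk =>
    (integrableOn_faaIntegrand hβ hP hSK hΛ hγ hk).const_mul _
  have h2 : ∀ m ∈ Finset.range M, IntegrableOn (fun r => 2 * Real.pi * lamSK *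
      ((1 / (-1 : ℝ) ^ m) * ∑ k ∈ multiplicities m,
          (1 / ∏ i : Fin m, (((k i)! : ℝ) * ((((i : ℕ) + 1)! : ℕ) : ℝ) ^ k i)) *
            faaIntegrand β δ P lamAP lamSK rho γ m k r)) (Ioi 0) := fun m _ =>
    ((integrable_finsetSum _ (h1 m)).const_mul _).const_mul _
  refine ⟨integrable_finsetSum _ h2, ?_⟩
  rw [integral_finsetSum _ h2, closedForm_eq hM, sub_sub_cancel]
  refine Finset.sum_congr rfl fun m _ => ?_
  rw [integral_const_mul, integral_const_mul, integral_finsetSum _ (h1 m)]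
  simp_rw [integral_const_mul]

lemma gammaTail_le_one (M : ℕ) {s : ℝ} (hs : 0 ≤ s) : gammaTail M s ≤ 1 := by
  have : IsProbabilityMeasure (rayleigh M) := inferInstance
  rw [← ENNReal.ofReal_le_one, ← rayleigh_tail M hs]
  exact prob_le_one

lemma IsNetwork.measurable_sinr {Ω : Type*} [MeasurableSpace Ω] {μ : Measure Ω} {M : ℕ}
    {lamAP lamSK rho : ℝ} {X S : ℕ → Ω → Plane} {T : ℕ → Ω → Bool} {G H : ℕ → Ω → Chan M}
    (hnet : IsNetwork μ M lamAP lamSK rho X S T G H)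
    (β δ P : ℝ) (o : Plane) :
    Measurable fun ω => sinr β δ P o (fun i => X i ω) (fun i => S i ω)
      (fun i => T i ω) (fun i => G i ω) (fun i => H i ω) :=
  (SensorNet.measurable_sinr β δ P o).comp (f := config X S T G H) hnet.measurable_config

section Network

variable {Ω : Type*} [MeasurableSpace Ω] {μ : Measure Ω} [IsProbabilityMeasure μ] {M : ℕ}
  {lamAP lamSK rho β : ℝ} {X S : ℕ → Ω → Plane} {T : ℕ → Ω → Bool} {G H : ℕ → Ω → Chan M}

theorem IsNetwork.measure_lt_sinr_eq_closedForm (hnet : IsNetwork μ M lamAP lamSK rho X S T G H)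
    (hM : 1 ≤ M) (hAP : 0 < lamAP) (hSK : 0 < lamSK) (h0 : 0 < rho) (h1 : rho < 1) (hβ : 2 < β)
    {δ P γ : ℝ} (hP : 0 < P) (hγ : 0 ≤ γ) (o : Plane) :
    μ.real {ω | ENNReal.ofReal γ < sinr β δ P o (fun i => X i ω) (fun i => S i ω)
      (fun i => T i ω) (fun i => G i ω) (fun i => H i ω)}
      = 1 - closedForm M β δ P lamAP lamSK rho γ := by
  have hβ0 : 0 < β := by linarith
  have hΛ := (lambdaTwo_pos hAP h0 hβ).le
  set J : Ω → ℝ := fun ω => interferenceNoise β δ P o (config X S T G H ω) with hJ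
  have hJm : Measurable J := (measurable_interferenceNoise β δ P o).comp hnet.measurable_config
  have hJ0 : ∀ ω, 0 ≤ J ω := fun ω => interferenceNoise_nonneg hP o _
  obtain ⟨hint, hval⟩ := integral_sum_faaIntegrand hβ0 hP hSK hΛ hγ (δ := δ) hM
  have hterm : ∀ r ∈ Ioi (0 : ℝ), ENNReal.ofReal (linkDensity lamSK r) *
      ∫⁻ ω, ENNReal.ofReal (gammaTail M (γ * r ^ β * J ω)) ∂μ
      = ENNReal.ofReal (linkDensity lamSK r * ∫ ω, gammaTail M (γ * r ^ β * J ω) ∂μ) := by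
    intro r hr
    have hr : 0 < r := hr
    have hs : ∀ ω, 0 ≤ γ * r ^ β * J ω := fun ω => by have := hJ0 ω; positivity
    have hd : 0 ≤ linkDensity lamSK r := by unfold linkDensity; positivity
    rw [ENNReal.ofReal_mul hd, ofReal_integral_eq_lintegral_ofReal ?_
      (Eventually.of_forall fun ω => gammaTail_nonneg M (hs ω))]
    refine Integrable.of_bound (C := 1)
      ((continuous_gammaTail M).measurable.comp (hJm.const_mul _)).aestronglyMeasurable
      (Eventually.of_forall fun ω => ?_)
    rw [Real.norm_eq_abs, abs_of_nonneg (gammaTail_nonneg M (hs ω))]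
    exact gammaTail_le_one M (hs ω)
  have hterm2 : ∀ r ∈ Ioi (0 : ℝ), linkDensity lamSK r * ∫ ω, gammaTail M (γ * r ^ β * J ω) ∂μ
      = ∑ m ∈ Finset.range M, 2 * Real.pi * lamSK * ((1 / (-1 : ℝ) ^ m) *
        ∑ k ∈ multiplicities m,
          (1 / ∏ i : Fin m, (((k i)! : ℝ) * ((((i : ℕ) + 1)! : ℕ) : ℝ) ^ k i)) *
            faaIntegrand β δ P lamAP lamSK rho γ m k r) := by
    intro r hr
    rw [integral_gammaTail hβ0 hγ hr hJm hJ0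
      (fun x hx => hnet.integral_exp_interferenceNoise hM hAP h0 h1 hβ δ P o hx) M,
      linkDensity_mul_eq hr]
  -- The individual terms may have either sign, but their sum is a density times the mean of a tail.
  -- Its nonnegativity permits the passage from the Lebesgue to the Bochner integral.
  have hnn : ∀ᵐ r ∂(volume.restrict (Ioi (0 : ℝ))), 0 ≤
      ∑ m ∈ Finset.range M, 2 * Real.pi * lamSK * ((1 / (-1 : ℝ) ^ m) *
        ∑ k ∈ multiplicities m,
          (1 / ∏ i : Fin m, (((k i)! : ℝ) * ((((i : ℕ) + 1)! : ℕ) : ℝ) ^ k i)) *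
            faaIntegrand β δ P lamAP lamSK rho γ m k r) := by
    filter_upwards [ae_restrict_mem measurableSet_Ioi] with r hr
    rw [← hterm2 r hr]
    have hr : 0 < r := hr
    have hd : 0 ≤ linkDensity lamSK r := by unfold linkDensity; positivity
    exact mul_nonneg hd (integral_nonneg fun ω => gammaTail_nonneg M
      (by have := hJ0 ω; positivity))
  rw [measureReal_def, hnet.measure_lt_sinr_eq_lintegral hM hAP hSK h0 h1 hβ hP hγ o,
    setLIntegral_congr_fun measurableSet_Ioi
      (fun r hr => (hterm r hr).trans (congrArg ENNReal.ofReal (hterm2 r hr))),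
    ← ofReal_integral_eq_lintegral_ofReal hint hnn,
    ENNReal.toReal_ofReal (integral_nonneg_of_ae hnn), hval]

end Network

end SensorNet

end

/-! ### The distribution function as the complement of the tail -/

theorem lemma3 {Ω : Type*} [MeasurableSpace Ω] (μ : MeasureTheory.Measure Ω)
    [MeasureTheory.IsProbabilityMeasure μ]
    (M : ℕ) (hM : 1 ≤ M)
    (lamAP lamSK rho β δ P : ℝ) (hAP : 0 < lamAP) (hSK : 0 < lamSK)
    (hrho0 : 0 < rho) (hrho1 : rho < 1) (hβ : 2 < β) (hP : 0 < P)
    (o : SensorNet.Plane) (X S : ℕ → Ω → SensorNet.Plane) (T : ℕ → Ω → Bool)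
    (G H : ℕ → Ω → SensorNet.Chan M)
    (hnet : SensorNet.IsNetwork μ M lamAP lamSK rho X S T G H)
    (γsk : Ω → ENNReal)
    (hγsk : ∀ ω, γsk ω = SensorNet.sinr β δ P o (fun i => X i ω) (fun i => S i ω)
      (fun i => T i ω) (fun i => G i ω) (fun i => H i ω)) :
    Measurable γsk ∧
    ∀ γ : ℝ, 0 ≤ γ →
      MeasureTheory.IntegrableOn
        (fun r => r * SensorNet.expFactor β δ P lamAP lamSK rho γ r) (Set.Ioi 0) ∧
      (∀ m ∈ Finset.Icc 1 (M - 1), ∀ k ∈ SensorNet.multiplicities m,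
        MeasureTheory.IntegrableOn
          (SensorNet.faaIntegrand β δ P lamAP lamSK rho γ m k) (Set.Ioi 0)) ∧
      μ.real {ω | γsk ω ≤ ENNReal.ofReal γ}
        = SensorNet.closedForm M β δ P lamAP lamSK rho γ := by

  have hmeas : Measurable γsk := by
    rw [funext hγsk]
    exact hnet.measurable_sinr β δ P o
  have hβ0 : 0 < β := by linarith
  have hΛ := (SensorNet.lambdaTwo_pos hAP hrho0 hβ).le
  refine ⟨hmeas, fun γ hγ => ⟨?_, fun m _ k hk =>
    SensorNet.integrableOn_faaIntegrand hβ0 hP hSK hΛ hγ hk, ?_⟩⟩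
  -- The first integrand is the Faà di Bruno integrand with `m = 0`.
  · have h := SensorNet.integrableOn_faaIntegrand (δ := δ) (m := 0) (k := 0) hβ0 hP hSK hΛ hγ
      (SensorNet.mem_multiplicities.2 (by simp))
    rwa [SensorNet.faaIntegrand_zero] at h
  · have h := hnet.measure_lt_sinr_eq_closedForm hM hAP hSK hrho0 hrho1 hβ (δ := δ) hP hγ o
    have hs : {ω | γsk ω ≤ ENNReal.ofReal γ} = {ω | ENNReal.ofReal γ < γsk ω}ᶜ := by
      ext ω
      simp
    rw [hs, probReal_compl_eq_one_sub (measurableSet_lt measurable_const hmeas)]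
    simp_rw [hγsk]
    rw [h, sub_sub_cancel]
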